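/- Let $f=2r$, let $Q$ be a positive definite integral quadratic form on $\mathbb{Z}^f$ with bilinear form $B$, $2Q(x)=B(x,x)$, and matrix $A$ (so $B(x,y)=x^TAy$); extend $Q$ and $B$ to $\mathbb{C}^f$. Let $N$ be the level of $Q$ (the least positive integer such that $NA^{-1}$ is integral with even diagonal). Let $h_1,\dots,h_n\in\mathbb{Z}^f$ be linearly independent, and let $G=(B(h_i,h_j))_{i,j}$. For a matrix $F$ write $F[x]=x^TFx$. Let $\epsilon(d)=\left(\frac{(-1)^r\det A}{d}\right)$ (Kronecker symbol) for $d\ge 0$ and $\epsilon(-d)=(-1)^r\epsilon(d)$ for $d>0$. For $\gamma=\left(\begin{smallmatrix}a&b\\c&d\end{smallmatrix}\right)$ put $\gamma\tau=\frac{a\tau+b}{c\tau+d}$ and $\gamma z=\frac{z}{c\tau+d}$. Definitions. Let $F$ be a real symmetric positive definite $n\times n$ matrix, $\kappa\in\mathbb{Z}$, and $\chi:\Gamma_0(N)\to\mathbb{C}^*$ a character; let $\phi$ be holomorphic on $\mathbb{H}\times\mathbb{C}^n$. (a) $\phi$ is a *quasi-Jacobi form* of weight $\kappa$, index $F$ and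 character $\chi$ on $\Gamma_0(N)\ltimes(\mathbb{Z}^n\times\mathbb{Z}^n)$ if there are $s\in\mathbb{N}^n$, $t\in\mathbb{N}$ and holomorphic functions $S_{i,j}$, $T_i$ on $\mathbb{H}\times\mathbb{C}^n$ (for multi-indices $i\le s$ and for $j\le t$), depending only on $\phi$, such that for all $(\tau,z)\in\mathbb{H}\times\mathbb{C}^n$, $\gamma\in\Gamma_0(N)$ and $\lambda,\mu\in\mathbb{Z}^n$ $$(c\tau+d)^{-\kappa}\exp\Big(-\frac{2\pi i\,cF[z]}{c\tau+d}\Big)\phi(\gamma\tau,\gamma z)=\chi(\gamma)\sum_{i\le s,\,j\le t}S_{i,j}(\tau,z)\prod_{a=1}^n\Big(\frac{cz_a}{c\tau+d}\Big)^{i_a}\Big(\frac{c}{c\tau+d}\Big)^{j},$$ $$\exp\big(2\pi i(\tau F[\lambda]+2z^TF\lambda)\big)\phi(\tau,z+\lambda\tau+\mu)=\sum_{i\le s}T_i(\tau,z)\lambda_1^{i_1}\cdots\lambda_n^{i_n}.$$ (b) $\phi$ is a *Jacobi form* of weight $\kappa$, index $F$ and character $\chi$ if $$\phi(\gamma\tau,\gamma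 z)=\chi(\gamma)(c\tau+d)^\kappa\exp\Big(\frac{2\pi i\,cF[z]}{c\tau+d}\Big)\phi(\tau,z),\qquad \phi(\tau,z+\lambda\tau+\mu)=\exp\big(-2\pi i(\tau F[\lambda]+2z^TF\lambda)\big)\phi(\tau,z)$$ for all such $\gamma,\lambda,\mu,\tau,z$, and $\phi$ has an expansion $$\phi(\tau,z)=\sum_{\nu\in\mathbb{Z}^n,\ \ell\in\mathbb{Q},\ \ell\ge 0,\ 4\ell-F^{-1}[\nu]\ge 0}c(\ell,\nu)\,q^\ell\exp(2\pi i z^T\nu),\qquad q=e^{2\pi i\tau}.\tag{1}$$ **Theorem 1.** For any $v\in\mathbb{C}^f$ and any natural number $k\ge 0$ the series $$\theta_h(Q,v,k,\tau,z)=\sum_{m\in\mathbb{Z}^f}B(v,m)^k q^{Q(m)}\zeta_1^{B(m,h_1)}\cdots\zeta_n^{B(m,h_n)},\qquad \zeta_j=e^{2\pi i z_j},$$ converges absolutely on $\mathbb{H}\times\mathbb{C}^n$. The map $\gamma\mapsto\epsilon(d)$ is a character of $\Gamma_0(N)$, and $\theta_h(Q,v,k,\cdot,\cdot)$ is a quasi-Jacobi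 form of weight $k+r$, index $G/2$ and character $\epsilon$ on $\Gamma_0(N)\ltimes(\mathbb{Z}^n\times\mathbb{Z}^n)$. It has a Fourier expansion of the form (1) with $F=G/2$ in which only pairs $\ell=Q(m)$, $\nu=(B(m,h_1),\dots,B(m,h_n))$ with $m\in\mathbb{Z}^f$ occur, and all these pairs satisfy $4\ell-(G/2)^{-1}[\nu]\ge 0$. If in addition $Q(v)=0$ and $B(v,h_j)=0$ for all $j$, then for all $\gamma\in\Gamma_0(N)$ and $\lambda,\mu\in\mathbb{Z}^n$ $$\theta_h(Q,v,k,\gamma\tau,\gamma z)=\epsilon(d)\exp\Big(\frac{\pi i\,cG[z]}{c\tau+d}\Big)(c\tau+d)^{k+r}\theta_h(Q,v,k,\tau,z),$$ $$\theta_h(Q,v,k,\tau,z+\lambda\tau+\mu)=\exp\big(-\pi i(G[\lambda]\tau+2z^TG\lambda)\big)\theta_h(Q,v,k,\tau,z),$$ and $\theta_h(Q,v,k,\cdot,\cdot)$ is a Jacobi form of weight $k+r$, index $G/2$ and character $\epsilon$. -/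

import Mathlib

open scoped UpperHalfPlane MatrixGroups

noncomputable section

namespace JacobiTheta

/-! ### Positive definite integral quadratic forms -/

/-- The integral bilinear form `B(x, y) = Q(x + y) - Q(x) - Q(y)`. -/
def bilinZ {f : ℕ} (Q : QuadraticForm ℤ (Fin f → ℤ)) (x y : Fin f → ℤ) : ℤ :=
  QuadraticMap.polar Q x y

/-- The matrix `A` of an integral quadratic form `Q`: `A i j = B(e_i, e_j)`, for the bilinear
form `B(x, y) = Q(x + y) - Q(x) - Q(y)`, so that `2 Q(x) = B(x, x) = xᵀ A x`. -/
def formMatrix {f : ℕ} (Q : QuadraticForm ℤ (Fin f → ℤ)) : Matrix (Fin f) (Fin f) ℤ :=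
  Matrix.of fun i j => bilinZ Q (Pi.single i 1) (Pi.single j 1)

/-- The complex bilinear extension `B(x, y) = xᵀ A y` of the bilinear form of `Q`. -/
def bilinC {f : ℕ} (Q : QuadraticForm ℤ (Fin f → ℤ)) (x y : Fin f → ℂ) : ℂ :=
  x ⬝ᵥ ((formMatrix Q).map (Int.cast : ℤ → ℂ)).mulVec y

/-- The extension of `Q` to complex vectors, `Q(x) = B(x, x) / 2`. -/
def formC {f : ℕ} (Q : QuadraticForm ℤ (Fin f → ℤ)) (x : Fin f → ℂ) : ℂ :=
  bilinC Q x x / 2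

/-- `N` is the level of `Q`: the least positive integer for which the matrix `M = N A⁻¹` has
integral entries and even diagonal entries. -/
def IsLevel {f : ℕ} (Q : QuadraticForm ℤ (Fin f → ℤ)) (N : ℕ) : Prop :=
  IsLeast {K : ℕ | 0 < K ∧ ∃ M : Matrix (Fin f) (Fin f) ℤ,
    formMatrix Q * M = (K : ℤ) • (1 : Matrix (Fin f) (Fin f) ℤ) ∧ ∀ i, Even (M i i)} N

/-- The Kronecker symbol `(a / d)` for a natural number `d`. The symbol `(a / 2)` is `χ₈ a`, that
is `0` for even `a`, `1` for `a ≡ ±1 (mod 8)` and `-1` for `a ≡ ±3 (mod 8)`; and `(a / 0)` is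
`1` for `a = ±1` and `0` otherwise. For odd `d` this is the Jacobi symbol. -/
def kronecker (a : ℤ) (d : ℕ) : ℤ :=
  if d = 0 then (if a.natAbs = 1 then 1 else 0)
  else (d.primeFactorsList.map fun p => if p = 2 then ZMod.χ₈ (a : ZMod 8) else jacobiSym a p).prod

/-- `ε(d) = ((-1)^r det A / d)` for `d ≥ 0`, and `ε(-d) = (-1)^r ε(d)` for `d > 0`. -/
def eps {f : ℕ} (Q : QuadraticForm ℤ (Fin f → ℤ)) (r : ℕ) (d : ℤ) : ℤ :=
  if 0 ≤ d then kronecker ((-1) ^ r * (formMatrix Q).det) d.natAbs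
  else (-1) ^ r * kronecker ((-1) ^ r * (formMatrix Q).det) d.natAbs

/-! ### Jacobi and quasi-Jacobi forms on `ℍ × ℂⁿ` -/

/-- Holomorphic functions on `ℍ × ℂⁿ`. -/
def IsHol {n : ℕ} (φ : ℍ → (Fin n → ℂ) → ℂ) : Prop :=
  DifferentiableOn ℂ (fun p : ℂ × (Fin n → ℂ) => φ (UpperHalfPlane.ofComplex p.1) p.2)
    {p | 0 < p.1.im}

/-- The real number `F[α] = αᵀ F α`. -/
def quadR {n : ℕ} (F : Matrix (Fin n) (Fin n) ℝ) (α : Fin n → ℝ) : ℝ :=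
  α ⬝ᵥ F.mulVec α

/-- The complex number `zᵀ F w`, for a real matrix `F`. -/
def pairC {n : ℕ} (F : Matrix (Fin n) (Fin n) ℝ) (z w : Fin n → ℂ) : ℂ :=
  z ⬝ᵥ (F.map (Complex.ofReal : ℝ → ℂ)).mulVec w

/-- An integral vector as a complex vector. -/
def vecC {n : ℕ} (x : Fin n → ℤ) : Fin n → ℂ := fun j => (x j : ℂ)

/-- The automorphy factor `c τ + d`. -/
def autFactor (γ : SL(2, ℤ)) (τ : ℍ) : ℂ := ((γ 1 0 : ℤ) : ℂ) * (τ : ℂ) + ((γ 1 1 : ℤ) : ℂ)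

/-- The vector `γ z = z / (c τ + d)`. -/
def actZ {n : ℕ} (γ : SL(2, ℤ)) (τ : ℍ) (z : Fin n → ℂ) : Fin n → ℂ :=
  fun j => z j / autFactor γ τ

/-- The vector `z + λ τ + μ`. -/
def shiftZ {n : ℕ} (τ : ℍ) (z : Fin n → ℂ) (l μ : Fin n → ℤ) : Fin n → ℂ :=
  fun j => z j + (l j : ℂ) * (τ : ℂ) + (μ j : ℂ)

/-- `φ(τ, z) = ∑ c(ℓ, ν) q^ℓ exp(2πi zᵀν)`, the sum over the rational `ℓ ≥ 0` and `ν ∈ ℤⁿ` with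
`4 ℓ - F⁻¹[ν] ≥ 0`; the coefficient function is extended by zero to all other `(ℓ, ν)`. -/
def HasJacobiExpansion {n : ℕ} (F : Matrix (Fin n) (Fin n) ℝ) (c : ℚ → (Fin n → ℤ) → ℂ)
    (φ : ℍ → (Fin n → ℂ) → ℂ) : Prop :=
  (∀ (ℓ : ℚ) (ν : Fin n → ℤ), c ℓ ν ≠ 0 →
    0 ≤ ℓ ∧ 0 ≤ 4 * (ℓ : ℝ) - quadR F⁻¹ (fun j => (ν j : ℝ))) ∧
  ∀ (τ : ℍ) (z : Fin n → ℂ),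
    HasSum (fun p : ℚ × (Fin n → ℤ) =>
      c p.1 p.2 * Complex.exp (2 * Real.pi * Complex.I * (p.1 : ℂ) * (τ : ℂ)) *
        Complex.exp (2 * Real.pi * Complex.I * (z ⬝ᵥ vecC p.2))) (φ τ z)

/-- `φ` is a holomorphic Jacobi form of weight `k`, index `F` and character `χ` on `Γ'`. -/
structure IsJacobiForm {n : ℕ} (Γ' : Subgroup SL(2, ℤ)) (χ : Γ' →* ℂˣ) (k : ℤ)
    (F : Matrix (Fin n) (Fin n) ℝ) (φ : ℍ → (Fin n → ℂ) → ℂ) : Prop where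
  index_posDef : F.PosDef
  hol : IsHol φ
  expansion : ∃ c : ℚ → (Fin n → ℤ) → ℂ, HasJacobiExpansion F c φ
  modular : ∀ (γ : Γ') (τ : ℍ) (z : Fin n → ℂ),
    φ ((γ : SL(2, ℤ)) • τ) (actZ γ τ z) =
      (χ γ : ℂ) * autFactor γ τ ^ k *
        Complex.exp (2 * Real.pi * Complex.I *
          ((((γ : SL(2, ℤ)) 1 0 : ℤ) : ℂ) * pairC F z z / autFactor γ τ)) * φ τ z
  elliptic : ∀ (l μ : Fin n → ℤ) (τ : ℍ) (z : Fin n → ℂ),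
    φ τ (shiftZ τ z l μ) =
      Complex.exp (-(2 * Real.pi * Complex.I *
        ((τ : ℂ) * pairC F (vecC l) (vecC l) + 2 * pairC F z (vecC l)))) * φ τ z

/-- `φ` is a quasi-Jacobi form of weight `k`, index `F` and character `χ` on `Γ'`. The
exponents `s`, `t` and the holomorphic coefficients `S`, `T` do not depend on `γ`, `l`, `μ`. -/
structure IsQuasiJacobiForm {n : ℕ} (Γ' : Subgroup SL(2, ℤ)) (χ : Γ' →* ℂˣ) (k : ℤ)
    (F : Matrix (Fin n) (Fin n) ℝ) (φ : ℍ → (Fin n → ℂ) → ℂ) : Prop where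
  index_posDef : F.PosDef
  hol : IsHol φ
  quasi : ∃ (s : Fin n → ℕ) (t : ℕ)
      (S : (Fin n → ℕ) → ℕ → ℍ → (Fin n → ℂ) → ℂ)
      (T : (Fin n → ℕ) → ℍ → (Fin n → ℂ) → ℂ),
    (∀ i j, IsHol (S i j)) ∧ (∀ i, IsHol (T i)) ∧
    (∀ (γ : Γ') (τ : ℍ) (z : Fin n → ℂ),
      autFactor γ τ ^ (-k) *
        Complex.exp (-(2 * Real.pi * Complex.I *
          ((((γ : SL(2, ℤ)) 1 0 : ℤ) : ℂ) * pairC F z z / autFactor γ τ))) *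
        φ ((γ : SL(2, ℤ)) • τ) (actZ γ τ z) =
      (χ γ : ℂ) * ∑ i ∈ Fintype.piFinset (fun a => Finset.range (s a + 1)),
        ∑ j ∈ Finset.range (t + 1),
          S i j τ z *
            (∏ a, ((((γ : SL(2, ℤ)) 1 0 : ℤ) : ℂ) * z a / autFactor γ τ) ^ i a) *
            ((((γ : SL(2, ℤ)) 1 0 : ℤ) : ℂ) / autFactor γ τ) ^ j) ∧
    (∀ (l μ : Fin n → ℤ) (τ : ℍ) (z : Fin n → ℂ),
      Complex.exp (2 * Real.pi * Complex.I *
          ((τ : ℂ) * pairC F (vecC l) (vecC l) + 2 * pairC F z (vecC l))) *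
        φ τ (shiftZ τ z l μ) =
      ∑ i ∈ Fintype.piFinset (fun a => Finset.range (s a + 1)),
        T i τ z * ∏ a, (l a : ℂ) ^ i a)

/-! ### The theta series -/

/-- The summand `B(v, m)^k q^{Q(m)} ζ₁^{B(m, h₁)} ⋯ ζₙ^{B(m, hₙ)}`. -/
def thetaTerm {f n : ℕ} (Q : QuadraticForm ℤ (Fin f → ℤ)) (h : Fin n → Fin f → ℤ)
    (v : Fin f → ℂ) (k : ℕ) (τ : ℍ) (z : Fin n → ℂ) (m : Fin f → ℤ) : ℂ :=
  bilinC Q v (vecC m) ^ k * Complex.exp (2 * Real.pi * Complex.I * (τ : ℂ) * (Q m : ℂ)) *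
    ∏ j, Complex.exp (2 * Real.pi * Complex.I * z j * (bilinZ Q m (h j) : ℂ))

/-- The theta series `θ_h(Q, v, k, τ, z)`. -/
def theta {f n : ℕ} (Q : QuadraticForm ℤ (Fin f → ℤ)) (h : Fin n → Fin f → ℤ)
    (v : Fin f → ℂ) (k : ℕ) (τ : ℍ) (z : Fin n → ℂ) : ℂ :=
  ∑' m : Fin f → ℤ, thetaTerm Q h v k τ z m

/-- The Gram matrix `G = (B(h_i, h_j))`, with real entries. -/
def gram {f n : ℕ} (Q : QuadraticForm ℤ (Fin f → ℤ)) (h : Fin n → Fin f → ℤ) :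
    Matrix (Fin n) (Fin n) ℝ :=
  Matrix.of fun i j => (bilinZ Q (h i) (h j) : ℝ)

end JacobiTheta

end

noncomputable section

namespace JacobiTheta

open Matrix

/-! ### The bilinear form and its extensions -/

section Basics

variable {f : ℕ} (Q : QuadraticForm ℤ (Fin f → ℤ))

/-! Write e(x) = exp(2πix) and J = cτ + d. Everything is read off from one function, Θ(τ, u) = ∑ₘ
e(τQ(m) + B(m, u)) with u in all of ℂ^f (`thetaC`). Along the line u = ∑ zⱼhⱼ + wv the coefficient
of w^k is θ_h(Q, v, k, τ, z) times (2πi)^k / k! (`hasSum_theta`), so one law for Θ gives the modular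
laws for all k by comparing Taylor coefficients in w.

The law for Θ, for γ in Γ₀(N) with c > 0: since γτ = a/c - 1/(cJ), each residue class of ℤ^f modulo
c contributes a constant phase times a Gaussian sum over a translated lattice. Poisson summation
(`poisson_gauss`) turns this into a sum over dual frequencies p weighted by Gauss sums modulo c
(`hasSum_thetaC_moebius`). If N divides c, these vanish unless p lies in Aℤ^f (`gaussQ_eq_zero`),
and at p = Am completing the square cancels the remaining phase. The dual sum is Θ(τ, u) again, so Θ
acquires the factor φ(γ) J^r e(cQ(u)/J) with a constant φ(γ).

To see that φ(γ) = ε(d): φ is multiplicative because Θ(i, 0) ≠ 0. Comparing the laws for γS and S =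
(0 -1; 1 0) as Im τ → ∞ gives φ(γ) d^r = ∑_{x mod d} e(bQ(x)/d) for d > 0
(`IsMultiplier.mul_pow_eq`). For an odd prime d this sum is d^r (D/d) with D = (-1)^r det A, by
diagonalising over the prime field. Right multiplication by translations moves d by multiples of c,
Dirichlet's theorem supplies primes, and so φ depends only on d modulo N. Factoring d gives the
Kronecker symbol; the prime 2, which occurs only for odd N, is traded for N + 2 and handled by
quadratic reciprocity (`jacobiSym_add_two_eq`).

Now Q(u + wv) = Q(u) + wB(u, v) + w²Q(v), so the automorphy factor contributes exp((c/J)(αw + βw²))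
with α = 2πiB(u, v), β = 2πiQ(v). Its Taylor coefficients are polynomials in c/J with holomorphic
coefficients: this is the quasi-modular law, exact when α = β = 0. For the elliptic law replace m by
m + ∑ λⱼhⱼ and expand the power of B(v, m) by the binomial and multinomial theorems. The inequality
for the exponents is Pythagoras: 4ℓ - (G/2)⁻¹[ν] is four times Q of the component of m orthogonal to
the span of the hⱼ. -/

theorem bilinZ_eq (x y : Fin f → ℤ) : bilinZ Q x y = x ⬝ᵥ formMatrix Q *ᵥ y := by
  have h : formMatrix Q = LinearMap.toMatrix₂' ℤ (QuadraticMap.polarBilin Q) := by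
    ext i j
    rw [LinearMap.toMatrix₂'_apply]
    rfl
  rw [h, ← Matrix.toLinearMap₂'_apply', Matrix.toLinearMap₂'_toMatrix']
  rfl

theorem two_mul_form (x : Fin f → ℤ) : 2 * Q x = x ⬝ᵥ formMatrix Q *ᵥ x := by
  rw [← bilinZ_eq, bilinZ, QuadraticMap.polar_self, two_nsmul, two_mul]

theorem formMatrix_transpose : (formMatrix Q)ᵀ = formMatrix Q := by
  ext i j
  exact QuadraticMap.polar_comm _ _ _

theorem form_add (x y : Fin f → ℤ) : Q (x + y) = Q x + Q y + bilinZ Q x y := by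
  simp [bilinZ, QuadraticMap.polar]

theorem form_smul (a : ℤ) (x : Fin f → ℤ) : Q (a • x) = a ^ 2 * Q x := by
  rw [QuadraticMap.map_smul, smul_eq_mul, sq]

theorem bilinZ_smul_right (a : ℤ) (x y : Fin f → ℤ) : bilinZ Q x (a • y) = a * bilinZ Q x y := by
  rw [bilinZ, QuadraticMap.polar_smul_right, smul_eq_mul, bilinZ]

theorem bilinZ_comm (x y : Fin f → ℤ) : bilinZ Q x y = bilinZ Q y x :=
  QuadraticMap.polar_comm _ _ _

theorem cast_dotProduct {R : Type*} [CommRing R] {m : ℕ} (x y : Fin m → ℤ) :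
    ((x ⬝ᵥ y : ℤ) : R) = (fun i => (x i : R)) ⬝ᵥ (fun i => (y i : R)) := by
  simp [dotProduct]

theorem cast_mulVec {R : Type*} [CommRing R] {m n : ℕ} (M : Matrix (Fin m) (Fin n) ℤ)
    (y : Fin n → ℤ) :
    (fun i => ((M *ᵥ y) i : R)) = M.map (Int.cast : ℤ → R) *ᵥ fun i => (y i : R) := by
  ext i
  simp [mulVec, dotProduct]

theorem cast_bilinZ {R : Type*} [CommRing R] (x y : Fin f → ℤ) :
    (bilinZ Q x y : R) =
      (fun i => (x i : R)) ⬝ᵥ (formMatrix Q).map (Int.cast : ℤ → R) *ᵥ fun i => (y i : R) := by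
  rw [bilinZ_eq, cast_dotProduct, cast_mulVec]

theorem bilinC_vecC (x y : Fin f → ℤ) : bilinC Q (vecC x) (vecC y) = bilinZ Q x y :=
  (cast_bilinZ Q x y).symm

theorem cast_form_eq_formC (x : Fin f → ℤ) : (Q x : ℂ) = formC Q (vecC x) := by
  rw [formC, bilinC_vecC, bilinZ_eq, ← two_mul_form]
  push_cast
  ring

theorem bilinC_comm (x y : Fin f → ℂ) : bilinC Q x y = bilinC Q y x := by
  unfold bilinC
  rw [Matrix.dotProduct_mulVec, ← Matrix.mulVec_transpose, ← Matrix.transpose_map,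
    formMatrix_transpose, dotProduct_comm]

theorem bilinC_add_left (x y z : Fin f → ℂ) :
    bilinC Q (x + y) z = bilinC Q x z + bilinC Q y z := by
  simp [bilinC, add_dotProduct]

theorem bilinC_add_right (x y z : Fin f → ℂ) :
    bilinC Q x (y + z) = bilinC Q x y + bilinC Q x z := by
  simp [bilinC, mulVec_add]

theorem bilinC_smul_left (a : ℂ) (x y : Fin f → ℂ) :
    bilinC Q (a • x) y = a * bilinC Q x y := by
  simp [bilinC]

theorem bilinC_smul_right (a : ℂ) (x y : Fin f → ℂ) :
    bilinC Q x (a • y) = a * bilinC Q x y := by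
  simp [bilinC, mulVec_smul]

theorem bilinC_sum_left {ι : Type*} (s : Finset ι) (x : ι → Fin f → ℂ) (y : Fin f → ℂ) :
    bilinC Q (∑ i ∈ s, x i) y = ∑ i ∈ s, bilinC Q (x i) y := by
  simp [bilinC, sum_dotProduct]

theorem bilinC_sum_right {ι : Type*} (s : Finset ι) (y : Fin f → ℂ) (x : ι → Fin f → ℂ) :
    bilinC Q y (∑ i ∈ s, x i) = ∑ i ∈ s, bilinC Q y (x i) := by
  simp only [bilinC_comm Q y, bilinC_sum_left]

theorem formC_add (x y : Fin f → ℂ) :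
    formC Q (x + y) = formC Q x + formC Q y + bilinC Q x y := by
  simp only [formC, bilinC_add_left, bilinC_add_right, bilinC_comm Q y x]
  ring

theorem formC_smul (a : ℂ) (x : Fin f → ℂ) : formC Q (a • x) = a ^ 2 * formC Q x := by
  simp only [formC, bilinC_smul_left, bilinC_smul_right]
  ring

theorem vecC_add (x y : Fin f → ℤ) : vecC (x + y) = vecC x + vecC y := by
  ext i; simp [vecC]

theorem vecC_neg (x : Fin f → ℤ) : vecC (-x) = -vecC x := by
  ext i; simp [vecC]

end Basics

/-! ### Positive definiteness over the reals -/

section PosDef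

variable {f : ℕ} {Q : QuadraticForm ℤ (Fin f → ℤ)}

/-- A singular integral matrix kills a nonzero integral vector, which would be isotropic. -/
theorem det_formMatrix_ne_zero (hQ : Q.PosDef) : (formMatrix Q).det ≠ 0 := by
  intro h
  obtain ⟨v, hv, hv0⟩ := Matrix.exists_mulVec_eq_zero_iff.mpr h
  have h1 := two_mul_form Q v
  rw [hv0, dotProduct_zero] at h1
  have := hQ v hv
  omega

/-- The real matrix of an integral quadratic form. -/
def realMatrix (Q : QuadraticForm ℤ (Fin f → ℤ)) : Matrix (Fin f) (Fin f) ℝ :=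
  (formMatrix Q).map (Int.cast : ℤ → ℝ)

theorem two_mul_form_real (x : Fin f → ℤ) :
    2 * (Q x : ℝ) = (fun i => (x i : ℝ)) ⬝ᵥ realMatrix Q *ᵥ fun i => (x i : ℝ) := by
  rw [realMatrix, ← cast_bilinZ, bilinZ_eq, ← two_mul_form]
  push_cast
  rfl

/-- Clearing denominators gives nonnegativity at rational vectors, and these are dense. Strict
positivity does not survive the limit and is recovered separately from the determinant. -/
theorem realMatrix_nonneg (hQ : Q.PosDef) (x : Fin f → ℝ) : 0 ≤ x ⬝ᵥ realMatrix Q *ᵥ x := by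
  have hd : DenseRange (Pi.map fun (_ : Fin f) (q : ℚ) => (q : ℝ)) :=
    DenseRange.piMap fun _ => Rat.denseRange_cast
  refine hd.induction_on x ?_ fun q => ?_
  · refine isClosed_le continuous_const ?_
    fun_prop
  obtain ⟨b, hb⟩ := IsLocalization.exist_integer_multiples_of_finite (nonZeroDivisors ℤ) q
  choose m hm using hb
  have hb0 : ((b : ℤ) : ℝ) ≠ 0 := by
    have := nonZeroDivisors.coe_ne_zero b
    exact_mod_cast this
  have hx : Pi.map (fun (_ : Fin f) (q : ℚ) => (q : ℝ)) q
      = ((b : ℤ) : ℝ)⁻¹ • fun i => (m i : ℝ) := by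
    ext i
    have h1 : (m i : ℚ) = (b : ℤ) * q i := by
      have := hm i
      simpa using this
    have h2 : (m i : ℝ) = (b : ℤ) * (q i : ℝ) := by exact_mod_cast h1
    simp only [Pi.map_apply, Pi.smul_apply, smul_eq_mul, h2]
    field_simp
  rw [hx, mulVec_smul, dotProduct_smul, smul_dotProduct, ← two_mul_form_real, smul_eq_mul,
    smul_eq_mul, ← mul_assoc]
  have hQm : 0 ≤ Q m := by
    rcases eq_or_ne m 0 with rfl | h
    · simp
    · exact (hQ m h).le
  have : (0 : ℝ) ≤ Q m := by exact_mod_cast hQm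
  exact mul_nonneg (mul_self_nonneg _) (by linarith)

/-- A positive semidefinite matrix with nonzero determinant is positive definite. -/
theorem posDef_realMatrix (hQ : Q.PosDef) : (realMatrix Q).PosDef := by
  have hps : (realMatrix Q).PosSemidef := by
    refine Matrix.PosSemidef.of_dotProduct_mulVec_nonneg ?_ fun x => ?_
    · ext i j
      simp only [realMatrix, conjTranspose_apply, map_apply, star_trivial]
      rw [← formMatrix_transpose Q, transpose_apply, formMatrix_transpose]
    · simpa using realMatrix_nonneg hQ x
  rw [hps.posDef_iff_isUnit, Matrix.isUnit_iff_isUnit_det, isUnit_iff_ne_zero, realMatrix]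
  have := det_formMatrix_ne_zero hQ
  rw [show (formMatrix Q).map (Int.cast : ℤ → ℝ) = (Int.castRingHom ℝ).mapMatrix (formMatrix Q)
    from rfl, ← RingHom.map_det]
  simpa using this

end PosDef

/-! ### Positive definite real matrices -/

section RealMatrix

theorem _root_.Matrix.PosDef.exists_transpose_mul_self {ι : Type*} [Fintype ι] [DecidableEq ι]
    {A : Matrix ι ι ℝ} (hA : A.PosDef) : ∃ B : Matrix ι ι ℝ, A = Bᵀ * B ∧ B.det ≠ 0 := by
  open scoped MatrixOrder in
  obtain ⟨B, hB⟩ := CStarAlgebra.nonneg_iff_eq_star_mul_self.mp hA.posSemidef.nonneg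
  have hB' : A = Bᵀ * B := by rw [hB, star_eq_conjTranspose, conjTranspose_eq_transpose_of_trivial]
  refine ⟨B, hB', fun h => ?_⟩
  have := hA.det_pos
  rw [hB', det_mul, h, mul_zero] at this
  exact lt_irrefl _ this

theorem _root_.Matrix.PosDef.exists_norm_sq_le {ι : Type*} [Fintype ι] [DecidableEq ι]
    {A : Matrix ι ι ℝ} (hA : A.PosDef) :
    ∃ δ : ℝ, 0 < δ ∧ ∀ x : ι → ℝ, δ * ‖x‖ ^ 2 ≤ x ⬝ᵥ A *ᵥ x := by
  obtain ⟨B, rfl, hB⟩ := hA.exists_transpose_mul_self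
  let L : (ι → ℝ) →L[ℝ] (ι → ℝ) := LinearMap.toContinuousLinearMap (Matrix.toLin' B⁻¹)
  -- With L = B⁻¹ one has ‖x‖ ≤ ‖L‖ ‖Bx‖; the added 1 keeps the constant invertible even when L = 0,
  -- in dimension zero.
  refine ⟨((‖L‖ + 1) ^ 2)⁻¹, by positivity, fun x => ?_⟩
  have h1 : L (B *ᵥ x) = x := by
    simp [L, Matrix.mulVec_mulVec, Matrix.nonsing_inv_mul _ (isUnit_iff_ne_zero.mpr hB)]
  have h2 : ‖x‖ ≤ (‖L‖ + 1) * ‖B *ᵥ x‖ := by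
    calc ‖x‖ = ‖L (B *ᵥ x)‖ := by rw [h1]
      _ ≤ ‖L‖ * ‖B *ᵥ x‖ := L.le_opNorm _
      _ ≤ _ := by nlinarith [norm_nonneg (B *ᵥ x)]
  have h3 : ‖B *ᵥ x‖ ^ 2 ≤ (B *ᵥ x) ⬝ᵥ (B *ᵥ x) := by
    have h0 : ∀ y : ι → ℝ, 0 ≤ y ⬝ᵥ y := fun y =>
      Finset.sum_nonneg fun i _ => mul_self_nonneg _
    have : ‖B *ᵥ x‖ ≤ Real.sqrt ((B *ᵥ x) ⬝ᵥ (B *ᵥ x)) := by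
      refine (pi_norm_le_iff_of_nonneg (Real.sqrt_nonneg _)).mpr fun i => ?_
      refine Real.abs_le_sqrt ?_
      rw [sq]
      exact Finset.single_le_sum (f := fun i => (B *ᵥ x) i * (B *ᵥ x) i)
        (fun i _ => mul_self_nonneg _) (Finset.mem_univ i)
    calc _ ≤ (Real.sqrt ((B *ᵥ x) ⬝ᵥ (B *ᵥ x))) ^ 2 := by gcongr
      _ = _ := Real.sq_sqrt (h0 _)
  have h4 : x ⬝ᵥ (Bᵀ * B) *ᵥ x = (B *ᵥ x) ⬝ᵥ (B *ᵥ x) := by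
    rw [← mulVec_mulVec, dotProduct_mulVec, vecMul_transpose]
  rw [h4, inv_mul_le_iff₀ (by positivity)]
  calc ‖x‖ ^ 2 ≤ ((‖L‖ + 1) * ‖B *ᵥ x‖) ^ 2 := by gcongr
    _ = (‖L‖ + 1) ^ 2 * ‖B *ᵥ x‖ ^ 2 := by ring
    _ ≤ _ := by gcongr

end RealMatrix

/-! ### Summability of Gaussian series -/

section Summable

theorem summable_exp_neg_abs_int : Summable fun m : ℤ => Real.exp (-|(m : ℝ)|) := by
  have h : Summable fun n : ℕ => Real.exp (-(n : ℝ)) := Real.summable_exp_neg_nat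
  refine Summable.of_nat_of_neg ?_ ?_
  · simpa using h
  · simpa using h

theorem summable_exp_neg_sum_abs (f : ℕ) :
    Summable fun m : Fin f → ℤ => Real.exp (-∑ i, |(m i : ℝ)|) := by
  induction f with
  | zero => exact Summable.of_finite
  | succ f ih =>
    rw [← (Fin.consEquiv fun _ => ℤ).summable_iff]
    refine (summable_exp_neg_abs_int.mul_of_nonneg ih (fun _ => (Real.exp_pos _).le)
      fun _ => (Real.exp_pos _).le).congr fun p => ?_
    simp [Fin.sum_univ_succ, Fin.consEquiv, ← Real.exp_add, add_comm]

/-- The quadratic decay beats every linear exponent, so the terms are dominated by a product of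
one-dimensional geometric series. -/
theorem summable_gaussian {f : ℕ} {δ : ℝ} (hδ : 0 < δ) (R : ℝ) (k : ℕ) :
    Summable fun m : Fin f → ℤ =>
      (1 + ‖m‖) ^ k * Real.exp (-δ * ‖m‖ ^ 2 + R * ‖m‖) := by
  -- R is the given linear growth, f pays for ∑ |mᵢ| ≤ f‖m‖, and 1 pays for bounding the polynomial
  -- factor by a multiple of exp(1 + ‖m‖).
  let K := R + f + 1
  refine Summable.of_nonneg_of_le (fun m => by positivity) (fun m => ?_)
    ((summable_exp_neg_sum_abs f).mul_left (k.factorial * Real.exp (1 + K ^ 2 / (4 * δ))))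
  have h1 : (1 + ‖m‖) ^ k ≤ k.factorial * Real.exp (1 + ‖m‖) := by
    have := Real.pow_div_factorial_le_exp (1 + ‖m‖) (by positivity) k
    rwa [div_le_iff₀ (by positivity), mul_comm] at this
  have h2 : ∑ i, |(m i : ℝ)| ≤ f * ‖m‖ := by
    calc ∑ i, |(m i : ℝ)| ≤ ∑ _i : Fin f, ‖m‖ := by
          refine Finset.sum_le_sum fun i _ => ?_
          rw [← Int.norm_eq_abs]
          exact norm_le_pi_norm m i
      _ = _ := by simp
  have h3 : -δ * ‖m‖ ^ 2 + K * ‖m‖ ≤ K ^ 2 / (4 * δ) := by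
    rw [le_div_iff₀ (by positivity)]
    nlinarith [sq_nonneg (2 * δ * ‖m‖ - K)]
  calc (1 + ‖m‖) ^ k * Real.exp (-δ * ‖m‖ ^ 2 + R * ‖m‖)
      ≤ k.factorial * Real.exp (1 + ‖m‖) * Real.exp (-δ * ‖m‖ ^ 2 + R * ‖m‖) := by gcongr
    _ ≤ k.factorial * Real.exp (1 + K ^ 2 / (4 * δ)) * Real.exp (-∑ i, |(m i : ℝ)|) := by
      rw [mul_assoc, mul_assoc, ← Real.exp_add, ← Real.exp_add]
      refine mul_le_mul_of_nonneg_left (Real.exp_le_exp.mpr ?_) (by positivity)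
      have : K * ‖m‖ = R * ‖m‖ + f * ‖m‖ + ‖m‖ := by simp only [K]; ring
      linarith

end Summable


open Matrix MeasureTheory

/-! ### Poisson summation in several variables -/

section Poisson

variable {f : ℕ}

/-- The function `x ↦ exp (2πi x)`. -/
def expI (x : ℂ) : ℂ := Complex.exp (2 * Real.pi * Complex.I * x)

theorem expI_add (x y : ℂ) : expI (x + y) = expI x * expI y := by
  rw [expI, mul_add, Complex.exp_add]; rfl

theorem expI_zero : expI 0 = 1 := by simp [expI]

theorem expI_neg (x : ℂ) : expI (-x) = (expI x)⁻¹ := by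
  rw [expI, mul_neg, Complex.exp_neg]; rfl

theorem expI_int (n : ℤ) : expI n = 1 := by
  rw [expI, mul_comm, Complex.exp_int_mul_two_pi_mul_I]

theorem expI_ne_zero (x : ℂ) : expI x ≠ 0 := Complex.exp_ne_zero _

theorem expI_add_int (x : ℂ) (n : ℤ) : expI (x + n) = expI x := by
  rw [expI_add, expI_int, mul_one]

theorem norm_expI (x : ℂ) : ‖expI x‖ = Real.exp (-(2 * Real.pi * x.im)) := by
  rw [expI, Complex.norm_exp]
  congr 1
  simp

theorem norm_expI_ofReal (x : ℝ) : ‖expI x‖ = 1 := by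
  simp [norm_expI]

theorem mFourier_coe (p : Fin f → ℤ) (x : Fin f → ℝ) :
    UnitAddTorus.mFourier p (fun i => (x i : UnitAddCircle)) =
      expI (∑ i, (p i : ℂ) * (x i : ℂ)) := by
  simp only [UnitAddTorus.mFourier, ContinuousMap.coe_mk, fourier_coe_apply, expI,
    ← Complex.exp_sum]
  congr 1
  rw [Finset.mul_sum]
  refine Finset.sum_congr rfl fun i _ => ?_
  push_cast
  ring

/-- An integral vector as a real vector. -/
def vecR (n : Fin f → ℤ) : Fin f → ℝ := fun i => (n i : ℝ)

theorem vecR_add (m n : Fin f → ℤ) : vecR (m + n) = vecR m + vecR n := by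
  ext i; simp [vecR]

theorem norm_vecR (n : Fin f → ℤ) : ‖vecR n‖ = ‖n‖ := by
  simp [vecR, Pi.norm_def]
  congr

/-- The unit box with corner `n`. -/
def unitBox (n : Fin f → ℤ) : Set (Fin f → ℝ) := {x | ∀ i, x i ∈ Set.Ioc (n i : ℝ) (n i + 1)}

theorem unitBox_eq_pi (n : Fin f → ℤ) :
    unitBox n = Set.univ.pi fun i => Set.Ioc (n i : ℝ) (n i + 1) := by
  ext x; simp [unitBox]

theorem measurableSet_unitBox (n : Fin f → ℤ) : MeasurableSet (unitBox n) := by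
  rw [unitBox_eq_pi]
  exact MeasurableSet.univ_pi fun _ => measurableSet_Ioc

theorem norm_le_of_mem_unitBox {x : Fin f → ℝ} (hx : x ∈ unitBox (0 : Fin f → ℤ)) : ‖x‖ ≤ 1 := by
  refine (pi_norm_le_iff_of_nonneg zero_le_one).mpr fun i => ?_
  have := hx i
  simp only [Pi.zero_apply, Int.cast_zero, zero_add] at this
  rw [Real.norm_eq_abs, abs_le]
  constructor <;> linarith [this.1, this.2]

theorem hasSum_setIntegral_unitBox {h : (Fin f → ℝ) → ℂ} (hh : Integrable h) :
    HasSum (fun n : Fin f → ℤ => ∫ x in unitBox 0, h (x + vecR n)) (∫ x, h x) := by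
  have hU : (⋃ n : Fin f → ℤ, unitBox n) = Set.univ := by
    -- The boxes are open on the left and closed on the right, so the corner is the ceiling minus
    -- one, not the floor.
    refine Set.eq_univ_of_forall fun x => Set.mem_iUnion.mpr ⟨fun i => ⌈x i⌉ - 1, fun i => ?_⟩
    push_cast
    constructor
    · linarith [Int.ceil_lt_add_one (x i)]
    · linarith [Int.le_ceil (x i)]
  have hdisj : Pairwise (Function.onFun Disjoint (unitBox : (Fin f → ℤ) → Set (Fin f → ℝ))) := by
    intro m n hmn
    refine Set.disjoint_left.mpr fun x hm hn => hmn (funext fun i => ?_)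
    have h1 := hm i
    have h2 := hn i
    have h3 : (m i : ℝ) < n i + 1 := h1.1.trans_le h2.2
    have h4 : (n i : ℝ) < m i + 1 := h2.1.trans_le h1.2
    have h3' : m i < n i + 1 := by exact_mod_cast h3
    have h4' : n i < m i + 1 := by exact_mod_cast h4
    omega
  have key := hasSum_integral_iUnion (μ := volume) (f := h) measurableSet_unitBox hdisj
    hh.integrableOn
  rw [hU, Measure.restrict_univ] at key
  suffices hk : ∀ n : Fin f → ℤ, ∫ x in unitBox 0, h (x + vecR n) = ∫ x in unitBox n, h x by
    simpa only [hk] using key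
  intro n
  have hpre : (fun x : Fin f → ℝ => x + vecR n) ⁻¹' unitBox n = unitBox 0 := by
    ext x
    simp only [unitBox, Set.mem_preimage, Set.mem_ofPred_eq, Pi.add_apply, vecR, Set.mem_Ioc,
      Pi.zero_apply, Int.cast_zero, zero_add]
    refine forall_congr' fun i => ⟨fun h => ⟨?_, ?_⟩, fun h => ⟨?_, ?_⟩⟩ <;> linarith [h.1, h.2]
  have := (measurePreserving_add_right (volume : Measure (Fin f → ℝ))
    (vecR n)).setIntegral_preimage_emb (MeasurableEquiv.addRight (vecR n)).measurableEmbedding h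
    (unitBox n)
  rw [hpre] at this
  exact this

/-- The convergence is uniform on balls, and a ball of radius ‖x‖ + 1 is a neighbourhood of x. -/
theorem continuous_tsum_translates {g : (Fin f → ℝ) → ℂ} (hg : Continuous g)
    (hbound : ∀ R : ℝ, ∃ u : (Fin f → ℤ) → ℝ, Summable u ∧
      ∀ n x, ‖x‖ ≤ R → ‖g (x + vecR n)‖ ≤ u n) :
    Continuous fun x => ∑' n : Fin f → ℤ, g (x + vecR n) := by
  rw [continuous_iff_continuousAt]
  intro x
  obtain ⟨u, hu, hle⟩ := hbound (‖x‖ + 1)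
  have h : ContinuousOn (fun x => ∑' n : Fin f → ℤ, g (x + vecR n))
      (Metric.closedBall 0 (‖x‖ + 1)) := by
    refine continuousOn_tsum (fun n => ?_) hu fun n y hy => hle n y (by simpa using hy)
    fun_prop
  refine h.continuousAt (Metric.closedBall_mem_nhds_of_mem ?_)
  simp

/-- The periodisation of g descends to a continuous function on the torus, whose Fourier
coefficients unfold to values of the Fourier transform of g at integral frequencies. Absolute
summability of the coefficients makes the Fourier series converge to the function at every point. -/
theorem hasSum_poisson {g : (Fin f → ℝ) → ℂ} (hg : Continuous g) (hint : Integrable g)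
    (hbound : ∀ R : ℝ, ∃ u : (Fin f → ℤ) → ℝ, Summable u ∧
      ∀ n x, ‖x‖ ≤ R → ‖g (x + vecR n)‖ ≤ u n)
    (hsum : Summable fun p : Fin f → ℤ =>
      ∫ x : Fin f → ℝ, expI (-∑ i, (p i : ℂ) * (x i : ℂ)) * g x) (x : Fin f → ℝ) :
    HasSum (fun p : Fin f → ℤ =>
      (∫ x : Fin f → ℝ, expI (-∑ i, (p i : ℂ) * (x i : ℂ)) * g x) *
        expI (∑ i, (p i : ℂ) * (x i : ℂ)))
      (∑' n : Fin f → ℤ, g (x + vecR n)) := by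
  set F : (Fin f → ℝ) → ℂ := fun x => ∑' n : Fin f → ℤ, g (x + vecR n) with hF
  have hFc : Continuous F := continuous_tsum_translates hg hbound
  have hper : ∀ x (m : Fin f → ℤ), F (x + vecR m) = F x := by
    intro x m
    simp only [hF]
    rw [← (Equiv.addLeft m).tsum_eq fun n => g (x + vecR n)]
    simp only [Equiv.coe_addLeft, vecR_add, add_assoc]
  -- A product of open quotient maps is a quotient map, so a continuous periodic function on ℝ^f
  -- induces a continuous function on the torus.
  let q : C(Fin f → ℝ, UnitAddTorus (Fin f)) :=
    ⟨Pi.map fun _ (t : ℝ) => (t : UnitAddCircle),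
      (IsOpenQuotientMap.piMap fun _ => QuotientAddGroup.isOpenQuotientMap_mk).continuous⟩
  have hq : Topology.IsQuotientMap q :=
    (IsOpenQuotientMap.piMap fun _ => QuotientAddGroup.isOpenQuotientMap_mk).isQuotientMap
  have hfac : Function.FactorsThrough (⟨F, hFc⟩ : C(Fin f → ℝ, ℂ)) q := by
    intro a b hab
    have h1 : ∀ i, ∃ m : ℤ, b i = a i + m := by
      intro i
      have h2 : ((a i : ℝ) : UnitAddCircle) = (b i : ℝ) := congrFun hab i
      have h3 := QuotientAddGroup.eq.mp h2
      obtain ⟨m, hm⟩ := AddSubgroup.mem_zmultiples_iff.mp h3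
      refine ⟨m, ?_⟩
      simp only [zsmul_eq_mul, mul_one] at hm
      linarith
    choose m hm using h1
    have : b = a + vecR m := funext hm
    simp only [ContinuousMap.coe_mk, this, hper]
  let Φ : C(UnitAddTorus (Fin f), ℂ) := hq.lift ⟨F, hFc⟩ hfac
  have hΦ : ∀ x : Fin f → ℝ, Φ (fun i => (x i : UnitAddCircle)) = F x := fun x => by
    have := hq.lift_comp ⟨F, hFc⟩ hfac
    exact DFunLike.congr_fun this x
  have hcoef : ∀ p, UnitAddTorus.mFourierCoeff Φ p =
      ∫ x : Fin f → ℝ, expI (-∑ i, (p i : ℂ) * (x i : ℂ)) * g x := by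
    intro p
    rw [UnitAddTorus.mFourierCoeff_eq_integral _ _ 0]
    have hbox : {x : Fin f → ℝ | ∀ i, x i ∈ Set.Ioc ((0 : Fin f → ℝ) i) ((0 : Fin f → ℝ) i + 1)}
        = unitBox 0 := by
      ext x; simp [unitBox]
    have hexp : ∀ x : Fin f → ℝ, (∑ i, ((-p) i : ℂ) * (x i : ℂ)) =
        -∑ i, (p i : ℂ) * (x i : ℂ) := fun x => by simp
    rw [hbox]
    simp only [mFourier_coe, hΦ, Pi.neg_apply, Int.cast_neg, neg_mul, Finset.sum_neg_distrib,
      smul_eq_mul]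
    have hnorm : ∀ x : Fin f → ℝ, ‖expI (-∑ i, (p i : ℂ) * (x i : ℂ))‖ = 1 := fun x => by
      rw [show -∑ i, (p i : ℂ) * (x i : ℂ) = ((-∑ i, (p i : ℝ) * x i : ℝ) : ℂ) by push_cast; rfl,
        norm_expI_ofReal]
    have hcont : Continuous fun x : Fin f → ℝ => expI (-∑ i, (p i : ℂ) * (x i : ℂ)) * g x := by
      unfold expI
      fun_prop
    have hi : Integrable fun x : Fin f → ℝ => expI (-∑ i, (p i : ℂ) * (x i : ℂ)) * g x := by
      refine hint.mono hcont.aestronglyMeasurable (Filter.Eventually.of_forall fun x => ?_)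
      rw [norm_mul, hnorm, one_mul]
    have h1 := hasSum_setIntegral_unitBox hi
    obtain ⟨u, hu, hle⟩ := hbound 1
    have hfin : volume (unitBox (0 : Fin f → ℤ)) < ⊤ := by
      refine lt_of_le_of_lt (measure_mono (t := Metric.closedBall 0 1) fun x hx => ?_)
        (measure_closedBall_lt_top)
      simpa using norm_le_of_mem_unitBox hx
    have : IsFiniteMeasure (volume.restrict (unitBox (0 : Fin f → ℤ))) := ⟨by simpa using hfin⟩
    -- The exponential is ℤ^f-periodic, so it can be taken out of the sum over translates.
    have hshift : ∀ (x : Fin f → ℝ) (n : Fin f → ℤ),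
        expI (-∑ i, (p i : ℂ) * ((x + vecR n) i : ℂ)) = expI (-∑ i, (p i : ℂ) * (x i : ℂ)) := by
      intro x n
      rw [← expI_add_int _ (∑ i, p i * n i)]
      congr 1
      push_cast
      simp only [Pi.add_apply, vecR, Complex.ofReal_add, Complex.ofReal_intCast, mul_add,
        Finset.sum_add_distrib]
      ring
    have hmem : ∀ᵐ x ∂(volume.restrict (unitBox (0 : Fin f → ℤ))), ‖x‖ ≤ 1 :=
      (ae_restrict_iff' (measurableSet_unitBox _)).mpr
        (Filter.Eventually.of_forall fun x hx => norm_le_of_mem_unitBox hx)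
    have h2 : HasSum (fun n : Fin f → ℤ => ∫ x in unitBox 0,
        (expI (-∑ i, (p i : ℂ) * ((x + vecR n) i : ℂ)) * g (x + vecR n)))
        (∫ x in unitBox 0, expI (-∑ i, (p i : ℂ) * (x i : ℂ)) * F x) := by
      refine hasSum_integral_of_dominated_convergence (fun n _ => u n) (fun n => ?_) (fun n => ?_)
        (Filter.Eventually.of_forall fun _ => hu) (integrable_const _) ?_
      · exact (hcont.comp (continuous_id.add continuous_const)).aestronglyMeasurable
      · filter_upwards [hmem] with x hx
        rw [hshift, norm_mul, hnorm, one_mul]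
        exact hle n x hx
      · filter_upwards [hmem] with x hx
        simp only [hshift]
        exact (Summable.of_norm_bounded hu fun n => hle n x hx).hasSum.mul_left _
    -- The same series over boxes computes the integral over one period, by dominated convergence,
    -- and the integral over ℝ^f, by countable additivity.
    exact h2.unique h1
  have hs : Summable (UnitAddTorus.mFourierCoeff Φ) := by
    rw [show UnitAddTorus.mFourierCoeff Φ = _ from funext hcoef]
    exact hsum
  have := UnitAddTorus.hasSum_mFourier_series_apply_of_summable hs fun i => (x i : UnitAddCircle)
  simpa only [hΦ, hcoef, mFourier_coe, smul_eq_mul] using this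

end Poisson

/-! ### Gaussian functions attached to a positive definite matrix -/

section Gaussian

variable {f : ℕ}

/-- The complex bilinear form attached to a real matrix. -/
def matC (A : Matrix (Fin f) (Fin f) ℝ) (x y : Fin f → ℂ) : ℂ :=
  x ⬝ᵥ A.map (Complex.ofReal : ℝ → ℂ) *ᵥ y

/-- The function `x ↦ exp (-π s xᵀAx + 2πi wᵀx)`. -/
def gauss (A : Matrix (Fin f) (Fin f) ℝ) (s : ℂ) (w : Fin f → ℂ) (x : Fin f → ℝ) : ℂ :=
  Complex.exp (-(Real.pi * s * ((x ⬝ᵥ A *ᵥ x : ℝ) : ℂ))) * expI (∑ i, w i * (x i : ℂ))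

theorem continuous_gauss (A : Matrix (Fin f) (Fin f) ℝ) (s : ℂ) (w : Fin f → ℂ) :
    Continuous (gauss A s w) := by
  unfold gauss expI
  have : Continuous fun x : Fin f → ℝ => x ⬝ᵥ A *ᵥ x := by fun_prop
  fun_prop

theorem norm_gauss_le {A : Matrix (Fin f) (Fin f) ℝ} {δ : ℝ}
    (hδ : ∀ x : Fin f → ℝ, δ * ‖x‖ ^ 2 ≤ x ⬝ᵥ A *ᵥ x) {s : ℂ} (hs : 0 < s.re) (w : Fin f → ℂ)
    (x : Fin f → ℝ) :
    ‖gauss A s w x‖ ≤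
      Real.exp (-(Real.pi * s.re * δ) * ‖x‖ ^ 2 + 2 * Real.pi * (∑ i, ‖w i‖) * ‖x‖) := by
  rw [gauss, norm_mul, norm_expI, Complex.norm_exp, ← Real.exp_add, Real.exp_le_exp]
  have h1 : (-(Real.pi * s * ((x ⬝ᵥ A *ᵥ x : ℝ) : ℂ))).re =
      -(Real.pi * s.re) * (x ⬝ᵥ A *ᵥ x) := by simp
  have h2 : |(∑ i, w i * (x i : ℂ)).im| ≤ (∑ i, ‖w i‖) * ‖x‖ := by
    refine (Complex.abs_im_le_norm _).trans ((norm_sum_le _ _).trans ?_)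
    rw [Finset.sum_mul]
    refine Finset.sum_le_sum fun i _ => ?_
    rw [norm_mul, Complex.norm_real]
    gcongr
    exact norm_le_pi_norm x i
  rw [h1]
  have h3 := mul_le_mul_of_nonneg_left (hδ x) (mul_pos Real.pi_pos hs).le
  have h4 := mul_le_mul_of_nonneg_left (neg_le_of_abs_le h2) (by positivity : 0 ≤ 2 * Real.pi)
  linarith

/-- A bounded translation only costs a linear term in the exponent: ‖x + n‖² ≥ ‖n‖² - 2R‖n‖ when ‖x‖
≤ R, which accounts for the coefficient 2Ra + C below. -/
theorem gauss_bound {A : Matrix (Fin f) (Fin f) ℝ} (hA : A.PosDef) {s : ℂ} (hs : 0 < s.re)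
    (w : Fin f → ℂ) (R : ℝ) : ∃ u : (Fin f → ℤ) → ℝ, Summable u ∧
      ∀ n x, ‖x‖ ≤ R → ‖gauss A s w (x + vecR n)‖ ≤ u n := by
  obtain ⟨δ, hδ, hle⟩ := hA.exists_norm_sq_le
  set a := Real.pi * s.re * δ with ha
  have ha0 : 0 < a := by have := Real.pi_pos; positivity
  set C := 2 * Real.pi * ∑ i, ‖w i‖ with hC
  have hC0 : 0 ≤ C := by have := Real.pi_pos; positivity
  refine ⟨fun n => Real.exp (C * R) * ((1 + ‖n‖) ^ 0 *
    Real.exp (-a * ‖n‖ ^ 2 + (2 * R * a + C) * ‖n‖)),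
    (summable_gaussian ha0 _ 0).mul_left _, fun n x hx => ?_⟩
  refine (norm_gauss_le hle hs w _).trans ?_
  simp only [pow_zero, one_mul]
  rw [← Real.exp_add, Real.exp_le_exp]
  have h1 : ‖x + vecR n‖ ≤ ‖n‖ + R := by
    have := norm_add_le x (vecR n)
    rw [norm_vecR] at this
    linarith
  have h2 : ‖n‖ ≤ ‖x + vecR n‖ + R := by
    have := norm_sub_le (x + vecR n) x
    rw [add_sub_cancel_left, norm_vecR] at this
    linarith
  have h3 : ‖n‖ ^ 2 - 2 * R * ‖n‖ ≤ ‖x + vecR n‖ ^ 2 := by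
    have hR : 0 ≤ R := (norm_nonneg x).trans hx
    rcases le_total ‖n‖ (2 * R) with h | h
    · nlinarith [norm_nonneg n, sq_nonneg ‖x + vecR n‖]
    · nlinarith [norm_nonneg n, norm_nonneg (x + vecR n)]
  have h4 := mul_le_mul_of_nonneg_left h3 ha0.le
  have h5 := mul_le_mul_of_nonneg_left h1 hC0
  nlinarith

theorem summable_gauss {A : Matrix (Fin f) (Fin f) ℝ} (hA : A.PosDef) {s : ℂ} (hs : 0 < s.re)
    (w : Fin f → ℂ) : Summable fun n : Fin f → ℤ => gauss A s w (vecR n) := by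
  obtain ⟨u, hu, hle⟩ := gauss_bound hA hs w 0
  refine Summable.of_norm_bounded hu fun n => ?_
  simpa using hle n 0 (by simp)

/-- With A = BᵀB the substitution y = Bx turns the quadratic form into a sum of squares, and the
linear form into one with coefficients transformed by the transposed inverse of B. -/
theorem gauss_eq_comp {B : Matrix (Fin f) (Fin f) ℝ} (hB : B.det ≠ 0) (s : ℂ) (w : Fin f → ℂ)
    (x : Fin f → ℝ) :
    gauss (Bᵀ * B) s w x = Complex.exp (-(Real.pi * s) * ∑ i, ((Matrix.toLin' B x) i : ℂ) ^ 2 +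
      ∑ i, (2 * Real.pi * Complex.I * ∑ j, (B⁻¹ j i : ℂ) * w j) * ((Matrix.toLin' B x) i : ℂ)) := by
  rw [gauss, expI, Complex.exp_add, toLin'_apply]
  congr 2
  · rw [← mulVec_mulVec, dotProduct_mulVec, vecMul_transpose, dotProduct]
    push_cast
    rw [neg_mul]
    congr 2
    exact Finset.sum_congr rfl fun i _ => (sq _).symm
  · have h1 : ∀ j, (x j : ℂ) = ∑ i, (B⁻¹ j i : ℂ) * ((B *ᵥ x) i : ℂ) := by
      intro j
      have : x = B⁻¹ *ᵥ (B *ᵥ x) := by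
        rw [mulVec_mulVec, nonsing_inv_mul _ (isUnit_iff_ne_zero.mpr hB), one_mulVec]
      conv_lhs => rw [this]
      simp only [mulVec, dotProduct]
      push_cast
      rfl
    conv_lhs => rw [Finset.sum_congr rfl fun j _ => by rw [h1 j, Finset.mul_sum]]
    rw [Finset.sum_comm, Finset.mul_sum]
    refine Finset.sum_congr rfl fun i _ => ?_
    rw [mul_assoc (2 * Real.pi * Complex.I : ℂ), Finset.sum_mul]
    congr 1
    refine Finset.sum_congr rfl fun j _ => ?_
    ring

theorem integrable_gauss {A : Matrix (Fin f) (Fin f) ℝ} (hA : A.PosDef) {s : ℂ} (hs : 0 < s.re)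
    (w : Fin f → ℂ) : Integrable (gauss A s w) := by
  obtain ⟨B, rfl, hB⟩ := hA.exists_transpose_mul_self
  have hb : 0 < (Real.pi * s : ℂ).re := by
    simpa using mul_pos Real.pi_pos hs
  have h := GaussianFourier.integrable_cexp_neg_mul_sum_add hb
    fun i => 2 * Real.pi * Complex.I * ∑ j, (B⁻¹ j i : ℂ) * w j
  rw [show gauss (Bᵀ * B) s w = _ from funext (gauss_eq_comp hB s w)]
  have h2 : Integrable (fun v : Fin f → ℝ => Complex.exp (-(Real.pi * s) * ∑ i, (v i : ℂ) ^ 2 +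
      ∑ i, (2 * Real.pi * Complex.I * ∑ j, (B⁻¹ j i : ℂ) * w j) * (v i : ℂ)))
      (Measure.map (Matrix.toLin' B) volume) := by
    rw [Real.map_matrix_volume_pi_eq_smul_volume_pi hB]
    exact h.smul_measure ENNReal.ofReal_ne_top
  exact h2.comp_measurable (LinearMap.continuous_on_pi _).measurable

/-- After the substitution y = Bx this is the standard Gaussian integral; the Jacobian is |det B| =
√(det A), and the linear coefficients square to the form of A⁻¹ = B⁻¹(B⁻¹)ᵀ. -/
theorem integral_gauss {A : Matrix (Fin f) (Fin f) ℝ} (hA : A.PosDef) {s : ℂ} (hs : 0 < s.re)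
    (w : Fin f → ℂ) : ∫ x, gauss A s w x =
      (1 / s) ^ (f / 2 : ℂ) * ((√A.det)⁻¹ : ℝ) * Complex.exp (-(Real.pi / s) * matC A⁻¹ w w) := by
  obtain ⟨B, rfl, hB⟩ := hA.exists_transpose_mul_self
  have hb : 0 < (Real.pi * s : ℂ).re := by
    simpa using mul_pos Real.pi_pos hs
  have h := GaussianFourier.integral_cexp_neg_mul_sum_add hb
    fun i => 2 * Real.pi * Complex.I * ∑ j, (B⁻¹ j i : ℂ) * w j
  have hs0 : s ≠ 0 := fun h => by simp [h] at hs
  have hpi : (Real.pi : ℂ) ≠ 0 := by exact_mod_cast Real.pi_ne_zero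
  have hm : AEMeasurable (Matrix.toLin' B) (volume : Measure (Fin f → ℝ)) :=
    (LinearMap.continuous_on_pi _).measurable.aemeasurable
  rw [show gauss (Bᵀ * B) s w = _ from funext (gauss_eq_comp hB s w),
    ← integral_map (φ := Matrix.toLin' B) (f := fun v : Fin f → ℝ =>
      Complex.exp (-(Real.pi * s) * ∑ i, (v i : ℂ) ^ 2 +
      ∑ i, (2 * Real.pi * Complex.I * ∑ j, (B⁻¹ j i : ℂ) * w j) * (v i : ℂ))) hm
      (Continuous.aestronglyMeasurable (by fun_prop)),
    Real.map_matrix_volume_pi_eq_smul_volume_pi hB, integral_smul_measure, h,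
    ENNReal.toReal_ofReal (abs_nonneg _), Fintype.card_fin]
  have hdet : √(Bᵀ * B).det = |B.det| := by
    rw [det_mul, det_transpose, Real.sqrt_mul_self_eq_abs]
  have hinv : (Bᵀ * B)⁻¹ = B⁻¹ * B⁻¹ᵀ := by
    rw [Matrix.mul_inv_rev, transpose_nonsing_inv]
  have hq : matC (Bᵀ * B)⁻¹ w w = ∑ i, (∑ j, (B⁻¹ j i : ℂ) * w j) ^ 2 := by
    rw [hinv, matC, show (B⁻¹ * B⁻¹ᵀ).map (Complex.ofReal : ℝ → ℂ) =
      B⁻¹.map (Complex.ofReal : ℝ → ℂ) * (B⁻¹.map (Complex.ofReal : ℝ → ℂ))ᵀ by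
        rw [← transpose_map]
        exact Matrix.map_mul (f := Complex.ofRealHom),
      ← mulVec_mulVec, dotProduct_mulVec, ← mulVec_transpose, dotProduct]
    refine Finset.sum_congr rfl fun i _ => ?_
    rw [sq]
    rfl
  rw [hdet, hq, abs_inv, Complex.real_smul, show (Real.pi / (Real.pi * s) : ℂ) = 1 / s by
    field_simp]
  have hsq : ∀ i, (2 * Real.pi * Complex.I * ∑ j, (B⁻¹ j i : ℂ) * w j) ^ 2 =
      -(4 * Real.pi ^ 2) * (∑ j, (B⁻¹ j i : ℂ) * w j) ^ 2 := by
    intro i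
    rw [mul_pow, mul_pow, Complex.I_sq]
    ring
  have hexp : (∑ i, (2 * Real.pi * Complex.I * ∑ j, (B⁻¹ j i : ℂ) * w j) ^ 2) /
      (4 * (Real.pi * s)) = -(Real.pi / s) * ∑ i, (∑ j, (B⁻¹ j i : ℂ) * w j) ^ 2 := by
    rw [Finset.sum_congr rfl fun i _ => hsq i, ← Finset.mul_sum]
    field_simp
  rw [hexp]
  ring

theorem matC_sub_self {A : Matrix (Fin f) (Fin f) ℝ} (hA : Aᵀ = A) (x y : Fin f → ℂ) :
    matC A (x - y) (x - y) = matC A x x + matC A y y - 2 * matC A x y := by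
  have hc : matC A y x = matC A x y := by
    unfold matC
    rw [dotProduct_mulVec, ← mulVec_transpose, ← transpose_map, hA, dotProduct_comm]
  have : matC A (x - y) (x - y) = matC A x x - matC A x y - (matC A y x - matC A y y) := by
    simp only [matC, sub_dotProduct, mulVec_sub, dotProduct_sub]
    ring
  rw [this, hc]
  ring

theorem matC_ofReal (A : Matrix (Fin f) (Fin f) ℝ) (x : Fin f → ℝ) :
    matC A (fun i => (x i : ℂ)) (fun i => (x i : ℂ)) = ((x ⬝ᵥ A *ᵥ x : ℝ) : ℂ) := by
  simp [matC, dotProduct, mulVec]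

/-- **Poisson summation** for Gaussian functions in several variables. -/
theorem poisson_gauss {A : Matrix (Fin f) (Fin f) ℝ} (hA : A.PosDef) {s : ℂ} (hs : 0 < s.re)
    (w : Fin f → ℂ) (x : Fin f → ℝ) :
    HasSum (fun p : Fin f → ℤ => (1 / s) ^ (f / 2 : ℂ) * ((√A.det)⁻¹ : ℝ) *
      Complex.exp (-(Real.pi / s) * matC A⁻¹ (w - vecC p) (w - vecC p)) *
        expI (∑ i, (p i : ℂ) * (x i : ℂ)))
      (∑' n : Fin f → ℤ, gauss A s w (x + vecR n)) := by
  have hs0 : s ≠ 0 := fun h => by simp [h] at hs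
  have hpi : (Real.pi : ℂ) ≠ 0 := by exact_mod_cast Real.pi_ne_zero
  have hcoef : ∀ p : Fin f → ℤ, ∫ x : Fin f → ℝ, expI (-∑ i, (p i : ℂ) * (x i : ℂ)) * gauss A s w x
      = (1 / s) ^ (f / 2 : ℂ) * ((√A.det)⁻¹ : ℝ) *
        Complex.exp (-(Real.pi / s) * matC A⁻¹ (w - vecC p) (w - vecC p)) := by
    intro p
    rw [← integral_gauss hA hs]
    congr 1
    funext x
    rw [gauss, gauss, mul_left_comm, ← expI_add]
    congr 2
    simp [vecC, sub_mul, Finset.sum_sub_distrib]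
    ring
  have hAt : Aᵀ = A := by
    have := hA.isHermitian
    rwa [IsHermitian, conjTranspose_eq_transpose_of_trivial] at this
  have hsre : 0 < (1 / s).re := by
    rw [one_div, Complex.inv_re]
    exact div_pos hs (Complex.normSq_pos.mpr hs0)
  have h := hasSum_poisson (continuous_gauss A s w) (integrable_gauss hA hs w)
    (gauss_bound hA hs w) ?_ x
  · simpa only [hcoef] using h
  simp only [hcoef]
  refine Summable.mul_left _ ?_
  -- As a function of p the Fourier transform is again a Gaussian, for A⁻¹ and 1/s, with the linear
  -- term coming from the cross term -2wᵀA⁻¹p; so it is summable for the same reason as the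
  -- original.
  refine ((summable_gauss hA.inv hsre fun i =>
    -(Complex.I / s) * ((A⁻¹).map (Complex.ofReal : ℝ → ℂ) *ᵥ w) i).mul_left
      (Complex.exp (-(Real.pi / s) * matC A⁻¹ w w))).congr fun p => ?_
  have hAit : (A⁻¹)ᵀ = A⁻¹ := by rw [transpose_nonsing_inv, hAt]
  have hv : vecC p = fun i => ((vecR p i : ℝ) : ℂ) := by ext i; simp [vecC, vecR]
  have h1 : matC A⁻¹ w (vecC p) = ∑ i, ((A⁻¹).map (Complex.ofReal : ℝ → ℂ) *ᵥ w) i *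
      ((vecR p i : ℝ) : ℂ) := by
    rw [matC, dotProduct_mulVec, ← mulVec_transpose, ← transpose_map, hAit, hv, dotProduct]
  rw [matC_sub_self hAit, h1, hv, matC_ofReal, gauss, expI, ← Complex.exp_add, ← Complex.exp_add]
  congr 1
  simp only [mul_assoc, ← Finset.mul_sum]
  field_simp
  rw [Complex.I_sq]
  ring

end Gaussian


open Matrix

/-! ### Sums over residue classes -/

section Residues

variable {f : ℕ}

/-- The least non-negative representatives of a vector of residues. -/
def liftZ {c : ℕ} (g : Fin f → ZMod c) : Fin f → ℤ := fun i => ((g i).val : ℤ)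

theorem cast_liftZ {c : ℕ} [NeZero c] (g : Fin f → ZMod c) (i : Fin f) :
    ((liftZ g i : ℤ) : ZMod c) = g i := by
  simp [liftZ]

/-- Division with remainder for integral vectors. -/
def divModEquiv (f c : ℕ) [NeZero c] : (Fin f → ZMod c) × (Fin f → ℤ) ≃ (Fin f → ℤ) where
  toFun p := liftZ p.1 + (c : ℤ) • p.2
  invFun m := (fun i => (m i : ZMod c), fun i => m i / c)
  left_inv p := by
    have hc : (0 : ℤ) < c := by exact_mod_cast NeZero.pos c
    refine Prod.ext (funext fun i => ?_) (funext fun i => ?_)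
    · simp [liftZ]
    · have h1 : ((p.1 i).val : ℤ) / c = 0 :=
        Int.ediv_eq_zero_of_lt (by positivity) (by exact_mod_cast ZMod.val_lt (p.1 i))
      change (((p.1 i).val : ℤ) + c * p.2 i) / c = p.2 i
      rw [Int.add_mul_ediv_left _ _ hc.ne', h1, zero_add]
  right_inv m := by
    ext i
    change (((m i : ZMod c).val : ℤ) + c * (m i / c)) = m i
    rw [ZMod.val_intCast, Int.emod_add_mul_ediv]

theorem exists_eq_liftZ_add {c : ℕ} [NeZero c] (x : Fin f → ℤ) :
    ∃ y, x = liftZ (fun i => (x i : ZMod c)) + (c : ℤ) • y :=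
  ⟨_, ((divModEquiv f c).apply_symm_apply x).symm⟩

/-- The sum of a function on `ℤ^f` over representatives modulo `c`. -/
def sumMod (c : ℕ) [NeZero c] (F : (Fin f → ℤ) → ℂ) : ℂ := ∑ g : Fin f → ZMod c, F (liftZ g)

/-- Both the vanishing and the evaluation of the Gauss sums are instances of this translation
invariance. -/
theorem sumMod_add {c : ℕ} [NeZero c] {F : (Fin f → ℤ) → ℂ}
    (hF : ∀ x y, F (x + (c : ℤ) • y) = F x) (x₀ : Fin f → ℤ) :
    sumMod c (fun x => F (x + x₀)) = sumMod c F := by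
  unfold sumMod
  refine Fintype.sum_equiv (Equiv.addRight fun i => (x₀ i : ZMod c)) _ _ fun g => ?_
  obtain ⟨y, hy⟩ := exists_eq_liftZ_add (c := c) (liftZ g + x₀)
  change F (liftZ g + x₀) = _
  rw [hy, hF]
  congr 2
  ext i
  simp [liftZ]

end Residues

theorem hasSum_of_eq {ι : Type*} {F G : ι → ℂ} {a : ℂ} (h : HasSum F a) (hFG : ∀ i, G i = F i) :
    HasSum G a := by
  rwa [funext hFG]

/-! ### The theta function of a quadratic form in the full set of elliptic variables -/

section Theta

variable {f : ℕ} (Q : QuadraticForm ℤ (Fin f → ℤ))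

/-- The theta function `∑ₘ exp (2πi (τ Q(m) + B(m, u)))`. -/
def thetaC (τ : ℂ) (u : Fin f → ℂ) : ℂ :=
  ∑' m : Fin f → ℤ, expI (τ * (Q m : ℂ) + bilinC Q (vecC m) u)

/-- The complex matrix of `Q` applied to a vector. -/
def mulC (u : Fin f → ℂ) : Fin f → ℂ := (formMatrix Q).map (Int.cast : ℤ → ℂ) *ᵥ u

theorem realMatrix_map : (realMatrix Q).map (Complex.ofReal : ℝ → ℂ) =
    (formMatrix Q).map (Int.cast : ℤ → ℂ) := by
  ext i j
  simp [realMatrix]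

/-- Here m = c·x. For c = 1 this gives the terms of Θ themselves; for c the modulus it rewrites
lattice points g + cn as c(g/c + n), the form needed for Poisson summation on a residue class. -/
theorem gauss_realMatrix (t : ℂ) (u : Fin f → ℂ) (c : ℂ) (x : Fin f → ℝ) (m : Fin f → ℤ)
    (hx : ∀ i, (m i : ℂ) = c * x i) :
    gauss (realMatrix Q) (-Complex.I * t * c ^ 2) (mulC Q (c • u)) x =
      expI (t * (Q m : ℂ) + bilinC Q (vecC m) u) := by
  have h1 : vecC m = c • fun i => (x i : ℂ) := funext fun i => by simp [vecC, hx]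
  have h2 : c ^ 2 * ((x ⬝ᵥ realMatrix Q *ᵥ x : ℝ) : ℂ) = 2 * (Q m : ℂ) := by
    rw [cast_form_eq_formC, h1, formC_smul, formC, ← matC_ofReal, matC, realMatrix_map, bilinC]
    ring
  have h3 : ∑ i, mulC Q (c • u) i * (x i : ℂ) = bilinC Q (vecC m) u := by
    rw [bilinC_comm, h1, bilinC_smul_right, ← bilinC_smul_left, bilinC_comm, bilinC, dotProduct]
    exact Finset.sum_congr rfl fun i _ => mul_comm _ _
  rw [gauss, h3, expI_add]
  congr 1
  rw [expI]
  congr 1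
  linear_combination (Real.pi * Complex.I * t) * h2

variable {Q}

theorem summable_thetaC (hQ : Q.PosDef) {τ : ℂ} (hτ : 0 < τ.im) (u : Fin f → ℂ) :
    Summable fun m : Fin f → ℤ => expI (τ * (Q m : ℂ) + bilinC Q (vecC m) u) := by
  refine (summable_gauss (posDef_realMatrix hQ) (s := -Complex.I * τ * 1 ^ 2) ?_
    (mulC Q ((1 : ℂ) • u))).congr fun m => ?_
  · simpa using hτ
  · rw [gauss_realMatrix]
    simp [vecR]

variable (Q) in
/-- The quadratic form dual to `Q`. -/
def dualForm (x : Fin f → ℂ) : ℂ := matC (realMatrix Q)⁻¹ x x / 2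

theorem isUnit_det_realMatrix (hQ : Q.PosDef) : IsUnit (realMatrix Q).det :=
  (posDef_realMatrix hQ).det_pos.ne'.isUnit

theorem realMatrix_transpose : (realMatrix Q)ᵀ = realMatrix Q := by
  rw [realMatrix, ← transpose_map, formMatrix_transpose]

theorem matC_inv_mulC_left (hQ : Q.PosDef) (u x : Fin f → ℂ) :
    matC (realMatrix Q)⁻¹ (mulC Q u) x = u ⬝ᵥ x := by
  have ht : ((realMatrix Q).map (Complex.ofReal : ℝ → ℂ))ᵀ = (realMatrix Q).map Complex.ofReal := by
    rw [← transpose_map, realMatrix_transpose]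
  rw [matC, mulC, ← realMatrix_map, ← ht, mulVec_transpose, ← dotProduct_mulVec, mulVec_mulVec]
  rw [show (realMatrix Q).map (Complex.ofReal : ℝ → ℂ) *
    (realMatrix Q)⁻¹.map (Complex.ofReal : ℝ → ℂ) =
    (realMatrix Q * (realMatrix Q)⁻¹).map (Complex.ofReal : ℝ → ℂ) from
      (Matrix.map_mul (f := Complex.ofRealHom)).symm, mul_nonsing_inv _ (isUnit_det_realMatrix hQ)]
  simp

theorem dualForm_mulC (hQ : Q.PosDef) (u : Fin f → ℂ) : dualForm Q (mulC Q u) = formC Q u := by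
  rw [dualForm, matC_inv_mulC_left hQ, formC]
  rfl

theorem matC_dual_sub (hQ : Q.PosDef) (u x : Fin f → ℂ) :
    matC (realMatrix Q)⁻¹ (mulC Q u - x) (mulC Q u - x) =
      2 * (formC Q u + dualForm Q x - u ⬝ᵥ x) := by
  rw [matC_sub_self (by rw [transpose_nonsing_inv, realMatrix_transpose]),
    matC_inv_mulC_left hQ, matC_inv_mulC_left hQ, dualForm, formC]
  rw [show u ⬝ᵥ mulC Q u = bilinC Q u u from rfl]
  ring

variable (Q) in
/-- The Gauss sum `∑_g exp (2πi (a Q(g) + pᵀ g) / c)`, over `g` modulo `c`. -/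
def gaussQ (a : ℤ) (c : ℕ) [NeZero c] (p : Fin f → ℤ) : ℂ :=
  sumMod c fun g => expI (((a * Q g + p ⬝ᵥ g : ℤ) : ℂ) / c)

theorem add_im_pos {c : ℕ} (hc : 0 < c) (d : ℤ) {τ : ℂ} (hτ : 0 < τ.im) :
    0 < ((c : ℂ) * τ + d).im := by
  simp only [Complex.add_im, Complex.mul_im, Complex.natCast_re, Complex.natCast_im, zero_mul,
    add_zero, Complex.intCast_im]
  positivity

theorem expI_form_div (a : ℤ) (c : ℕ) [NeZero c] (x y : Fin f → ℤ) :
    expI ((a * Q (x + (c : ℤ) • y) : ℤ) / c) = expI ((a * Q x : ℤ) / c) := by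
  have hc : (c : ℂ) ≠ 0 := NeZero.ne _
  rw [← expI_add_int ((a * Q x : ℤ) / c) (a * (bilinZ Q x y + c * Q y)), form_add, form_smul, bilinZ_smul_right]
  congr 1
  push_cast
  field_simp
  ring

/-- On the class of g, the summand a/c of γτ only sees Q(g) modulo c and gives a constant phase.
What remains is a Gaussian in g/c + n with parameter s = ic/J, and Poisson summation applies to it.
-/
theorem thetaC_moebius_residue (hQ : Q.PosDef) {r : ℕ} (hf : f = 2 * r) {a b d : ℤ} {c : ℕ}
    [NeZero c] (hdet : a * d - b * c = 1) {τ : ℂ} (hτ : 0 < τ.im) (u : Fin f → ℂ)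
    (g : Fin f → ℤ) :
    HasSum (fun p : Fin f → ℤ => (-Complex.I / c) ^ r * ((√(realMatrix Q).det)⁻¹ : ℝ) *
        ((c : ℂ) * τ + d) ^ r * expI (c * formC Q u / ((c : ℂ) * τ + d)) *
        (expI (((a * Q g + p ⬝ᵥ g : ℤ) : ℂ) / c) *
          expI ((τ + d / c) * dualForm Q (vecC p) - u ⬝ᵥ vecC p)))
      (∑' n : Fin f → ℤ, expI ((a * τ + b) / ((c : ℂ) * τ + d) * (Q (g + (c : ℤ) • n) : ℂ) +
        bilinC Q (vecC (g + (c : ℤ) • n)) (((c : ℂ) * τ + d)⁻¹ • u))) := by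
  have hc : (c : ℂ) ≠ 0 := NeZero.ne _
  have hcR : (c : ℝ) ≠ 0 := NeZero.ne _
  have hJim := add_im_pos (NeZero.pos c) d hτ
  set J : ℂ := (c : ℂ) * τ + d with hJ
  have hJ0 : J ≠ 0 := fun h => by simp [h] at hJim
  have hdet' : (a : ℂ) * d - b * c = 1 := by exact_mod_cast hdet
  -- The splitting of γτ into its limit a/c at infinity and a term that tends to zero; it only uses
  -- ad - bc = 1.
  have hmob : (a * τ + b) / J = a / c + -1 / (c * J) := by
    field_simp
    rw [hJ]
    linear_combination (-1 : ℂ) * hdet'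
  set s : ℂ := -Complex.I * (-1 / (c * J)) * c ^ 2 with hs_def
  have hs : s = Complex.I * c / J := by
    rw [hs_def]
    field_simp
  have hs0 : 0 < s.re := by
    rw [hs, Complex.div_re]
    have : 0 < Complex.normSq J := Complex.normSq_pos.mpr hJ0
    have hcpos : (0 : ℝ) < c := by exact_mod_cast NeZero.pos c
    simp only [Complex.mul_re, Complex.I_re, Complex.I_im, Complex.natCast_re, Complex.natCast_im,
      Complex.mul_im, zero_mul, one_mul, mul_zero, zero_add, sub_zero, zero_div]
    positivity
  have key := poisson_gauss (posDef_realMatrix hQ) hs0 (mulC Q ((c : ℂ) • J⁻¹ • u))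
    fun i => (g i : ℝ) / c
  have hsum : ∀ n : Fin f → ℤ,
      gauss (realMatrix Q) s (mulC Q ((c : ℂ) • J⁻¹ • u)) ((fun i => (g i : ℝ) / c) + vecR n) *
        expI ((a * Q g : ℤ) / c) =
      expI ((a * τ + b) / J * (Q (g + (c : ℤ) • n) : ℂ) +
        bilinC Q (vecC (g + (c : ℤ) • n)) (J⁻¹ • u)) := by
    intro n
    rw [hs_def, gauss_realMatrix Q _ _ _ _ (g + (c : ℤ) • n), ← expI_form_div _ _ _ n, ← expI_add,
      hmob]
    · congr 1
      push_cast
      ring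
    · intro i
      simp only [vecR, Pi.add_apply, Pi.smul_apply, smul_eq_mul]
      push_cast
      field_simp
  have key2 := key.mul_right (expI ((a * Q g : ℤ) / c))
  rw [← tsum_mul_right] at key2
  simp only [hsum] at key2
  refine hasSum_of_eq key2 fun p => ?_
  have hI : Complex.I ≠ 0 := Complex.I_ne_zero
  -- Since f = 2r, the exponent f/2 is an integer and no branch of the power has to be chosen.
  have hpow : (1 / s) ^ (f / 2 : ℂ) = (-Complex.I / c) ^ r * J ^ r := by
    rw [hf, ← mul_pow, show (((2 * r : ℕ) : ℂ) / 2) = r by push_cast; ring, Complex.cpow_natCast, hs]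
    congr 1
    field_simp
    rw [Complex.I_sq, neg_neg]
  have hexp : Complex.exp (-(Real.pi / s) * matC (realMatrix Q)⁻¹
      (mulC Q ((c : ℂ) • J⁻¹ • u) - vecC p) (mulC Q ((c : ℂ) • J⁻¹ • u) - vecC p)) =
      expI (c * formC Q u / J + ((τ + d / c) * dualForm Q (vecC p) - u ⬝ᵥ vecC p)) := by
    rw [matC_dual_sub hQ, formC_smul, formC_smul, smul_dotProduct, smul_dotProduct, smul_eq_mul,
      smul_eq_mul, expI, hs]
    congr 1
    -- The dual Gaussian has parameter 1/s = -iJ/c, so its frequency variable is J/c = τ + d/c: this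
    -- is how τ returns.
    rw [show τ + d / c = J / c by rw [hJ]; field_simp]
    field_simp
    rw [Complex.I_sq]
    ring
  have hlin : expI (((a * Q g + p ⬝ᵥ g : ℤ) : ℂ) / c) =
      expI ((a * Q g : ℤ) / c) * expI (∑ i, (p i : ℂ) * (((g i : ℝ) / c : ℝ) : ℂ)) := by
    rw [← expI_add]
    congr 1
    rw [dotProduct]
    push_cast
    rw [add_div, Finset.sum_div]
    congr 1
    exact Finset.sum_congr rfl fun i _ => by ring
  rw [hpow, hexp, hlin, expI_add]
  ring

/-- The transformation of the theta function under an element of `SL₂(ℤ)` with `c > 0`. -/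
theorem hasSum_thetaC_moebius (hQ : Q.PosDef) {r : ℕ} (hf : f = 2 * r) {a b d : ℤ} {c : ℕ}
    [NeZero c] (hdet : a * d - b * c = 1) {τ : ℂ} (hτ : 0 < τ.im) (u : Fin f → ℂ) :
    HasSum (fun p : Fin f → ℤ => (-Complex.I / c) ^ r * ((√(realMatrix Q).det)⁻¹ : ℝ) *
        ((c : ℂ) * τ + d) ^ r * expI (c * formC Q u / ((c : ℂ) * τ + d)) *
        (gaussQ Q a c p * expI ((τ + d / c) * dualForm Q (vecC p) - u ⬝ᵥ vecC p)))
      (thetaC Q ((a * τ + b) / ((c : ℂ) * τ + d)) (((c : ℂ) * τ + d)⁻¹ • u)) := by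
  have hJim := add_im_pos (NeZero.pos c) d hτ
  have him : 0 < ((a * τ + b) / ((c : ℂ) * τ + d)).im := by
    have hJ0 : Complex.normSq ((c : ℂ) * τ + d) ≠ 0 := fun h => by
      rw [Complex.normSq_eq_zero] at h
      simp [h] at hJim
    have hdet' : (a : ℝ) * d - b * c = 1 := by exact_mod_cast hdet
    rw [Complex.div_im, ← sub_div]
    refine div_pos ?_ (lt_of_le_of_ne (Complex.normSq_nonneg _) hJ0.symm)
    simp only [Complex.add_im, Complex.mul_im, Complex.natCast_re, Complex.natCast_im, zero_mul,
      add_zero, Complex.intCast_im, Complex.intCast_re, Complex.add_re, Complex.mul_re, sub_zero]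
    nlinarith
  have h := hasSum_sum (s := (Finset.univ : Finset (Fin f → ZMod c)))
    fun g _ => thetaC_moebius_residue hQ hf hdet hτ u (liftZ g)
  have hs := summable_thetaC hQ him (((c : ℂ) * τ + d)⁻¹ • u)
  have hs' := (divModEquiv f c).summable_iff.mpr hs
  have htot : thetaC Q ((a * τ + b) / ((c : ℂ) * τ + d)) (((c : ℂ) * τ + d)⁻¹ • u) =
      ∑ g : Fin f → ZMod c, ∑' n : Fin f → ℤ,
        expI ((a * τ + b) / ((c : ℂ) * τ + d) * (Q (liftZ g + (c : ℤ) • n) : ℂ) +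
          bilinC Q (vecC (liftZ g + (c : ℤ) • n)) (((c : ℂ) * τ + d)⁻¹ • u)) := by
    rw [thetaC, ← (divModEquiv f c).tsum_eq]
    exact (Summable.tsum_prod hs').trans (tsum_fintype _)
  rw [htot]
  refine hasSum_of_eq h fun p => ?_
  rw [gaussQ, sumMod, ← Finset.mul_sum, ← Finset.sum_mul]

end Theta


open Matrix

/-! ### Gauss sums whose modulus is divisible by the level -/

section GaussSums

variable {f : ℕ} {Q : QuadraticForm ℤ (Fin f → ℤ)}

theorem expI_gaussQ_periodic (a : ℤ) (c : ℕ) [NeZero c] (p x y : Fin f → ℤ) :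
    expI (((a * Q (x + (c : ℤ) • y) + p ⬝ᵥ (x + (c : ℤ) • y) : ℤ) : ℂ) / c) =
      expI (((a * Q x + p ⬝ᵥ x : ℤ) : ℂ) / c) := by
  have hc : (c : ℂ) ≠ 0 := NeZero.ne _
  rw [← expI_add_int (((a * Q x + p ⬝ᵥ x : ℤ) : ℂ) / c) (a * (bilinZ Q x y + c * Q y) + p ⬝ᵥ y),
    form_add, form_smul, bilinZ_smul_right, dotProduct_add, dotProduct_smul, smul_eq_mul]
  congr 1
  push_cast
  field_simp
  ring

theorem transpose_eq_of_formMatrix_mul {K : ℤ} (hK : K ≠ 0) {M : Matrix (Fin f) (Fin f) ℤ}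
    (hM : formMatrix Q * M = K • (1 : Matrix (Fin f) (Fin f) ℤ)) : Mᵀ = M := by
  have h1 : Mᵀ * formMatrix Q = K • (1 : Matrix (Fin f) (Fin f) ℤ) := by
    rw [← formMatrix_transpose Q, ← transpose_mul, hM, transpose_smul, transpose_one]
  have h2 : K • Mᵀ = K • M := by
    calc K • Mᵀ = Mᵀ * (formMatrix Q * M) := by rw [hM, Matrix.mul_smul, Matrix.mul_one]
      _ = K • M := by rw [← Matrix.mul_assoc, h1, Matrix.smul_mul, Matrix.one_mul]
  ext i j
  have := congrFun (congrFun h2 i) j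
  simpa [hK] using this

/-- Write c = Ke and translate by x₀ = eMeᵢ. Then Ax₀ = ceᵢ, so B(g, x₀) is divisible by c, and
Q(x₀) is divisible by c because M has even diagonal. The translation multiplies the Gauss sum by
e((Mp)ᵢ/K), so a nonzero sum forces K to divide every entry of Mp, whence p = A(Mp/K). Both
conditions in the definition of the level are used here. -/
theorem gaussQ_eq_zero {K : ℕ} (hK : 0 < K) {M : Matrix (Fin f) (Fin f) ℤ}
    (hM : formMatrix Q * M = (K : ℤ) • (1 : Matrix (Fin f) (Fin f) ℤ)) (hMe : ∀ i, Even (M i i))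
    (a : ℤ) {c : ℕ} [NeZero c] (hKc : K ∣ c) {p : Fin f → ℤ} (hp : ∀ m, formMatrix Q *ᵥ m ≠ p) :
    gaussQ Q a c p = 0 := by
  have hK0 : (K : ℤ) ≠ 0 := by exact_mod_cast hK.ne'
  have hc : (c : ℂ) ≠ 0 := NeZero.ne _
  have hMt := transpose_eq_of_formMatrix_mul hK0 hM
  obtain ⟨e, rfl⟩ := hKc
  by_contra hne
  have hdvd : ∀ i, (K : ℤ) ∣ (M *ᵥ p) i := by
    intro i
    set x₀ : Fin f → ℤ := (e : ℤ) • M *ᵥ Pi.single i 1 with hx₀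
    have hAx : formMatrix Q *ᵥ x₀ = ((K * e : ℕ) : ℤ) • Pi.single i 1 := by
      rw [hx₀, mulVec_smul, mulVec_mulVec, hM, smul_mulVec, one_mulVec, smul_smul]
      congr 1
      push_cast
      ring
    have hB : ∀ g : Fin f → ℤ, bilinZ Q g x₀ = (K * e : ℕ) * g i := by
      intro g
      rw [bilinZ_eq, hAx, dotProduct_smul, dotProduct_single, mul_one, smul_eq_mul]
    obtain ⟨t, ht⟩ := hMe i
    have hQ0 : Q x₀ = (K * e : ℕ) * (e * t) := by
      have h1 := two_mul_form Q x₀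
      rw [← bilinZ_eq, hB, hx₀] at h1
      simp only [mulVec_single, MulOpposite.op_one, one_smul, Pi.smul_apply, col_apply, ht,
        smul_eq_mul] at h1
      rw [hx₀]
      simp only [mulVec_single, MulOpposite.op_one, one_smul] at h1 ⊢
      linarith
    have hpx : p ⬝ᵥ x₀ = e * (M *ᵥ p) i := by
      rw [hx₀, dotProduct_smul, smul_eq_mul, dotProduct_mulVec, ← mulVec_transpose, hMt,
        dotProduct_single, mul_one]
    have h1 := sumMod_add (c := K * e) (F := fun x => expI (((a * Q x + p ⬝ᵥ x : ℤ) : ℂ) / (K * e : ℕ)))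
      (expI_gaussQ_periodic (Q := Q) a (K * e) p) x₀
    have h2 : ∀ g : Fin f → ℤ, expI (((a * Q (g + x₀) + p ⬝ᵥ (g + x₀) : ℤ) : ℂ) / (K * e : ℕ)) =
        expI (((e * (M *ᵥ p) i : ℤ) : ℂ) / (K * e : ℕ)) *
          expI (((a * Q g + p ⬝ᵥ g : ℤ) : ℂ) / (K * e : ℕ)) := by
      intro g
      rw [← expI_add, ← expI_add_int (_ + _) (a * (g i + e * t)), form_add, hB, hQ0,
        dotProduct_add, hpx]
      congr 1
      rw [Int.cast_add, Int.cast_add, Int.cast_mul a, Int.cast_add, Int.cast_add, Int.cast_mul,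
        Int.cast_mul, Int.cast_mul a]
      simp only [Int.cast_natCast, Int.cast_mul, Int.cast_add]
      field_simp
      ring
    have h3 : expI (((e * (M *ᵥ p) i : ℤ) : ℂ) / (K * e : ℕ)) = 1 := by
      have : expI (((e * (M *ᵥ p) i : ℤ) : ℂ) / (K * e : ℕ)) * gaussQ Q a (K * e) p =
          gaussQ Q a (K * e) p := by
        refine Eq.trans ?_ h1
        rw [gaussQ]
        simp only [h2, sumMod, Finset.mul_sum]
      exact mul_right_cancel₀ hne (by rw [this, one_mul])
    rw [expI, Complex.exp_eq_one_iff] at h3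
    obtain ⟨n, hn⟩ := h3
    refine ⟨n, ?_⟩
    have h2pi : (2 * Real.pi * Complex.I : ℂ) ≠ 0 := Complex.two_pi_I_ne_zero
    have he0 : (e : ℤ) ≠ 0 := fun h => hc (by rw [Nat.cast_mul]; norm_cast at h; simp [h])
    rw [mul_comm (n : ℂ)] at hn
    have h4 := mul_left_cancel₀ h2pi hn
    rw [div_eq_iff hc] at h4
    have h5 : (e : ℤ) * (M *ᵥ p) i = n * (K * e) := by exact_mod_cast h4
    exact mul_left_cancel₀ he0 (by rw [h5]; ring)
  choose m hm using hdvd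
  refine hp m ?_
  have h1 : (K : ℤ) • formMatrix Q *ᵥ m = (K : ℤ) • p := by
    rw [← mulVec_smul, show (K : ℤ) • m = M *ᵥ p from funext fun i => (hm i).symm, mulVec_mulVec,
      hM, smul_mulVec, one_mulVec]
  ext i
  have := congrFun h1 i
  simpa [hK.ne'] using this

/-- Completing the square: translate by dm, where d is an inverse of a modulo c. -/
theorem gaussQ_mulVec {a b d : ℤ} {c : ℕ} [NeZero c] (hdet : a * d - b * c = 1)
    (m : Fin f → ℤ) :
    gaussQ Q a c (formMatrix Q *ᵥ m) = expI (-(d * Q m : ℤ) / c) * gaussQ Q a c 0 := by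
  have hc : (c : ℂ) ≠ 0 := NeZero.ne _
  have h1 := sumMod_add (c := c) (F := fun x => expI (((a * Q x + 0 ⬝ᵥ x : ℤ) : ℂ) / c)) (expI_gaussQ_periodic (Q := Q) a c 0) (d • m)
  rw [gaussQ, gaussQ, ← h1, sumMod, sumMod, Finset.mul_sum]
  refine Finset.sum_congr rfl fun g _ => ?_
  have hdet' : (a : ℂ) * d = 1 + b * c := by
    have : a * d = 1 + b * c := by linarith
    exact_mod_cast this
  rw [← expI_add, dotProduct_comm, ← bilinZ_eq, zero_dotProduct, add_zero, form_add, form_smul,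
    bilinZ_smul_right,
    ← expI_add_int (((a * Q (liftZ g) + bilinZ Q (liftZ g) m : ℤ) : ℂ) / c)
      (b * (bilinZ Q (liftZ g) m + d * Q m))]
  congr 1
  push_cast
  field_simp
  linear_combination (-(d : ℂ) * Q m - bilinZ Q (liftZ g) m) * hdet'

end GaussSums

/-! ### The transformation law on `Γ₀(N)` -/

section Transformation

variable {f : ℕ} {Q : QuadraticForm ℤ (Fin f → ℤ)}

theorem bilinC_neg_left (x y : Fin f → ℂ) : bilinC Q (-x) y = -bilinC Q x y := by
  simp [bilinC]

theorem bilinC_neg_right (x y : Fin f → ℂ) : bilinC Q x (-y) = -bilinC Q x y := by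
  rw [bilinC_comm, bilinC_neg_left, bilinC_comm]

theorem thetaC_neg (τ : ℂ) (u : Fin f → ℂ) : thetaC Q τ (-u) = thetaC Q τ u := by
  unfold thetaC
  rw [← (Equiv.neg _).tsum_eq]
  refine tsum_congr fun m => ?_
  simp [vecC_neg, bilinC_neg_left, bilinC_neg_right]

theorem thetaC_add_int (τ : ℂ) (b : ℤ) (u : Fin f → ℂ) : thetaC Q (τ + b) u = thetaC Q τ u := by
  unfold thetaC
  refine tsum_congr fun m => ?_
  rw [← expI_add_int (τ * _ + _) (b * Q m)]
  congr 1
  push_cast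
  ring

theorem vecC_mulVec (m : Fin f → ℤ) : vecC (formMatrix Q *ᵥ m) = mulC Q (vecC m) :=
  cast_mulVec _ _

theorem mulVec_formMatrix_injective (hQ : Q.PosDef) :
    Function.Injective fun m : Fin f → ℤ => formMatrix Q *ᵥ m :=
  Matrix.mulVec_injective_of_det_ne_zero (det_formMatrix_ne_zero hQ)

/-- Only the frequencies p = Am survive. The dual form takes the value Q(m) there, and the phase
e(-dQ(m)/c) of the Gauss sum cancels the e(dQ(m)/c) coming from τ + d/c. The sign of u is absorbed
by the evenness of Θ. -/
theorem thetaC_moebius_of_level_dvd (hQ : Q.PosDef) {r : ℕ} (hf : f = 2 * r) {N : ℕ}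
    (hN : IsLevel Q N) {a b d : ℤ} {c : ℕ} [NeZero c] (hNc : N ∣ c)
    (hdet : a * d - b * c = 1) {τ : ℂ} (hτ : 0 < τ.im) (u : Fin f → ℂ) :
    thetaC Q ((a * τ + b) / ((c : ℂ) * τ + d)) (((c : ℂ) * τ + d)⁻¹ • u) =
      (-Complex.I / c) ^ r * ((√(realMatrix Q).det)⁻¹ : ℝ) * gaussQ Q a c 0 *
        ((c : ℂ) * τ + d) ^ r * expI (c * formC Q u / ((c : ℂ) * τ + d)) * thetaC Q τ u := by
  obtain ⟨hN0, M, hM, hMe⟩ := hN.1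
  have hc : (c : ℂ) ≠ 0 := NeZero.ne _
  have h := hasSum_thetaC_moebius hQ hf hdet hτ u
  rw [← (mulVec_formMatrix_injective hQ).hasSum_iff] at h
  · rw [← h.tsum_eq, ← thetaC_neg τ, thetaC, ← tsum_mul_left]
    refine tsum_congr fun m => ?_
    simp only [Function.comp_apply]
    rw [gaussQ_mulVec hdet, vecC_mulVec, dualForm_mulC hQ, ← cast_form_eq_formC]
    have : expI ((τ + d / c) * (Q m : ℂ) - u ⬝ᵥ mulC Q (vecC m)) =
        expI ((d * Q m : ℤ) / c) * expI (τ * (Q m : ℂ) + bilinC Q (vecC m) (-u)) := by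
      rw [← expI_add, bilinC_neg_right, bilinC_comm]
      congr 1
      rw [bilinC, mulC]
      push_cast
      ring
    rw [this, neg_div _ (((d * Q m : ℤ) : ℂ)), expI_neg]
    have := expI_ne_zero ((d * Q m : ℤ) / c)
    field_simp
  · intro p hp
    rw [gaussQ_eq_zero hN0 hM hMe a hNc fun m hm => hp ⟨m, hm⟩]
    simp

/-- `φ` is the factor of the theta function of `Q` under `γ`. -/
def IsMultiplier (Q : QuadraticForm ℤ (Fin f → ℤ)) (r : ℕ) (γ : SL(2, ℤ)) (φ : ℂ) : Prop :=
  ∀ (τ : ℍ) (u : Fin f → ℂ), thetaC Q ((γ • τ : ℍ) : ℂ) ((autFactor γ τ)⁻¹ • u) =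
    φ * autFactor γ τ ^ r * expI (((γ 1 0 : ℤ) : ℂ) * formC Q u / autFactor γ τ) * thetaC Q τ u

theorem coe_smul_eq (γ : SL(2, ℤ)) (τ : ℍ) :
    ((γ • τ : ℍ) : ℂ) = (((γ 0 0 : ℤ) : ℂ) * τ + ((γ 0 1 : ℤ) : ℂ)) / autFactor γ τ := by
  rw [UpperHalfPlane.coe_specialLinearGroup_apply]
  simp [autFactor]

theorem det_eq_one (γ : SL(2, ℤ)) : γ 0 0 * γ 1 1 - γ 0 1 * γ 1 0 = 1 := by
  rw [← Matrix.det_fin_two, γ.det_coe]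

theorem isMultiplier_of_pos (hQ : Q.PosDef) {r : ℕ} (hf : f = 2 * r) {N : ℕ}
    (hN : IsLevel Q N) {γ : SL(2, ℤ)} {c : ℕ} [NeZero c] (hc : γ 1 0 = c) (hNc : N ∣ c) :
    IsMultiplier Q r γ
      ((-Complex.I / c) ^ r * ((√(realMatrix Q).det)⁻¹ : ℝ) * gaussQ Q (γ 0 0) c 0) := by
  intro τ u
  have h := thetaC_moebius_of_level_dvd hQ hf hN (a := γ 0 0) (b := γ 0 1) (d := γ 1 1) hNc
    (by rw [← hc]; exact det_eq_one γ) τ.im_pos u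
  rw [coe_smul_eq, autFactor, hc, Int.cast_natCast]
  exact h

theorem autFactor_neg (γ : SL(2, ℤ)) (τ : ℍ) : autFactor (-γ) τ = -autFactor γ τ := by
  simp [autFactor]
  ring

/-- γ and -γ act alike on ℍ while J changes sign, and Θ is even in u. This extends the law from c >
0 to c < 0. -/
theorem IsMultiplier.neg {r : ℕ} {γ : SL(2, ℤ)} {φ : ℂ} (h : IsMultiplier Q r γ φ) :
    IsMultiplier Q r (-γ) ((-1) ^ r * φ) := by
  intro τ u
  have h1 := h τ (-u)
  rw [autFactor_neg, ModularGroup.SL_neg_smul, inv_neg, neg_smul, ← smul_neg, h1, thetaC_neg,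
    show formC Q (-u) = formC Q u by simp [formC, bilinC_neg_left, bilinC_neg_right], neg_pow]
  have h2 : ((((-γ : SL(2, ℤ)) 1 0 : ℤ) : ℂ) * formC Q u / -autFactor γ τ) =
      ((γ 1 0 : ℤ) : ℂ) * formC Q u / autFactor γ τ := by
    rw [Matrix.SpecialLinearGroup.coe_neg]
    simp
  rw [h2]
  have : ((-1 : ℂ) ^ r) * (-1) ^ r = 1 := by rw [← mul_pow]; simp
  linear_combination (-(φ * autFactor γ τ ^ r *
    expI (((γ 1 0 : ℤ) : ℂ) * formC Q u / autFactor γ τ) * thetaC Q τ u)) * this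

theorem isMultiplier_one_of_translation (r : ℕ) {γ : SL(2, ℤ)} (hc : γ 1 0 = 0)
    (hd : γ 1 1 = 1) : IsMultiplier Q r γ 1 := by
  intro τ u
  have ha : γ 0 0 = 1 := by
    have := det_eq_one γ
    rw [hc, hd] at this
    linarith
  have hJ : autFactor γ τ = 1 := by simp [autFactor, hc, hd]
  rw [coe_smul_eq, hJ, hc, ha]
  simp [expI_zero, thetaC_add_int]

theorem exists_isMultiplier (hQ : Q.PosDef) {r : ℕ} (hf : f = 2 * r) {N : ℕ}
    (hN : IsLevel Q N) {γ : SL(2, ℤ)} (hγ : (N : ℤ) ∣ γ 1 0) : ∃ φ, IsMultiplier Q r γ φ := by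
  have hpos : ∀ γ : SL(2, ℤ), (N : ℤ) ∣ γ 1 0 → 0 < γ 1 0 → ∃ φ, IsMultiplier Q r γ φ := by
    intro γ hγ h0
    obtain ⟨c, hc⟩ := Int.eq_ofNat_of_zero_le h0.le
    have : NeZero c := ⟨by rintro rfl; simp [hc] at h0⟩
    exact ⟨_, isMultiplier_of_pos hQ hf hN hc (by rw [hc] at hγ; exact_mod_cast hγ)⟩
  rcases lt_trichotomy (γ 1 0) 0 with h0 | h0 | h0
  · obtain ⟨φ, hφ⟩ := hpos (-γ) (by simpa using hγ) (by simpa using h0)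
    exact ⟨_, by simpa using hφ.neg⟩
  · have hdet := det_eq_one γ
    rw [h0, mul_zero, sub_zero] at hdet
    rcases Int.eq_one_or_neg_one_of_mul_eq_one' hdet with ⟨-, h⟩ | ⟨-, h⟩
    · exact ⟨1, isMultiplier_one_of_translation r h0 h⟩
    · have := isMultiplier_one_of_translation (Q := Q) r (γ := -γ) (by simpa using h0)
        (by simp [h])
      exact ⟨_, by simpa using this.neg⟩
  · exact hpos γ hγ h0

end Transformation


open Matrix

/-! ### The multiplier as a character -/

section Multiplier

variable {f : ℕ} {Q : QuadraticForm ℤ (Fin f → ℤ)}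

/-- All terms are positive. One point of nonvanishing suffices to make multipliers unique, hence
multiplicative. -/
theorem thetaC_I_ne_zero (hQ : Q.PosDef) : thetaC Q Complex.I 0 ≠ 0 := by
  have h1 : ∀ m : Fin f → ℤ, expI (Complex.I * (Q m : ℂ) + bilinC Q (vecC m) 0) =
      ((Real.exp (-(2 * Real.pi * Q m)) : ℝ) : ℂ) := by
    intro m
    rw [show bilinC Q (vecC m) 0 = 0 by simp [bilinC], add_zero, expI, Complex.ofReal_exp]
    congr 1
    push_cast
    linear_combination (2 * Real.pi * Q m : ℂ) * Complex.I_sq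
  have hs := summable_thetaC hQ (τ := Complex.I) (by simp) 0
  rw [thetaC]
  simp only [h1] at hs ⊢
  rw [← Complex.ofReal_tsum]
  have := (Complex.summable_ofReal.mp hs).tsum_pos (fun m => (Real.exp_pos _).le) 0
    (Real.exp_pos _)
  exact_mod_cast this.ne'

theorem autFactor_ne_zero (γ : SL(2, ℤ)) (τ : ℍ) : autFactor γ τ ≠ 0 := by
  intro h
  have him := congrArg Complex.im h
  simp only [autFactor, Complex.add_im, Complex.mul_im, Complex.intCast_re, Complex.intCast_im,
    zero_mul, add_zero, Complex.zero_im] at him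
  have hc : γ 1 0 = 0 := by
    have := mul_eq_zero.mp him
    rcases this with h | h
    · exact_mod_cast h
    · exact absurd h τ.im_pos.ne'
  have hd : γ 1 1 = 0 := by
    rw [autFactor, hc] at h
    simpa using h
  have := det_eq_one γ
  rw [hc, hd] at this
  simp at this

theorem autFactor_mul (γ₁ γ₂ : SL(2, ℤ)) (τ : ℍ) :
    autFactor (γ₁ * γ₂) τ = autFactor γ₁ (γ₂ • τ) * autFactor γ₂ τ := by
  have h := autFactor_ne_zero γ₂ τ
  rw [autFactor, autFactor, coe_smul_eq]
  simp only [Matrix.SpecialLinearGroup.coe_mul, Matrix.mul_apply, Fin.sum_univ_two]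
  field_simp
  rw [autFactor]
  push_cast
  ring

theorem IsMultiplier.apply_zero {r : ℕ} {γ : SL(2, ℤ)} {φ : ℂ} (h : IsMultiplier Q r γ φ)
    (τ : ℍ) : thetaC Q ((γ • τ : ℍ) : ℂ) 0 = φ * autFactor γ τ ^ r * thetaC Q τ 0 := by
  have h1 := h τ 0
  rw [smul_zero, show formC Q (0 : Fin f → ℂ) = 0 by simp [formC, bilinC], mul_zero, zero_div,
    expI_zero, mul_one] at h1
  exact h1

theorem IsMultiplier.mul_eq (hQ : Q.PosDef) {r : ℕ} {γ₁ γ₂ : SL(2, ℤ)} {φ₁ φ₂ φ : ℂ}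
    (h₁ : IsMultiplier Q r γ₁ φ₁) (h₂ : IsMultiplier Q r γ₂ φ₂)
    (h : IsMultiplier Q r (γ₁ * γ₂) φ) : φ = φ₁ * φ₂ := by
  have h3 := h.apply_zero UpperHalfPlane.I
  rw [mul_smul, h₁.apply_zero, h₂.apply_zero, autFactor_mul] at h3
  have e1 := pow_ne_zero r (autFactor_ne_zero γ₁ (γ₂ • UpperHalfPlane.I))
  have e2 := pow_ne_zero r (autFactor_ne_zero γ₂ UpperHalfPlane.I)
  have e3 := thetaC_I_ne_zero hQ
  have e4 : ((UpperHalfPlane.I : ℍ) : ℂ) = Complex.I := rfl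
  rw [e4, mul_pow] at h3
  refine (mul_left_injective₀ (mul_ne_zero (mul_ne_zero e1 e2) e3) ?_).symm
  simp only
  linear_combination h3

/-- Every term with q > 0 decays exponentially and the value at y = 1 dominates, so only the index
with q = 0 remains. -/
theorem tendsto_tsum_expI {ι : Type*} [DecidableEq ι] {i₀ : ι} {q : ι → ℝ} (h0 : q i₀ = 0)
    (hpos : ∀ i, i ≠ i₀ → 0 < q i) (hs : Summable fun i => Real.exp (-(2 * Real.pi * q i)))
    {a : ι → ℂ} {C : ℝ} (ha : ∀ i, ‖a i‖ ≤ C) :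
    Filter.Tendsto (fun y : ℝ => ∑' i, a i * expI (Complex.I * y * q i)) Filter.atTop
      (nhds (a i₀)) := by
  have hnn : ∀ i, 0 ≤ q i := fun i => by
    rcases eq_or_ne i i₀ with rfl | h
    · exact h0.ge
    · exact (hpos i h).le
  have hnorm : ∀ (y : ℝ) i, ‖expI (Complex.I * y * q i)‖ = Real.exp (-(2 * Real.pi * (y * q i))) := by
    intro y i
    rw [norm_expI]
    simp
  rw [show a i₀ = ∑' i, if i = i₀ then a i₀ else 0 by rw [tsum_ite_eq]]
  refine tendsto_tsum_of_dominated_convergence (hs.mul_left C) (fun i => ?_) ?_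
  · split_ifs with h
    · subst h
      simp [h0, expI_zero]
    · have h1 : Filter.Tendsto (fun y : ℝ => Real.exp (-(2 * Real.pi * (y * q i)))) Filter.atTop
          (nhds 0) := by
        refine Real.tendsto_exp_neg_atTop_nhds_zero.comp ?_
        exact (Filter.tendsto_id.atTop_mul_const (hpos i h)).const_mul_atTop (by positivity)
      have h2 : Filter.Tendsto (fun y : ℝ => expI (Complex.I * y * q i)) Filter.atTop
          (nhds 0) := by
        rw [tendsto_zero_iff_norm_tendsto_zero]
        simpa only [hnorm] using h1
      simpa using h2.const_mul (a i)
  · filter_upwards [Filter.eventually_ge_atTop 1] with y hy i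
    rw [norm_mul, hnorm]
    have hC : 0 ≤ C := (norm_nonneg _).trans (ha i)
    refine mul_le_mul (ha i) (Real.exp_le_exp.mpr ?_) (Real.exp_pos _).le hC
    have := hnn i
    have := Real.pi_pos
    rw [neg_le_neg_iff]
    gcongr
    nlinarith

/-- The values of the dual form at integral vectors. -/
def dualR (Q : QuadraticForm ℤ (Fin f → ℤ)) (p : Fin f → ℤ) : ℝ :=
  vecR p ⬝ᵥ (realMatrix Q)⁻¹ *ᵥ vecR p / 2

theorem dualForm_vecC (p : Fin f → ℤ) : dualForm Q (vecC p) = dualR Q p := by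
  have : vecC p = fun i => ((vecR p i : ℝ) : ℂ) := by ext i; simp [vecC, vecR]
  rw [dualForm, this, matC_ofReal, dualR]
  push_cast
  rfl

theorem dualR_pos (hQ : Q.PosDef) {p : Fin f → ℤ} (hp : p ≠ 0) : 0 < dualR Q p := by
  have hp' : vecR p ≠ 0 := by
    intro h
    refine hp (funext fun i => ?_)
    have := congrFun h i
    simpa [vecR] using this
  have := (posDef_realMatrix hQ).inv.dotProduct_mulVec_pos hp'
  rw [star_trivial] at this
  exact half_pos this

theorem summable_exp_dualR (hQ : Q.PosDef) :
    Summable fun p : Fin f → ℤ => Real.exp (-(2 * Real.pi * dualR Q p)) := by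
  refine (summable_gauss (posDef_realMatrix hQ).inv (s := 1) (by simp) 0).norm.congr fun p => ?_
  rw [gauss, norm_mul, norm_expI, Complex.norm_exp]
  simp [dualR]
  ring

theorem norm_gaussQ_le (a : ℤ) (c : ℕ) [NeZero c] (p : Fin f → ℤ) :
    ‖gaussQ Q a c p‖ ≤ Fintype.card (Fin f → ZMod c) := by
  rw [gaussQ, sumMod]
  refine (norm_sum_le _ _).trans ?_
  rw [Finset.sum_congr rfl fun g _ => show ‖expI (((a * Q (liftZ g) + p ⬝ᵥ liftZ g : ℤ) : ℂ) / c)‖ = 1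
    from ?_]
  · simp
  · rw [← norm_expI_ofReal (((a * Q (liftZ g) + p ⬝ᵥ liftZ g : ℤ) : ℝ) / c)]
    push_cast
    rfl

theorem gaussQ_one (a : ℤ) (p : Fin f → ℤ) : gaussQ Q a 1 p = 1 := by
  rw [gaussQ, sumMod]
  simp only [Nat.cast_one, div_one, expI_int]
  simp

/-- Put S = (0 -1; 1 0). The matrix γS has bottom row (d, -c) and top left entry b, so Θ(γSτ, 0) has
an expansion with Gauss sums modulo d; going through S first, it is φ times an expansion with
trivial Gauss sums. Both are series in the dual form, and comparing their limits as τ = iy tends to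
i∞ isolates the term p = 0. -/
theorem IsMultiplier.mul_pow_eq (hQ : Q.PosDef) {r : ℕ} (hf : f = 2 * r) {γ : SL(2, ℤ)} {φ : ℂ}
    (h : IsMultiplier Q r γ φ) {d : ℕ} [NeZero d] (hd : γ 1 1 = d) :
    φ * (d : ℂ) ^ r = gaussQ Q (γ 0 1) d 0 := by
  have hd0 : (d : ℂ) ≠ 0 := NeZero.ne _
  have hdet := det_eq_one γ
  rw [hd] at hdet
  set K : ℂ := (((√(realMatrix Q).det)⁻¹ : ℝ) : ℂ) with hK
  have hK0 : K ≠ 0 := by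
    rw [hK]
    have := Real.sqrt_pos.mpr (posDef_realMatrix hQ).det_pos
    exact_mod_cast (inv_pos.mpr this).ne'
  have key : ∀ y : ℝ, 0 < y → ∑' p : Fin f → ℤ, (gaussQ Q (γ 0 1) d p *
      expI (-(γ 1 0 : ℤ) / d * dualR Q p)) * expI (Complex.I * y * dualR Q p) =
      ∑' p : Fin f → ℤ, (φ * (d : ℂ) ^ r) * expI (Complex.I * y * dualR Q p) := by
    intro y hy
    have hy0 : (y : ℂ) ≠ 0 := by exact_mod_cast hy.ne'
    set τ : ℂ := Complex.I * y with hτ_def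
    have hτ : 0 < τ.im := by simpa [hτ_def] using hy
    have hτ0 : τ ≠ 0 := mul_ne_zero Complex.I_ne_zero hy0
    -- The matrix γS, with rows (b, -a) and (d, -c).
    have h1 := hasSum_thetaC_moebius hQ hf (a := γ 0 1) (b := -γ 0 0) (d := -γ 1 0) (c := d)
      (by linarith) hτ 0
    -- The matrix S, with modulus 1.
    have h2 := hasSum_thetaC_moebius hQ hf (a := 0) (b := -1) (d := 0) (c := 1) (by simp) hτ 0
    have hS : 0 < (-1 / τ).im := by
      rw [hτ_def, neg_div, one_div, mul_inv, Complex.inv_I, neg_mul, neg_neg, ← Complex.ofReal_inv]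
      simpa using hy
    have h3 := h.apply_zero ⟨-1 / τ, hS⟩
    rw [coe_smul_eq] at h3
    have hJ0 := autFactor_ne_zero γ ⟨-1 / τ, hS⟩
    have hJ : autFactor γ ⟨-1 / τ, hS⟩ = ((d : ℂ) * τ + ((-γ 1 0 : ℤ) : ℂ)) / τ := by
      rw [autFactor, hd]
      change ((γ 1 0 : ℤ) : ℂ) * (-1 / τ) + _ = _
      push_cast
      field_simp
      ring
    rw [hJ] at hJ0
    have hJ1 : (d : ℂ) * τ + ((-γ 1 0 : ℤ) : ℂ) ≠ 0 := fun h => hJ0 (by rw [h, zero_div])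
    have harg : (((γ 0 0 : ℤ) : ℂ) * (((⟨-1 / τ, hS⟩ : ℍ)) : ℂ) + ((γ 0 1 : ℤ) : ℂ)) /
        autFactor γ ⟨-1 / τ, hS⟩ = (((γ 0 1 : ℤ) : ℂ) * τ + ((-γ 0 0 : ℤ) : ℂ)) /
          ((d : ℂ) * τ + ((-γ 1 0 : ℤ) : ℂ)) := by
      rw [hJ]
      change (((γ 0 0 : ℤ) : ℂ) * (-1 / τ) + _) / _ = _
      push_cast at hJ1 ⊢
      field_simp
      ring
    rw [harg, hJ] at h3
    have h1' := h1.tsum_eq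
    have h2' := h2.tsum_eq
    rw [smul_zero] at h1' h2'
    have hz : formC Q (0 : Fin f → ℂ) = 0 := by simp [formC, bilinC]
    have h4 : (((0 : ℤ) : ℂ) * τ + ((-1 : ℤ) : ℂ)) / (((1 : ℕ) : ℂ) * τ + ((0 : ℤ) : ℂ)) =
        ((⟨-1 / τ, hS⟩ : ℍ) : ℂ) := by
      change _ = -1 / τ
      simp
    rw [h3, tsum_mul_left] at h1'
    rw [h4, tsum_mul_left] at h2'
    rw [← h2'] at h1'
    simp only [hz, mul_zero, zero_div, expI_zero, mul_one, zero_dotProduct, sub_zero, gaussQ_one,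
      one_mul, Nat.cast_one, div_one, Int.cast_zero, add_zero, dualForm_vecC] at h1'
    have h5 : ∀ p : Fin f → ℤ, gaussQ Q (γ 0 1) d p *
        expI ((τ + ((-γ 1 0 : ℤ) : ℂ) / d) * dualR Q p) = (gaussQ Q (γ 0 1) d p *
      expI (-(γ 1 0 : ℤ) / d * dualR Q p)) * expI (τ * dualR Q p) := by
      intro p
      rw [mul_assoc, ← expI_add]
      congr 2
      push_cast
      ring
    simp only [h5] at h1'
    rw [tsum_mul_left]
    have e1 : (-Complex.I) ^ r ≠ 0 := pow_ne_zero _ (neg_ne_zero.mpr Complex.I_ne_zero)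
    have e2 := pow_ne_zero r hJ1
    have e3 := pow_ne_zero r hd0
    have e4 := pow_ne_zero r hτ0
    rw [div_pow, div_pow, ← hK] at h1'
    clear_value K τ
    generalize ∑' p : Fin f → ℤ, expI (τ * dualR Q p) = S₁ at h1' ⊢
    generalize ∑' p : Fin f → ℤ, (gaussQ Q (γ 0 1) d p *
      expI (-(γ 1 0 : ℤ) / d * dualR Q p)) * expI (τ * dualR Q p) = S₂ at h1' ⊢
    generalize ((d : ℂ) * τ + ((-γ 1 0 : ℤ) : ℂ)) ^ r = J at *
    generalize (-Complex.I) ^ r = i at *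
    generalize (d : ℂ) ^ r = D at *
    generalize τ ^ r = T at *
    refine mul_left_cancel₀ (mul_ne_zero (mul_ne_zero e1 hK0) e2) ?_
    calc i * K * J * S₂ = D * (i / D * K * J * S₂) := by field_simp
      _ = D * (φ * (J / T) * (i * K * T * S₁)) := by rw [← h1']
      _ = i * K * J * (φ * D * S₁) := by field_simp
  have hsum := summable_exp_dualR hQ
  have hq0 : dualR Q 0 = 0 := by simp [dualR, show vecR (0 : Fin f → ℤ) = 0 by ext i; simp [vecR]]
  have t1 := tendsto_tsum_expI hq0 (fun p hp => dualR_pos hQ hp) hsum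
    (a := fun p => gaussQ Q (γ 0 1) d p * expI (-(γ 1 0 : ℤ) / d * dualR Q p))
    (C := Fintype.card (Fin f → ZMod d)) (fun p => by
      rw [norm_mul, show (-((γ 1 0 : ℤ) : ℂ) / d * dualR Q p) =
        ((-((γ 1 0 : ℤ) : ℝ) / d * dualR Q p : ℝ) : ℂ) by push_cast; rfl, norm_expI_ofReal, mul_one]
      exact norm_gaussQ_le _ _ _)
  have t2 := tendsto_tsum_expI hq0 (fun p hp => dualR_pos hQ hp) hsum
    (a := fun _ => φ * (d : ℂ) ^ r) (C := ‖φ * (d : ℂ) ^ r‖) (fun p => le_rfl)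
  have t3 := tendsto_nhds_unique (t1.congr' (by
    filter_upwards [Filter.eventually_gt_atTop 0] with y hy using key y hy)) t2
  rw [← t3]
  simp [hq0, expI_zero]

end Multiplier


open Matrix

/-! ### Gauss sums of quadratic forms over finite prime fields -/

section PrimeGauss

variable {p : ℕ} [Fact p.Prime]

/-- The quadratic character of `ZMod p` with complex values. -/
def quadC (p : ℕ) [Fact p.Prime] : MulChar (ZMod p) ℂ :=
  (quadraticChar (ZMod p)).ringHomComp (Int.castRingHom ℂ)

theorem ringChar_zmod_ne_two (hp : p ≠ 2) : ringChar (ZMod p) ≠ 2 := by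
  rwa [ZMod.ringChar_zmod_n]

theorem quadC_sq {a : ZMod p} (ha : a ≠ 0) : quadC p a ^ 2 = 1 := by
  have := quadraticChar_sq_one (F := ZMod p) ha
  simp only [quadC, MulChar.ringHomComp_apply, eq_intCast]
  exact_mod_cast this

/-- Group by y = t²: there are 1 + χ(y) square roots of y for the quadratic character χ, and the
constant 1 contributes a vanishing character sum. -/
theorem sum_stdAddChar_mul_sq (hp : p ≠ 2) {a : ZMod p} (ha : a ≠ 0) :
    ∑ t : ZMod p, ZMod.stdAddChar (a * t ^ 2) =
      quadC p a * gaussSum (quadC p) (ZMod.stdAddChar (N := p)) := by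
  classical
  have h1 : ∀ y : ZMod p, ∑ t : ZMod p with t ^ 2 = y, ZMod.stdAddChar (a * t ^ 2) =
      (quadC p y + 1) * ZMod.stdAddChar (a * y) := by
    intro y
    rw [Finset.sum_congr rfl fun t ht => by rw [(Finset.mem_filter.mp ht).2], Finset.sum_const,
      nsmul_eq_mul]
    congr 1
    have h2 := quadraticChar_card_sqrts (ringChar_zmod_ne_two hp) y
    have h3 : {x : ZMod p | x ^ 2 = y}.toFinset = Finset.univ.filter fun t => t ^ 2 = y := by
      ext; simp
    rw [h3] at h2
    have h4 : ((((Finset.univ.filter fun t : ZMod p => t ^ 2 = y).card : ℤ)) : ℂ) =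
      ((quadraticChar (ZMod p) y + 1 : ℤ) : ℂ) := by rw [h2]
    simpa [quadC] using h4
  rw [← Finset.sum_fiberwise Finset.univ (fun t : ZMod p => t ^ 2)]
  simp only [h1, add_mul, one_mul, Finset.sum_add_distrib]
  have h5 : ∑ y : ZMod p, (ZMod.stdAddChar (a * y) : ℂ) = 0 := by
    have := AddChar.sum_mulShift a (ZMod.isPrimitive_stdAddChar p)
    rw [if_neg ha, Nat.cast_zero] at this
    rw [← this]
    exact Finset.sum_congr rfl fun y _ => by rw [mul_comm]
  have h6 := gaussSum_mulShift (quadC p) (ZMod.stdAddChar (N := p)) (Units.mk0 a ha)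
  rw [h5, add_zero, ← h6, Units.val_mk0, ← mul_assoc, ← sq, quadC_sq ha, one_mul]
  rfl

theorem gaussSum_quadC_sq (hp : p ≠ 2) :
    gaussSum (quadC p) (ZMod.stdAddChar (N := p)) ^ 2 = quadC p (-1) * p := by
  have h1 : quadC p ≠ 1 :=
    (MulChar.ringHomComp_ne_one_iff (RingHom.injective_int _)).mpr
      (quadraticChar_ne_one (ringChar_zmod_ne_two hp))
  have h := gaussSum_sq h1 ((quadraticChar_isQuadratic (ZMod p)).comp _)
    (ZMod.isPrimitive_stdAddChar p)
  rwa [ZMod.card] at h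

/-- Away from characteristic 2 a symmetric bilinear form has an orthogonal basis; its vectors are
the columns of P. -/
theorem exists_diagonalization {F : Type*} [Field F] (h2 : (2 : F) ≠ 0) {f : ℕ}
    {A : Matrix (Fin f) (Fin f) F} (hA : Aᵀ = A) :
    ∃ (P : Matrix (Fin f) (Fin f) F) (w : Fin f → F), P.det ≠ 0 ∧ Pᵀ * A * P = diagonal w := by
  have : Invertible (2 : F) := invertibleOfNonzero h2
  have hsymm : LinearMap.IsSymm (Matrix.toBilin' A) := by
    constructor
    intro x y
    rw [RingHom.id_apply, Matrix.toBilin'_apply', Matrix.toBilin'_apply', dotProduct_mulVec,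
      ← mulVec_transpose, hA, dotProduct_comm]
  obtain ⟨v, hv⟩ := LinearMap.BilinForm.exists_orthogonal_basis hsymm
  let v' := v.reindex (finCongr (Module.finrank_fin_fun F (n := f)))
  let P : Matrix (Fin f) (Fin f) F := Matrix.of fun i j => v' j i
  refine ⟨P, fun i => v' i ⬝ᵥ A *ᵥ v' i, ?_, ?_⟩
  · have h : P = (Pi.basisFun F (Fin f)).toMatrix v' := by
      ext i j
      simp [P, Module.Basis.toMatrix_apply]
    have := (Pi.basisFun F (Fin f)).invertibleToMatrix v'
    rw [h]
    exact (Matrix.isUnit_det_of_invertible _).ne_zero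
  · ext i j
    have h : (Pᵀ * A * P) i j = v' i ⬝ᵥ A *ᵥ v' j := by
      rw [dotProduct_mulVec]
      rfl
    rw [h, diagonal_apply]
    split_ifs with hij
    · subst hij; rfl
    · have := LinearMap.isOrthoᵢ_def.mp hv ((finCongr (Module.finrank_fin_fun F (n := f))).symm i)
        ((finCongr (Module.finrank_fin_fun F (n := f))).symm j) (by simpa using hij)
      rw [Matrix.toBilin'_apply'] at this
      simpa [v'] using this

/-- After diagonalisation the sum is a product of f = 2r one-dimensional Gauss sums. The factors b^f
and (det P)² are squares and disappear from the quadratic character, and the square χ(-1)p of the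
Gauss sum is raised to the power r. -/
theorem sum_stdAddChar_quadratic (hp : p ≠ 2) {r : ℕ} {f : ℕ} (hf : f = 2 * r)
    {A : Matrix (Fin f) (Fin f) (ZMod p)} (hA : Aᵀ = A) (hdet : A.det ≠ 0) {b : ZMod p}
    (hb : b ≠ 0) :
    ∑ x : Fin f → ZMod p, ZMod.stdAddChar (b * (x ⬝ᵥ A *ᵥ x)) =
      (p : ℂ) ^ r * quadC p ((-1) ^ r * A.det) := by
  classical
  have h2 : (2 : ZMod p) ≠ 0 := Ring.two_ne_zero (ringChar_zmod_ne_two hp)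
  obtain ⟨P, w, hP, hPA⟩ := exists_diagonalization h2 hA
  have hwdet : ∏ i, w i = P.det ^ 2 * A.det := by
    rw [← det_diagonal, ← hPA, det_mul, det_mul, det_transpose]
    ring
  have hw : ∀ i, w i ≠ 0 := fun i hi => by
    have : ∏ i, w i = 0 := Finset.prod_eq_zero (Finset.mem_univ i) hi
    rw [hwdet] at this
    exact mul_ne_zero (pow_ne_zero 2 hP) hdet this
  have hPu : IsUnit P := (Matrix.isUnit_iff_isUnit_det _).mpr hP.isUnit
  have hbij : Function.Bijective fun t : Fin f → ZMod p => P *ᵥ t :=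
    (Finite.injective_iff_bijective).mp (Matrix.mulVec_injective_of_isUnit hPu)
  rw [← Function.Bijective.sum_comp hbij]
  have hterm : ∀ t : Fin f → ZMod p, ZMod.stdAddChar (b * ((P *ᵥ t) ⬝ᵥ A *ᵥ (P *ᵥ t))) =
      ∏ i, ZMod.stdAddChar (b * w i * t i ^ 2) := by
    intro t
    have h3 : (P *ᵥ t) ⬝ᵥ A *ᵥ (P *ᵥ t) = ∑ i, w i * t i ^ 2 := by
      rw [mulVec_mulVec, dotProduct_mulVec, ← mulVec_transpose, mulVec_mulVec, transpose_mul, hA,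
        hPA, dotProduct_comm, dotProduct]
      refine Finset.sum_congr rfl fun i _ => ?_
      rw [mulVec_diagonal]
      ring
    rw [h3, Finset.mul_sum]
    have h4 := map_prod (ZMod.stdAddChar (N := p)).toMonoidHom
      (fun i => Multiplicative.ofAdd (b * w i * t i ^ 2)) Finset.univ
    rw [← ofAdd_sum] at h4
    simp only [← mul_assoc]
    exact h4
  simp only [hterm]
  rw [← Fintype.piFinset_univ, ← Finset.prod_univ_sum (fun _ => Finset.univ)
    fun i (t : ZMod p) => (ZMod.stdAddChar (b * w i * t ^ 2) : ℂ)]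
  simp only [sum_stdAddChar_mul_sq hp (mul_ne_zero hb (hw _))]
  have hb' : b ^ f = (b ^ r) ^ 2 := by rw [← pow_mul, hf, mul_comm]
  have hg' : gaussSum (quadC p) (ZMod.stdAddChar (N := p)) ^ f = (quadC p (-1) * p) ^ r := by
    rw [← gaussSum_quadC_sq hp, ← pow_mul, hf]
  rw [Finset.prod_mul_distrib, Finset.prod_const, Finset.card_univ, Fintype.card_fin, ← map_prod,
    Finset.prod_mul_distrib, Finset.prod_const, Finset.card_univ, Fintype.card_fin, hwdet, hb', hg',
    map_mul, map_mul, map_pow, quadC_sq (pow_ne_zero r hb), map_pow, quadC_sq hP, map_mul, map_pow]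
  ring

/-- Modulo an odd p one may halve, so bQ(x) is (b/2)xᵀAx and the evaluation over the prime field
applies. -/
theorem gaussQ_prime {r f : ℕ} (hf : f = 2 * r) {Q : QuadraticForm ℤ (Fin f → ℤ)} (hp : p ≠ 2)
    (hdet : ¬ (p : ℤ) ∣ (formMatrix Q).det) {b : ℤ} (hb : ¬ (p : ℤ) ∣ b) :
    gaussQ Q b p 0 = (p : ℂ) ^ r * (jacobiSym ((-1) ^ r * (formMatrix Q).det) p : ℂ) := by
  have h2 : (2 : ZMod p) ≠ 0 := Ring.two_ne_zero (ringChar_zmod_ne_two hp)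
  set A : Matrix (Fin f) (Fin f) (ZMod p) := (formMatrix Q).map (Int.cast : ℤ → ZMod p) with hA
  have hAdet : A.det = ((formMatrix Q).det : ZMod p) := by
    rw [hA, show (formMatrix Q).map (Int.cast : ℤ → ZMod p) =
      (Int.castRingHom (ZMod p)).mapMatrix (formMatrix Q) from rfl, ← RingHom.map_det]
    simp
  have hb0 : (b : ZMod p) / 2 ≠ 0 :=
    div_ne_zero (fun h => hb ((ZMod.intCast_zmod_eq_zero_iff_dvd _ _).mp h)) h2
  have h := sum_stdAddChar_quadratic hp hf (A := A)
    (by rw [hA, ← transpose_map, formMatrix_transpose])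
    (by rw [hAdet]; exact fun h => hdet ((ZMod.intCast_zmod_eq_zero_iff_dvd _ _).mp h)) hb0
  have hq : quadC p ((-1) ^ r * A.det) = (jacobiSym ((-1) ^ r * (formMatrix Q).det) p : ℂ) := by
    rw [← jacobiSym.legendreSym.to_jacobiSym, legendreSym, hAdet]
    simp [quadC]
  rw [← hq, ← h, gaussQ, sumMod]
  refine Finset.sum_congr rfl fun g _ => ?_
  have hval : ((b * Q (liftZ g) : ℤ) : ZMod p) = b / 2 * (g ⬝ᵥ A *ᵥ g) := by
    have h3 : (2 : ZMod p) * (Q (liftZ g) : ZMod p) = g ⬝ᵥ A *ᵥ g := by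
      have h4 := cast_bilinZ (R := ZMod p) Q (liftZ g) (liftZ g)
      rw [bilinZ_eq, ← two_mul_form] at h4
      simp only [cast_liftZ] at h4
      rw [← h4]
      push_cast
      rfl
    rw [← h3]
    push_cast
    field_simp
  rw [← hval, ZMod.stdAddChar_coe, expI, zero_dotProduct, add_zero, mul_div_assoc]

end PrimeGauss


open Matrix

/-! ### Jacobi and Kronecker symbols -/

section Symbols

/-- Congruence modulo n itself would be too much to ask: the primes of det A divide N, but n = |det
A| need not. -/
theorem jacobiSym_congr_of_forall_prime {a b : ℤ} {n : ℕ}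
    (h : ∀ q : ℕ, q.Prime → q ∣ n → (q : ℤ) ∣ a - b) : jacobiSym a n = jacobiSym b n := by
  unfold jacobiSym
  congr 1
  refine List.pmap_congr_left _ fun q hq h₁ _ => ?_
  have : Fact q.Prime := ⟨h₁⟩
  have := (ZMod.intCast_eq_intCast_iff_dvd_sub b a q).mpr
    (h q h₁ (Nat.dvd_of_mem_primeFactorsList hq))
  simp only [legendreSym, this]

theorem chi_eight_neg (x : ZMod 8) : ZMod.χ₈ (-x) = ZMod.χ₈ x := by
  revert x
  decide

/-- Modulo every prime divisor of D, 1 + 2N is 1 and N + 2 is 2. As 1 + 2N ≡ 3 modulo 4, reciprocity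
turns the hypothesis (D/(1+2N)) = 1 into D ≡ 1 modulo 4. For such D, reciprocity gives (D/(N+2)) =
(2/|D|), which is the value of the character modulo 8. -/
theorem jacobiSym_add_two_eq {D : ℤ} (hD : Odd D) {N : ℕ} (hN : Odd N)
    (hDN : ∀ q : ℕ, q.Prime → (q : ℤ) ∣ D → q ∣ N) (h1 : jacobiSym D (1 + 2 * N) = 1) :
    jacobiSym D (N + 2) = ZMod.χ₈ (D : ZMod 8) := by
  set n := D.natAbs with hn
  have hnodd : Odd n := Int.natAbs_odd.mpr hD
  have hq : ∀ q : ℕ, q.Prime → q ∣ n → (q : ℤ) ∣ N := fun q hq hqn =>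
    Int.natCast_dvd_natCast.mpr (hDN q hq (Int.natCast_dvd.mpr hqn))
  have hm : (1 + 2 * N) % 4 = 3 := by
    obtain ⟨t, rfl⟩ := hN
    omega
  have hmodd : Odd (1 + 2 * N) := ⟨N, by ring⟩
  have hm'odd : Odd (N + 2) := by
    obtain ⟨t, rfl⟩ := hN
    exact ⟨t + 1, by ring⟩
  have e1 : jacobiSym ((1 + 2 * N : ℕ) : ℤ) n = 1 := by
    rw [jacobiSym_congr_of_forall_prime (b := 1), jacobiSym.one_left]
    intro q hq1 hq2
    push_cast
    rw [add_sub_cancel_left]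
    exact (hq q hq1 hq2).mul_left 2
  have e2 : jacobiSym ((N + 2 : ℕ) : ℤ) n = ZMod.χ₈ (n : ZMod 8) := by
    rw [jacobiSym_congr_of_forall_prime (b := 2), jacobiSym.at_two hnodd]
    intro q hq1 hq2
    push_cast
    rw [add_sub_cancel_right]
    exact hq q hq1 hq2
  have hχ3 : ∀ m : ℕ, m % 4 = 3 → ZMod.χ₄ (m : ZMod 4) = -1 := fun m hm => ZMod.χ₄_nat_three_mod_four hm
  have hn4 : n % 4 = 1 ∨ n % 4 = 3 := by
    obtain ⟨t, ht⟩ := hnodd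
    omega
  have hm'4 : (N + 2) % 4 = 1 ∨ (N + 2) % 4 = 3 := by
    obtain ⟨t, ht⟩ := hm'odd
    omega
  rcases Int.natAbs_eq D with hD' | hD' <;> rw [← hn] at hD' <;> rw [hD'] at h1 ⊢
  · rcases hn4 with h4 | h4
    · rw [jacobiSym.quadratic_reciprocity_one_mod_four h4 hm'odd, e2]
      simp
    · rw [jacobiSym.quadratic_reciprocity_three_mod_four h4 hm, e1] at h1
      norm_num at h1
  · rw [jacobiSym.neg _ hmodd, hχ3 _ hm] at h1
    rw [jacobiSym.neg _ hm'odd]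
    rcases hn4 with h4 | h4
    · rw [jacobiSym.quadratic_reciprocity_one_mod_four h4 hmodd, e1] at h1
      norm_num at h1
    · push_cast
      rw [chi_eight_neg, ← e2]
      rcases hm'4 with h5 | h5
      · have := ZMod.χ₄_nat_one_mod_four h5
        push_cast at this
        rw [this, one_mul, jacobiSym.quadratic_reciprocity_one_mod_four' hnodd h5]
      · have := hχ3 _ h5
        push_cast at this
        rw [this, jacobiSym.quadratic_reciprocity_three_mod_four h4 h5]
        push_cast
        ring

theorem kronecker_one (a : ℤ) : kronecker a 1 = 1 := by
  simp [kronecker]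

theorem kronecker_prime_mul (a : ℤ) {p d : ℕ} (hp : p.Prime) (hd : d ≠ 0) :
    kronecker a (p * d) =
      (if p = 2 then ZMod.χ₈ (a : ZMod 8) else jacobiSym a p) * kronecker a d := by
  rw [kronecker, kronecker, if_neg (mul_ne_zero hp.ne_zero hd), if_neg hd,
    ((Nat.perm_primeFactorsList_mul hp.ne_zero hd).map _).prod_eq, Nat.primeFactorsList_prime hp,
    List.singleton_append, List.map_cons, List.prod_cons]

end Symbols

/-! ### Identification of the character -/

section Character

variable {f : ℕ} {Q : QuadraticForm ℤ (Fin f → ℤ)} {N : ℕ}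

theorem det_dvd_pow (hN : IsLevel Q N) : (formMatrix Q).det ∣ (N : ℤ) ^ f := by
  obtain ⟨-, M, hM, -⟩ := hN.1
  refine ⟨M.det, ?_⟩
  rw [← det_mul, hM, det_smul, det_one, mul_one, Fintype.card_fin]

theorem prime_dvd_level (hN : IsLevel Q N) {q : ℕ} (hq : q.Prime)
    (h : (q : ℤ) ∣ (formMatrix Q).det) : q ∣ N := by
  have h1 := h.trans (det_dvd_pow hN)
  have h2 : q ∣ N ^ f := by exact_mod_cast h1
  exact hq.dvd_of_dvd_pow h2

/-! ### Bottom rows, primes in progressions, and dependence on d modulo N -/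

theorem exists_SL2_of_isCoprime {c d : ℤ} (h : IsCoprime c d) :
    ∃ γ : SL(2, ℤ), γ 1 0 = c ∧ γ 1 1 = d := by
  obtain ⟨u, v, huv⟩ := h
  refine ⟨⟨!![v, -u; c, d], ?_⟩, rfl, rfl⟩
  rw [det_fin_two_of]
  linarith

theorem isCoprime_bottom (γ : SL(2, ℤ)) : IsCoprime (γ 1 0) (γ 1 1) :=
  ⟨-γ 0 1, γ 0 0, by linarith [det_eq_one γ]⟩

theorem mul_bottom_right (γ₁ γ₂ : SL(2, ℤ)) :
    (γ₁ * γ₂) 1 1 = γ₁ 1 0 * γ₂ 0 1 + γ₁ 1 1 * γ₂ 1 1 := by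
  simp [Matrix.SpecialLinearGroup.coe_mul, Matrix.mul_apply, Fin.sum_univ_two]

theorem mul_bottom_left (γ₁ γ₂ : SL(2, ℤ)) :
    (γ₁ * γ₂) 1 0 = γ₁ 1 0 * γ₂ 0 0 + γ₁ 1 1 * γ₂ 1 0 := by
  simp [Matrix.SpecialLinearGroup.coe_mul, Matrix.mul_apply, Fin.sum_univ_two]

/-- The product matrix has some multiplier because N divides its lower left entry, and uniqueness
identifies it. -/
theorem IsMultiplier.mul (hQ : Q.PosDef) {r : ℕ} (hf : f = 2 * r) (hN : IsLevel Q N)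
    {γ₁ γ₂ : SL(2, ℤ)} {φ₁ φ₂ : ℂ} (h₁ : IsMultiplier Q r γ₁ φ₁) (h₂ : IsMultiplier Q r γ₂ φ₂)
    (hγ₁ : (N : ℤ) ∣ γ₁ 1 0) (hγ₂ : (N : ℤ) ∣ γ₂ 1 0) :
    IsMultiplier Q r (γ₁ * γ₂) (φ₁ * φ₂) := by
  obtain ⟨φ, hφ⟩ := exists_isMultiplier hQ hf hN (γ := γ₁ * γ₂) (by
    rw [mul_bottom_left]
    exact dvd_add (hγ₁.mul_right _) (hγ₂.mul_left _))
  rwa [← h₁.mul_eq hQ h₂ hφ]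

/-- A prime p = d divides neither b nor det A: in the second case it would divide N and hence c, and
either way ad - bc = 1 fails. So the Gauss sum modulo p is the nondegenerate one. -/
theorem IsMultiplier.eq_jacobiSym_of_prime (hQ : Q.PosDef) {r : ℕ} (hf : f = 2 * r)
    (hN : IsLevel Q N) {γ : SL(2, ℤ)} {φ : ℂ} (h : IsMultiplier Q r γ φ) (hγ : (N : ℤ) ∣ γ 1 0)
    {p : ℕ} (hp : p.Prime) (hp2 : p ≠ 2) (hd : γ 1 1 = p) :
    φ = (jacobiSym ((-1) ^ r * (formMatrix Q).det) p : ℂ) := by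
  have : Fact p.Prime := ⟨hp⟩
  have hp0 : (p : ℂ) ≠ 0 := by exact_mod_cast hp.ne_zero
  have hpZ : Prime (p : ℤ) := Nat.prime_iff_prime_int.mp hp
  have hdet := det_eq_one γ
  rw [hd] at hdet
  have h1 : ∀ x : ℤ, γ 0 1 * γ 1 0 = p * x → False := fun x hx =>
    hpZ.not_isUnit (isUnit_of_dvd_one ⟨γ 0 0 - x, by linarith⟩)
  have h2 := h.mul_pow_eq hQ hf hd
  rw [gaussQ_prime hf hp2 ?_ ?_, mul_comm] at h2
  · exact mul_left_cancel₀ (pow_ne_zero r hp0) h2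
  · intro hpd
    obtain ⟨x, hx⟩ := ((Int.natCast_dvd_natCast.mpr (prime_dvd_level hN hp hpd)).trans
      hγ).mul_left (γ 0 1)
    exact h1 x hx
  · intro hb
    obtain ⟨x, hx⟩ := hb.mul_right (γ 1 0)
    exact h1 x hx

/-- Right multiplication by a translation has multiplier 1 and changes d by a multiple of c. -/
theorem IsMultiplier.eq_jacobiSym_of_modEq (hQ : Q.PosDef) {r : ℕ} (hf : f = 2 * r)
    (hN : IsLevel Q N) {γ : SL(2, ℤ)} {φ : ℂ} (h : IsMultiplier Q r γ φ) (hγ : (N : ℤ) ∣ γ 1 0)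
    {p : ℕ} (hp : p.Prime) (hp2 : p ≠ 2) (hd : γ 1 0 ∣ p - γ 1 1) :
    φ = (jacobiSym ((-1) ^ r * (formMatrix Q).det) p : ℂ) := by
  obtain ⟨n, hn⟩ := hd
  let T : SL(2, ℤ) := ⟨!![1, n; 0, 1], by simp [det_fin_two_of]⟩
  have h1 := h.mul hQ hf hN (isMultiplier_one_of_translation r (γ := T) rfl rfl) hγ
    (show (N : ℤ) ∣ 0 from dvd_zero _)
  rw [mul_one] at h1
  refine h1.eq_jacobiSym_of_prime hQ hf hN ?_ hp hp2 ?_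
  · rw [mul_bottom_left, show T 1 0 = 0 from rfl, mul_zero, add_zero]
    exact hγ.mul_right _
  · rw [mul_bottom_right, show T 0 1 = n from rfl, show T 1 1 = 1 from rfl]
    linarith

/-- Dirichlet's theorem on primes in arithmetic progressions. -/
theorem exists_prime_modEq {c d : ℤ} (hc : c ≠ 0) (h : IsCoprime c d) :
    ∃ p : ℕ, p.Prime ∧ p ≠ 2 ∧ c ∣ p - d := by
  have : NeZero c.natAbs := ⟨Int.natAbs_ne_zero.mpr hc⟩
  have hu : IsUnit (d : ZMod c.natAbs) := by
    obtain ⟨u, v, huv⟩ := h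
    have h1 := congrArg (Int.cast : ℤ → ZMod c.natAbs) huv
    have h2 : (c : ZMod c.natAbs) = 0 :=
      (ZMod.intCast_zmod_eq_zero_iff_dvd _ _).mpr Int.natAbs_dvd_self
    push_cast at h1
    rw [h2, mul_zero, zero_add] at h1
    exact IsUnit.of_mul_eq_one_right _ h1
  obtain ⟨p, hp2, hp, hpd⟩ := Nat.forall_exists_prime_gt_and_eq_mod hu 2
  refine ⟨p, hp, hp2.ne', ?_⟩
  rw [← Int.natAbs_dvd]
  refine (ZMod.intCast_eq_intCast_iff_dvd_sub d p c.natAbs).mp ?_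
  rw [← hpd]
  simp

/-- This weakens the congruence from modulo c to modulo N. Choose γ' with bottom row (N, p) and a
prime p' ≡ d modulo c. Since p' ≡ d ≡ p modulo N, the multiplier of γ' equals both (D/p') and (D/p),
and that of γ equals (D/p'). -/
theorem IsMultiplier.eq_jacobiSym (hQ : Q.PosDef) {r : ℕ} (hf : f = 2 * r)
    (hN : IsLevel Q N) {γ : SL(2, ℤ)} {φ : ℂ} (h : IsMultiplier Q r γ φ) (hγ : (N : ℤ) ∣ γ 1 0)
    {p : ℕ} (hp : p.Prime) (hp2 : p ≠ 2) (hd : (N : ℤ) ∣ p - γ 1 1) :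
    φ = (jacobiSym ((-1) ^ r * (formMatrix Q).det) p : ℂ) := by
  have hN0 : (N : ℤ) ≠ 0 := by exact_mod_cast hN.1.1.ne'
  have main : ∀ {γ : SL(2, ℤ)} {φ : ℂ}, IsMultiplier Q r γ φ → (N : ℤ) ∣ γ 1 0 →
      (N : ℤ) ∣ p - γ 1 1 → γ 1 0 ≠ 0 →
      φ = (jacobiSym ((-1) ^ r * (formMatrix Q).det) p : ℂ) := by
    intro γ φ h hγ hd hc
    have hcop : IsCoprime (N : ℤ) p := by
      have h1 : IsCoprime (N : ℤ) (γ 1 1) := (isCoprime_bottom γ).of_isCoprime_of_dvd_left hγ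
      obtain ⟨x, hx⟩ := hd
      rw [show (p : ℤ) = γ 1 1 + N * x by linarith]
      exact h1.add_mul_left_right x
    obtain ⟨γ', hγ'c, hγ'd⟩ := exists_SL2_of_isCoprime hcop
    have hNγ' : (N : ℤ) ∣ γ' 1 0 := by rw [hγ'c]
    obtain ⟨φ', hφ'⟩ := exists_isMultiplier hQ hf hN hNγ'
    obtain ⟨p', hp', hp'2, hp'd⟩ := exists_prime_modEq hc (isCoprime_bottom γ)
    rw [h.eq_jacobiSym_of_modEq hQ hf hN hγ hp' hp'2 hp'd,
      ← hφ'.eq_jacobiSym_of_prime hQ hf hN hNγ' hp hp2 hγ'd]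
    refine (hφ'.eq_jacobiSym_of_modEq hQ hf hN hNγ' hp' hp'2 ?_).symm
    rw [hγ'c, hγ'd, show (p' : ℤ) - p = (p' - γ 1 1) - (p - γ 1 1) by ring]
    exact dvd_sub (hγ.trans hp'd) hd
  rcases eq_or_ne (γ 1 0) 0 with hc | hc
  -- For c = 0 there is no progression to use. Multiplying by V, whose multiplier is 1 because its
  -- lower right entry is 1, makes c nonzero without changing d.
  · let V : SL(2, ℤ) := ⟨!![1, 0; N, 1], by simp [det_fin_two_of]⟩
    have hNV : (N : ℤ) ∣ V 1 0 := dvd_refl _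
    obtain ⟨ψ, hψ⟩ := exists_isMultiplier hQ hf hN hNV
    have hψ1 : ψ = 1 := by
      have := hψ.mul_pow_eq hQ hf (d := 1) (show V 1 1 = ((1 : ℕ) : ℤ) from rfl)
      simpa [gaussQ_one] using this
    have hm := h.mul hQ hf hN hψ hγ hNV
    have hV : (γ * V) 1 0 = γ 1 1 * N := by
      rw [mul_bottom_left, hc, zero_mul, zero_add]
      rfl
    have hd0 : γ 1 1 ≠ 0 := by
      intro h0
      have := det_eq_one γ
      rw [hc, h0] at this
      simp at this
    rw [hψ1, mul_one] at hm
    refine main hm ?_ ?_ ?_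
    · rw [hV]; exact dvd_mul_left _ _
    · rw [mul_bottom_right, hc, zero_mul, zero_add, show V 1 1 = 1 from rfl, mul_one]
      exact hd
    · rw [hV]; exact mul_ne_zero hd0 hN0
  · exact main h hγ hd hc

/-- A single prime in the common residue class modulo N computes both multipliers. -/
theorem IsMultiplier.congr (hQ : Q.PosDef) {r : ℕ} (hf : f = 2 * r) (hN : IsLevel Q N)
    {γ₁ γ₂ : SL(2, ℤ)} {φ₁ φ₂ : ℂ} (h₁ : IsMultiplier Q r γ₁ φ₁) (h₂ : IsMultiplier Q r γ₂ φ₂)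
    (hγ₁ : (N : ℤ) ∣ γ₁ 1 0) (hγ₂ : (N : ℤ) ∣ γ₂ 1 0) (hd : (N : ℤ) ∣ γ₁ 1 1 - γ₂ 1 1) :
    φ₁ = φ₂ := by
  have hN0 : (N : ℤ) ≠ 0 := by exact_mod_cast hN.1.1.ne'
  obtain ⟨p, hp, hp2, hpd⟩ := exists_prime_modEq hN0
    ((isCoprime_bottom γ₁).of_isCoprime_of_dvd_left hγ₁)
  rw [h₁.eq_jacobiSym hQ hf hN hγ₁ hp hp2 hpd, h₂.eq_jacobiSym hQ hf hN hγ₂ hp hp2]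
  rw [show (p : ℤ) - γ₂ 1 1 = (p - γ₁ 1 1) + (γ₁ 1 1 - γ₂ 1 1) by ring]
  exact dvd_add hpd hd

/-! ### From primes to the Kronecker symbol -/

theorem isMultiplier_one (r : ℕ) : IsMultiplier Q r 1 1 :=
  isMultiplier_one_of_translation r (by simp) (by simp)

/-- Multipliers are determined multiplicatively by the values at primes. -/
theorem IsMultiplier.eq_of_prime_mul (hQ : Q.PosDef) {r : ℕ} (hf : f = 2 * r) (hN : IsLevel Q N)
    {p d : ℕ} (hcop : Nat.Coprime N (p * d)) {γ : SL(2, ℤ)} {φ α β : ℂ} (h : IsMultiplier Q r γ φ)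
    (hγ : (N : ℤ) ∣ γ 1 0) (hd : (N : ℤ) ∣ γ 1 1 - (p * d : ℕ))
    (hα : ∀ {γ : SL(2, ℤ)} {φ : ℂ}, IsMultiplier Q r γ φ → (N : ℤ) ∣ γ 1 0 →
      (N : ℤ) ∣ γ 1 1 - p → φ = α)
    (hβ : ∀ {γ : SL(2, ℤ)} {φ : ℂ}, IsMultiplier Q r γ φ → (N : ℤ) ∣ γ 1 0 →
      (N : ℤ) ∣ γ 1 1 - d → φ = β) : φ = α * β := by
  obtain ⟨γ₁, hc₁, hd₁⟩ := exists_SL2_of_isCoprime (c := N) (d := p)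
    (Nat.isCoprime_iff_coprime.mpr hcop.coprime_mul_right_right)
  obtain ⟨γ₂, hc₂, hd₂⟩ := exists_SL2_of_isCoprime (c := N) (d := d)
    (Nat.isCoprime_iff_coprime.mpr hcop.coprime_mul_left_right)
  have hN₁ : (N : ℤ) ∣ γ₁ 1 0 := by rw [hc₁]
  have hN₂ : (N : ℤ) ∣ γ₂ 1 0 := by rw [hc₂]
  obtain ⟨φ₁, h₁⟩ := exists_isMultiplier hQ hf hN hN₁
  obtain ⟨φ₂, h₂⟩ := exists_isMultiplier hQ hf hN hN₂
  rw [← hα h₁ hN₁ (by rw [hd₁, sub_self]; exact dvd_zero _),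
    ← hβ h₂ hN₂ (by rw [hd₂, sub_self]; exact dvd_zero _)]
  refine h.congr hQ hf hN (h₁.mul hQ hf hN h₂ hN₁ hN₂) hγ ?_ ?_
  · rw [mul_bottom_left]
    exact dvd_add (hN₁.mul_right _) (hN₂.mul_left _)
  · rw [mul_bottom_right, hd₁, hd₂, hc₁]
    push_cast at hd
    rw [show γ 1 1 - (N * γ₂ 0 1 + p * d) = (γ 1 1 - p * d) - N * γ₂ 0 1 by ring]
    exact dvd_sub hd (dvd_mul_right _ _)

theorem IsMultiplier.eq_jacobiSym_of_odd (hQ : Q.PosDef) {r : ℕ} (hf : f = 2 * r)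
    (hN : IsLevel Q N) (d : ℕ) : Odd d → Nat.Coprime N d →
    ∀ {γ : SL(2, ℤ)} {φ : ℂ}, IsMultiplier Q r γ φ → (N : ℤ) ∣ γ 1 0 → (N : ℤ) ∣ γ 1 1 - d →
      φ = (jacobiSym ((-1) ^ r * (formMatrix Q).det) d : ℂ) := by
  induction d using induction_on_primes with
  | zero => exact fun h => absurd h (by decide)
  | one =>
    intro _ _ γ φ h hγ hd
    rw [jacobiSym.one_right, Int.cast_one]
    exact h.congr hQ hf hN (isMultiplier_one r) hγ (by simp) (by simpa using hd)
  | prime_mul p d hp ih =>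
    intro hodd hcop γ φ h hγ hd
    obtain ⟨hpo, hdo⟩ := Nat.odd_mul.mp hodd
    have : NeZero p := ⟨hp.ne_zero⟩
    have : NeZero d := ⟨hdo.pos.ne'⟩
    rw [jacobiSym.mul_right, Int.cast_mul]
    refine h.eq_of_prime_mul hQ hf hN hcop hγ hd (fun h hγ hd => ?_)
      (ih hdo hcop.coprime_mul_left_right)
    refine h.eq_jacobiSym hQ hf hN hγ hp (fun h2 => ?_) ((dvd_sub_comm).mp hd)
    rw [h2] at hpo
    exact absurd hpo (by decide)

/-- The odd number N + 2 represents the class of 2 modulo N. The identity matrix has multiplier 1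
and 1 + 2N represents the class of 1, which supplies the value (D/(1+2N)) = 1 needed for
reciprocity. -/
theorem IsMultiplier.eq_chi_eight (hQ : Q.PosDef) {r : ℕ} (hf : f = 2 * r)
    (hN : IsLevel Q N) (hNodd : Odd N) {γ : SL(2, ℤ)} {φ : ℂ} (h : IsMultiplier Q r γ φ)
    (hγ : (N : ℤ) ∣ γ 1 0) (hd : (N : ℤ) ∣ γ 1 1 - 2) :
    φ = (ZMod.χ₈ (((-1) ^ r * (formMatrix Q).det : ℤ) : ZMod 8) : ℂ) := by
  have h1 := h.eq_jacobiSym_of_odd hQ hf hN (N + 2) (by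
      obtain ⟨t, rfl⟩ := hNodd
      exact ⟨t + 1, by ring⟩)
    (by simpa [Nat.coprime_comm] using (Nat.coprime_two_left.mpr hNodd).symm) hγ (by
      push_cast
      rw [show γ 1 1 - ((N : ℤ) + 2) = (γ 1 1 - 2) - N by ring]
      exact dvd_sub hd (dvd_refl _))
  have h2 := (isMultiplier_one (Q := Q) r).eq_jacobiSym_of_odd hQ hf hN (1 + 2 * N)
    ⟨N, by ring⟩ (by simp) (by simp) (by simp)
  have hdetodd : Odd (formMatrix Q).det := by
    rw [← Int.not_even_iff_odd, even_iff_two_dvd]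
    intro h2
    have := prime_dvd_level hN Nat.prime_two h2
    exact (Nat.not_even_iff_odd.mpr hNodd) (even_iff_two_dvd.mpr this)
  rw [h1, jacobiSym_add_two_eq ((Odd.pow (by decide)).mul hdetodd) hNodd (fun q hq hqd => ?_)
    (by exact_mod_cast h2.symm)]
  refine prime_dvd_level hN hq ?_
  rwa [(isUnit_neg_one.pow r).dvd_mul_left] at hqd

theorem IsMultiplier.eq_kronecker (hQ : Q.PosDef) {r : ℕ} (hf : f = 2 * r)
    (hN : IsLevel Q N) (d : ℕ) : d ≠ 0 → Nat.Coprime N d →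
    ∀ {γ : SL(2, ℤ)} {φ : ℂ}, IsMultiplier Q r γ φ → (N : ℤ) ∣ γ 1 0 → (N : ℤ) ∣ γ 1 1 - d →
      φ = (kronecker ((-1) ^ r * (formMatrix Q).det) d : ℂ) := by
  induction d using induction_on_primes with
  | zero => exact fun h => absurd rfl h
  | one =>
    intro _ _ γ φ h hγ hd
    rw [kronecker_one, Int.cast_one]
    exact h.congr hQ hf hN (isMultiplier_one r) hγ (by simp) (by simpa using hd)
  | prime_mul p d hp ih =>
    intro hne hcop γ φ h hγ hd
    have hd0 : d ≠ 0 := fun h => hne (by rw [h, mul_zero])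
    rw [kronecker_prime_mul _ hp hd0, Int.cast_mul]
    refine h.eq_of_prime_mul hQ hf hN hcop hγ hd (fun h hγ hd => ?_)
      (ih hd0 hcop.coprime_mul_left_right)
    split_ifs with h2
    · subst h2
      refine h.eq_chi_eight hQ hf hN ?_ hγ (by exact_mod_cast hd)
      exact Nat.coprime_two_right.mp hcop.coprime_mul_right_right
    · exact h.eq_jacobiSym hQ hf hN hγ hp h2 ((dvd_sub_comm).mp hd)

theorem IsMultiplier.eq_eps (hQ : Q.PosDef) {r : ℕ} (hf : f = 2 * r)
    (hN : IsLevel Q N) {γ : SL(2, ℤ)} {φ : ℂ} (h : IsMultiplier Q r γ φ) (hγ : (N : ℤ) ∣ γ 1 0) :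
    φ = (eps Q r (γ 1 1) : ℂ) := by
  have hcop : ∀ {γ : SL(2, ℤ)}, (N : ℤ) ∣ γ 1 0 → Nat.Coprime N (γ 1 1).natAbs := by
    intro γ hγ
    have h1 : IsCoprime (N : ℤ) (γ 1 1) := (isCoprime_bottom γ).of_isCoprime_of_dvd_left hγ
    have := Int.isCoprime_iff_gcd_eq_one.mp h1
    simpa [Int.gcd] using this
  rcases lt_trichotomy (γ 1 1) 0 with hd | hd | hd
  · rw [eps, if_neg (not_le.mpr hd)]
    have h1 := h.neg.eq_kronecker hQ hf hN (γ 1 1).natAbs (Int.natAbs_ne_zero.mpr hd.ne)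
      (hcop hγ) (by simpa using hγ) (by
        have : ((γ 1 1).natAbs : ℤ) = -γ 1 1 := by omega
        rw [this]
        simp)
    push_cast
    rw [← h1, ← mul_assoc, ← mul_pow]
    simp
  -- If d = 0, coprimality forces N = 1, so det A = ±1 and the symbol at 0 takes its conventional
  -- value 1.
  · have hN1 : N = 1 := by
      have := hcop hγ
      rw [hd] at this
      simpa using this
    have hdet : ((-1) ^ r * (formMatrix Q).det).natAbs = 1 := by
      have h1 := det_dvd_pow hN
      rw [hN1, Nat.cast_one, one_pow] at h1
      rw [Int.natAbs_mul, Int.natAbs_pow, Int.natAbs_neg, Int.natAbs_one, one_pow, one_mul]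
      exact Int.isUnit_iff_natAbs_eq.mp (isUnit_of_dvd_one h1)
    rw [hd, eps, if_pos le_rfl, Int.natAbs_zero, kronecker, if_pos rfl, if_pos hdet, Int.cast_one]
    exact h.congr hQ hf hN (isMultiplier_one r) hγ (by simp) (by rw [hN1]; simp)
  · rw [eps, if_pos hd.le]
    refine h.eq_kronecker hQ hf hN (γ 1 1).natAbs (Int.natAbs_ne_zero.mpr hd.ne') (hcop hγ) hγ ?_
    rw [show ((γ 1 1).natAbs : ℤ) = γ 1 1 by omega, sub_self]
    exact dvd_zero _

theorem isMultiplier_eps (hQ : Q.PosDef) {r : ℕ} (hf : f = 2 * r)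
    (hN : IsLevel Q N) {γ : SL(2, ℤ)} (hγ : (N : ℤ) ∣ γ 1 0) :
    IsMultiplier Q r γ (eps Q r (γ 1 1) : ℂ) := by
  obtain ⟨φ, hφ⟩ := exists_isMultiplier hQ hf hN hγ
  rwa [← hφ.eq_eps hQ hf hN hγ]

theorem level_dvd_of_mem {γ : SL(2, ℤ)} (hγ : γ ∈ CongruenceSubgroup.Gamma0 N) :
    (N : ℤ) ∣ γ 1 0 :=
  (ZMod.intCast_zmod_eq_zero_iff_dvd _ _).mp (CongruenceSubgroup.Gamma0_mem.mp hγ)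

/-- The character `γ ↦ ε(d)` of `Γ₀(N)`. -/
theorem exists_character (hQ : Q.PosDef) {r : ℕ} (hf : f = 2 * r) (hN : IsLevel Q N) :
    ∃ χ : CongruenceSubgroup.Gamma0 N →* ℂˣ,
      ∀ γ : CongruenceSubgroup.Gamma0 N, (χ γ : ℂ) = (eps Q r ((γ : SL(2, ℤ)) 1 1) : ℂ) := by
  let χ₀ : CongruenceSubgroup.Gamma0 N →* ℂ :=
    { toFun := fun γ => (eps Q r ((γ : SL(2, ℤ)) 1 1) : ℂ)
      map_one' := ((isMultiplier_one r).eq_eps hQ hf hN (by simp)).symm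
      map_mul' := fun γ₁ γ₂ => by
        have h1 := level_dvd_of_mem γ₁.2
        have h2 := level_dvd_of_mem γ₂.2
        refine ((isMultiplier_eps hQ hf hN h1).mul hQ hf hN (isMultiplier_eps hQ hf hN h2)
          h1 h2).eq_eps hQ hf hN ?_ |>.symm
        exact level_dvd_of_mem (γ₁ * γ₂).2 }
  exact ⟨χ₀.toHomUnits, fun γ => rfl⟩

end Character


open Matrix

/-! ### Estimates for the theta series -/

section Estimates

variable {f n : ℕ} {Q : QuadraticForm ℤ (Fin f → ℤ)}

/-- The vector `∑ zⱼ hⱼ`. -/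
def hvec (h : Fin n → Fin f → ℤ) (z : Fin n → ℂ) : Fin f → ℂ := ∑ j, z j • vecC (h j)

/-- The elliptic variables enter only through the vector ∑ zⱼhⱼ, so θ_h is a weighted version of Θ
restricted to a subspace. -/
theorem thetaTerm_eq (h : Fin n → Fin f → ℤ) (v : Fin f → ℂ) (k : ℕ) (τ : ℍ) (z : Fin n → ℂ)
    (m : Fin f → ℤ) : thetaTerm Q h v k τ z m =
      bilinC Q v (vecC m) ^ k * expI ((τ : ℂ) * (Q m : ℂ) + bilinC Q (vecC m) (hvec h z)) := by
  rw [thetaTerm, ← Complex.exp_sum, mul_assoc, ← Complex.exp_add, expI, hvec, bilinC_sum_right,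
    mul_add, Finset.mul_sum]
  congr 3
  · ring
  · refine Finset.sum_congr rfl fun j _ => ?_
    rw [bilinC_smul_right, bilinC_vecC]
    ring

theorem hvec_add (h : Fin n → Fin f → ℤ) (z w : Fin n → ℂ) :
    hvec h (z + w) = hvec h z + hvec h w := by
  simp [hvec, add_smul, Finset.sum_add_distrib]

theorem hvec_smul (h : Fin n → Fin f → ℤ) (a : ℂ) (z : Fin n → ℂ) :
    hvec h (a • z) = a • hvec h z := by
  simp [hvec, Finset.smul_sum, smul_smul]

theorem norm_hvec_le (h : Fin n → Fin f → ℤ) (z : Fin n → ℂ) :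
    ‖hvec h z‖ ≤ (∑ j, ‖vecC (h j)‖) * ‖z‖ := by
  rw [hvec, Finset.sum_mul]
  refine (norm_sum_le _ _).trans (Finset.sum_le_sum fun j _ => ?_)
  rw [norm_smul, mul_comm]
  gcongr
  exact norm_le_pi_norm z j

theorem norm_vecC (m : Fin f → ℤ) : ‖vecC m‖ = ‖m‖ := by
  simp only [Pi.norm_def, vecC]
  congr 2
  ext i
  simp

theorem exists_norm_bilinC_le (Q : QuadraticForm ℤ (Fin f → ℤ)) :
    ∃ C : ℝ, 0 ≤ C ∧ ∀ x y : Fin f → ℂ, ‖bilinC Q x y‖ ≤ C * ‖x‖ * ‖y‖ := by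
  refine ⟨∑ i, ∑ j, ‖((formMatrix Q i j : ℤ) : ℂ)‖, by positivity, fun x y => ?_⟩
  have h : bilinC Q x y = ∑ i, ∑ j, x i * (((formMatrix Q i j : ℤ) : ℂ) * y j) := by
    simp [bilinC, dotProduct, mulVec, Finset.mul_sum]
  rw [h, Finset.sum_mul, Finset.sum_mul]
  refine (norm_sum_le _ _).trans (Finset.sum_le_sum fun i _ => ?_)
  rw [Finset.sum_mul, Finset.sum_mul]
  refine (norm_sum_le _ _).trans (Finset.sum_le_sum fun j _ => ?_)
  rw [norm_mul, norm_mul, mul_left_comm, mul_assoc]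
  gcongr
  · exact norm_le_pi_norm x i
  · exact norm_le_pi_norm y j

theorem exists_le_form (hQ : Q.PosDef) :
    ∃ δ : ℝ, 0 < δ ∧ ∀ m : Fin f → ℤ, δ * ‖m‖ ^ 2 ≤ Q m := by
  obtain ⟨δ, hδ, h⟩ := (posDef_realMatrix hQ).exists_norm_sq_le
  refine ⟨δ / 2, by positivity, fun m => ?_⟩
  have h1 := h (vecR m)
  rw [norm_vecR] at h1
  have h2 := two_mul_form_real (Q := Q) m
  change _ = vecR m ⬝ᵥ realMatrix Q *ᵥ vecR m at h2
  linarith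

/-- A summable majorant of the theta series, uniform for `Im τ ≥ y` and `‖u‖ ≤ R`. -/
theorem exists_majorant (hQ : Q.PosDef) {y : ℝ} (hy : 0 < y) (R K : ℝ) (k : ℕ) :
    ∃ U : (Fin f → ℤ) → ℝ, Summable U ∧ ∀ (τ : ℂ) (u : Fin f → ℂ) (m : Fin f → ℤ), y ≤ τ.im →
      ‖u‖ ≤ R → (1 + ‖m‖) ^ k * Real.exp (K * ‖m‖) *
        ‖expI (τ * (Q m : ℂ) + bilinC Q (vecC m) u)‖ ≤ U m := by
  obtain ⟨δ, hδ, hle⟩ := exists_le_form hQ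
  obtain ⟨C, hC, hB⟩ := exists_norm_bilinC_le Q
  have hpi := Real.pi_pos
  refine ⟨_, summable_gaussian (δ := 2 * Real.pi * y * δ) (by positivity)
    (K + 2 * Real.pi * (C * R)) k, fun τ u m hτ hu => ?_⟩
  rw [mul_assoc]
  refine mul_le_mul_of_nonneg_left ?_ (by positivity)
  rw [norm_expI, ← Real.exp_add, Real.exp_le_exp]
  have h1 : (τ * (Q m : ℂ)).im = τ.im * Q m := by
    simp [Complex.mul_im]
  have h2 : |(bilinC Q (vecC m) u).im| ≤ C * ‖m‖ * R := by
    refine (Complex.abs_im_le_norm _).trans ((hB _ _).trans ?_)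
    rw [norm_vecC]
    gcongr
  have h3 : y * (δ * ‖m‖ ^ 2) ≤ τ.im * Q m :=
    mul_le_mul hτ (hle m) (by positivity) (hy.le.trans hτ)
  rw [Complex.add_im, h1]
  have h4 := neg_le_of_abs_le h2
  have h5 := mul_le_mul_of_nonneg_left (add_le_add h3 h4) (by positivity : 0 ≤ 2 * Real.pi)
  linarith

theorem exists_norm_pow_le (Q : QuadraticForm ℤ (Fin f → ℤ)) (v : Fin f → ℂ) (k : ℕ) :
    ∃ C : ℝ, 0 ≤ C ∧ ∀ m, ‖bilinC Q v (vecC m) ^ k‖ ≤ C * (1 + ‖m‖) ^ k := by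
  obtain ⟨C, hC, hB⟩ := exists_norm_bilinC_le Q
  refine ⟨(C * ‖v‖) ^ k, by positivity, fun m => ?_⟩
  rw [norm_pow, ← mul_pow]
  have := hB v (vecC m)
  rw [norm_vecC] at this
  refine pow_le_pow_left₀ (norm_nonneg _) (this.trans ?_) k
  gcongr
  linarith

theorem summable_mul_exp_mul_expI (hQ : Q.PosDef) {τ : ℂ} (hτ : 0 < τ.im) (u : Fin f → ℂ) (K : ℝ)
    (k : ℕ) : Summable fun m : Fin f → ℤ => (1 + ‖m‖) ^ k * Real.exp (K * ‖m‖) *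
      ‖expI (τ * (Q m : ℂ) + bilinC Q (vecC m) u)‖ := by
  obtain ⟨U, hU, hle⟩ := exists_majorant hQ hτ ‖u‖ K k
  exact Summable.of_nonneg_of_le (fun m => by positivity) (fun m => hle τ u m le_rfl le_rfl) hU

theorem summable_pow_mul_expI (hQ : Q.PosDef) (v : Fin f → ℂ) (k : ℕ) {τ : ℂ} (hτ : 0 < τ.im)
    (u : Fin f → ℂ) : Summable fun m : Fin f → ℤ =>
      bilinC Q v (vecC m) ^ k * expI (τ * (Q m : ℂ) + bilinC Q (vecC m) u) := by
  obtain ⟨C, hC, hle⟩ := exists_norm_pow_le Q v k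
  refine Summable.of_norm_bounded ((summable_mul_exp_mul_expI hQ hτ u 0 k).mul_left C) fun m => ?_
  rw [norm_mul, zero_mul, Real.exp_zero, mul_one, ← mul_assoc]
  gcongr
  exact hle m

theorem summable_thetaTerm (hQ : Q.PosDef) (h : Fin n → Fin f → ℤ) (v : Fin f → ℂ) (k : ℕ) (τ : ℍ)
    (z : Fin n → ℂ) : Summable (thetaTerm Q h v k τ z) :=
  (summable_pow_mul_expI hQ v k τ.im_pos (hvec h z)).congr fun m => (thetaTerm_eq h v k τ z m).symm

end Estimates

/-! ### Holomorphic functions on `ℍ × ℂⁿ` -/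

section Holomorphic

variable {f n : ℕ} {Q : QuadraticForm ℤ (Fin f → ℤ)}

theorem IsHol.const (a : ℂ) : IsHol (n := n) fun _ _ => a := differentiableOn_const _

theorem IsHol.mul {φ ψ : ℍ → (Fin n → ℂ) → ℂ} (hφ : IsHol φ) (hψ : IsHol ψ) :
    IsHol fun τ z => φ τ z * ψ τ z := DifferentiableOn.mul hφ hψ

theorem IsHol.pow {φ : ℍ → (Fin n → ℂ) → ℂ} (hφ : IsHol φ) (k : ℕ) :
    IsHol fun τ z => φ τ z ^ k := DifferentiableOn.pow hφ k

theorem IsHol.sum {ι : Type*} {s : Finset ι} {φ : ι → ℍ → (Fin n → ℂ) → ℂ}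
    (hφ : ∀ i ∈ s, IsHol (φ i)) : IsHol fun τ z => ∑ i ∈ s, φ i τ z :=
  DifferentiableOn.fun_sum hφ

theorem IsHol.bilinC_hvec (h : Fin n → Fin f → ℤ) (v : Fin f → ℂ) :
    IsHol fun _ z => bilinC Q (hvec h z) v := by
  unfold IsHol hvec
  simp only [bilinC_sum_left, bilinC_smul_left]
  fun_prop

/-- The linear functional `(τ, z) ↦ τ Q(m) + B(m, ∑ zⱼ hⱼ)`. -/
def phaseLin (Q : QuadraticForm ℤ (Fin f → ℤ)) (h : Fin n → Fin f → ℤ) (m : Fin f → ℤ) :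
    ℂ × (Fin n → ℂ) →ₗ[ℂ] ℂ where
  toFun p := p.1 * (Q m : ℂ) + bilinC Q (vecC m) (hvec h p.2)
  map_add' p q := by
    simp only [Prod.fst_add, Prod.snd_add, hvec_add, bilinC_add_right]
    ring
  map_smul' a p := by
    simp only [Prod.smul_fst, Prod.smul_snd, hvec_smul, bilinC_smul_right, smul_eq_mul,
      RingHom.id_apply]
    ring

theorem exists_norm_phaseLin_le (Q : QuadraticForm ℤ (Fin f → ℤ)) (h : Fin n → Fin f → ℤ) :
    ∃ C : ℝ, 0 ≤ C ∧ ∀ m p, ‖phaseLin Q h m p‖ ≤ C * (1 + ‖m‖) ^ 2 * ‖p‖ := by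
  obtain ⟨C, hC, hB⟩ := exists_norm_bilinC_le Q
  set D := ∑ j, ‖vecC (h j)‖ with hD
  have hD0 : 0 ≤ D := by positivity
  refine ⟨C + C * D, by positivity, fun m p => ?_⟩
  have h1 : ‖(Q m : ℂ)‖ ≤ C * (1 + ‖m‖) ^ 2 := by
    have h2 : ‖bilinC Q (vecC m) (vecC m) / 2‖ ≤ C * ‖m‖ * ‖m‖ := by
      have := hB (vecC m) (vecC m)
      rw [norm_vecC] at this
      rw [norm_div, Complex.norm_ofNat]
      linarith [norm_nonneg (bilinC Q (vecC m) (vecC m))]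
    rw [cast_form_eq_formC, formC]
    refine h2.trans ?_
    nlinarith [norm_nonneg m, mul_nonneg hC (norm_nonneg m)]
  have h2 : ‖bilinC Q (vecC m) (hvec h p.2)‖ ≤ C * D * (1 + ‖m‖) ^ 2 * ‖p‖ := by
    refine (hB _ _).trans ?_
    rw [norm_vecC]
    have h3 : ‖hvec h p.2‖ ≤ D * ‖p‖ :=
      (norm_hvec_le h p.2).trans (by gcongr; exact norm_snd_le p)
    have h4 : ‖m‖ ≤ (1 + ‖m‖) ^ 2 := by nlinarith [norm_nonneg m]
    calc C * ‖m‖ * ‖hvec h p.2‖ ≤ C * (1 + ‖m‖) ^ 2 * (D * ‖p‖) := by gcongr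
      _ = _ := by ring
  calc ‖phaseLin Q h m p‖ ≤ ‖p.1 * (Q m : ℂ)‖ + ‖bilinC Q (vecC m) (hvec h p.2)‖ :=
        norm_add_le _ _
    _ ≤ ‖p‖ * (C * (1 + ‖m‖) ^ 2) + C * D * (1 + ‖m‖) ^ 2 * ‖p‖ := by
        rw [norm_mul]
        gcongr
        exact norm_fst_le p
    _ = _ := by ring

/-- Termwise differentiation on a convex neighbourhood on which the derivatives have a common
summable majorant. -/
theorem isHol_theta (hQ : Q.PosDef) (h : Fin n → Fin f → ℤ) (v : Fin f → ℂ) (k : ℕ) :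
    IsHol (theta Q h v k) := by
  intro p₀ hp₀
  have hp₀' : 0 < p₀.1.im := hp₀
  obtain ⟨C, hC, hCle⟩ := exists_norm_phaseLin_le Q h
  obtain ⟨C', hC', hC'le⟩ := exists_norm_pow_le Q v k
  set D := ∑ j, ‖vecC (h j)‖ with hD
  have hD0 : 0 ≤ D := by positivity
  -- The factor B(v, m)^k costs k powers of 1 + ‖m‖, and differentiating the phase costs two more
  -- because Q(m) is quadratic.
  obtain ⟨U, hU, hUle⟩ := exists_majorant hQ (half_pos hp₀') (D * (‖p₀.2‖ + 1)) 0 (k + 2)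
  let s : Set (ℂ × (Fin n → ℂ)) := {p | p₀.1.im / 2 < p.1.im} ∩ {p | ‖p.2‖ < ‖p₀.2‖ + 1}
  have hsopen : IsOpen s :=
    (isOpen_lt continuous_const (Complex.continuous_im.comp continuous_fst)).inter
      (isOpen_lt continuous_snd.norm continuous_const)
  have hsconv : Convex ℝ s := by
    refine Convex.inter ?_ ?_
    · have := (convex_Ioi (p₀.1.im / 2)).linear_preimage
        (Complex.imLm ∘ₗ LinearMap.fst ℝ ℂ (Fin n → ℂ))
      exact this
    · intro x hx y hy a b ha hb hab
      have := convex_ball (0 : Fin n → ℂ) (‖p₀.2‖ + 1) (mem_ball_zero_iff.mpr hx)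
        (mem_ball_zero_iff.mpr hy) ha hb hab
      exact mem_ball_zero_iff.mp this
  have hp₀s : p₀ ∈ s := ⟨half_lt_self hp₀', show ‖p₀.2‖ < ‖p₀.2‖ + 1 from lt_add_one _⟩
  let L : (Fin f → ℤ) → ℂ × (Fin n → ℂ) →L[ℂ] ℂ := fun m =>
    (phaseLin Q h m).mkContinuous (C * (1 + ‖m‖) ^ 2) (hCle m)
  have hLnorm : ∀ m, ‖L m‖ ≤ C * (1 + ‖m‖) ^ 2 := fun m =>
    LinearMap.mkContinuous_norm_le _ (by positivity) _
  let F : (Fin f → ℤ) → ℂ × (Fin n → ℂ) → ℂ := fun m p =>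
    bilinC Q v (vecC m) ^ k * expI (L m p)
  have hF : ∀ m p, HasFDerivAt (F m)
      ((bilinC Q v (vecC m) ^ k * (expI (L m p) * (2 * Real.pi * Complex.I))) • L m) p := by
    intro m p
    have h1 : HasFDerivAt (fun p => expI (L m p))
        ((expI (L m p)) • ((2 * Real.pi * Complex.I : ℂ) • L m)) p :=
      ((L m).hasFDerivAt.const_mul _).cexp
    have h2 := h1.const_mul (bilinC Q v (vecC m) ^ k)
    refine h2.congr_fderiv (ContinuousLinearMap.ext fun q => ?_)
    change bilinC Q v (vecC m) ^ k * (expI (L m p) * (2 * Real.pi * Complex.I * L m q)) =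
      bilinC Q v (vecC m) ^ k * (expI (L m p) * (2 * Real.pi * Complex.I)) * L m q
    ring
  have hbound : ∀ m p, p ∈ s →
      ‖(bilinC Q v (vecC m) ^ k * (expI (L m p) * (2 * Real.pi * Complex.I))) • L m‖ ≤
        (C' * ‖(2 * Real.pi * Complex.I : ℂ)‖ * C) * U m := by
    intro m p hp
    have h1 := hUle p.1 (hvec h p.2) m hp.1.le
      ((norm_hvec_le h p.2).trans (mul_le_mul_of_nonneg_left (le_of_lt hp.2) hD0))
    rw [zero_mul, Real.exp_zero, mul_one] at h1
    rw [norm_smul, norm_mul, norm_mul]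
    calc ‖bilinC Q v (vecC m) ^ k‖ * (‖expI (L m p)‖ * ‖(2 * Real.pi * Complex.I : ℂ)‖) * ‖L m‖
        ≤ C' * (1 + ‖m‖) ^ k * (‖expI (L m p)‖ * ‖(2 * Real.pi * Complex.I : ℂ)‖) *
            (C * (1 + ‖m‖) ^ 2) := by
          gcongr
          · exact hC'le m
          · exact hLnorm m
      _ = (C' * ‖(2 * Real.pi * Complex.I : ℂ)‖ * C) *
            ((1 + ‖m‖) ^ (k + 2) * ‖expI (L m p)‖) := by ring
      _ ≤ _ := by
          gcongr
          exact h1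
  have hderiv := hasFDerivAt_tsum_of_isPreconnected (hU.mul_left _) hsopen hsconv.isPreconnected
    (fun m p _ => hF m p) hbound hp₀s (summable_pow_mul_expI hQ v k hp₀' (hvec h p₀.2)) hp₀s
  refine (hderiv.differentiableAt.congr_of_eventuallyEq ?_).differentiableWithinAt
  filter_upwards [hsopen.mem_nhds hp₀s] with p hp
  have hpim : 0 < p.1.im := (half_pos hp₀').trans hp.1
  refine tsum_congr fun m => ?_
  rw [thetaTerm_eq, UpperHalfPlane.ofComplex_apply_of_im_pos hpim]
  rfl

end Holomorphic

/-! ### The Gram matrix and the Fourier expansion -/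

section Fourier

variable {f n : ℕ} {Q : QuadraticForm ℤ (Fin f → ℤ)}

theorem form_nonneg (hQ : Q.PosDef) (m : Fin f → ℤ) : 0 ≤ Q m := by
  rcases eq_or_ne m 0 with rfl | hm
  · simp
  · exact (hQ m hm).le

theorem gram_eq (h : Fin n → Fin f → ℤ) :
    gram Q h = (Matrix.of fun i j => (h j i : ℝ))ᵀ * realMatrix Q *
      Matrix.of fun i j => (h j i : ℝ) := by
  ext i j
  rw [gram, of_apply, cast_bilinZ, dotProduct_mulVec]
  rfl

/-- An integral kernel vector x of G makes ∑ xⱼhⱼ isotropic, hence zero, against linear independence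
over ℤ. -/
theorem det_gram_ne_zero (hQ : Q.PosDef) {h : Fin n → Fin f → ℤ} (hh : LinearIndependent ℤ h) :
    (gram Q h).det ≠ 0 := by
  let GZ : Matrix (Fin n) (Fin n) ℤ := Matrix.of fun i j => bilinZ Q (h i) (h j)
  have hG : gram Q h = (Int.castRingHom ℝ).mapMatrix GZ := by
    ext i j
    simp [gram, GZ]
  rw [hG, ← RingHom.map_det]
  suffices GZ.det ≠ 0 by simpa using this
  intro h0
  obtain ⟨x, hx, hx0⟩ := Matrix.exists_mulVec_eq_zero_iff.mpr h0
  have h1 : ∀ i, bilinZ Q (h i) (∑ j, x j • h j) = 0 := by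
    intro i
    have h2 := congrFun hx0 i
    have h3 : bilinZ Q (h i) (∑ j, x j • h j) = (GZ *ᵥ x) i := by
      simp only [bilinZ_eq, mulVec_sum, dotProduct_sum, mulVec_smul, dotProduct_smul, smul_eq_mul]
      simp only [mulVec, dotProduct, GZ, of_apply, bilinZ_eq]
      exact Finset.sum_congr rfl fun j _ => mul_comm _ _
    rw [h3, h2]
    rfl
  have h2 : bilinZ Q (∑ j, x j • h j) (∑ j, x j • h j) = 0 := by
    conv_lhs => rw [bilinZ_eq, sum_dotProduct]
    refine Finset.sum_eq_zero fun i _ => ?_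
    rw [smul_dotProduct, ← bilinZ_eq, h1, smul_zero]
  have h3 : ∑ j, x j • h j = 0 := by
    by_contra hne
    have := hQ _ hne
    rw [bilinZ_eq, ← two_mul_form] at h2
    omega
  exact hx (funext fun i => Fintype.linearIndependent_iff.mp hh x h3 i)

theorem posDef_gram (hQ : Q.PosDef) {h : Fin n → Fin f → ℤ} (hh : LinearIndependent ℤ h) :
    (gram Q h).PosDef := by
  have hps : (gram Q h).PosSemidef := by
    have := (posDef_realMatrix hQ).posSemidef.conjTranspose_mul_mul_same
      (Matrix.of fun i j => (h j i : ℝ))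
    rwa [conjTranspose_eq_transpose_of_trivial, ← gram_eq] at this
  rw [hps.posDef_iff_isUnit, Matrix.isUnit_iff_isUnit_det, isUnit_iff_ne_zero]
  exact det_gram_ne_zero hQ hh

theorem posDef_half_gram (hQ : Q.PosDef) {h : Fin n → Fin f → ℤ} (hh : LinearIndependent ℤ h) :
    ((1 / 2 : ℝ) • gram Q h).PosDef :=
  (posDef_gram hQ hh).smul (by norm_num)

/-- With F = G/2 and y = F⁻¹ν, the vector Hy/2 is the orthogonal projection of m onto the span of
the hⱼ; the claim is nonnegativity of Q on the difference. -/
theorem discriminant_nonneg (hQ : Q.PosDef) {h : Fin n → Fin f → ℤ} (hh : LinearIndependent ℤ h)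
    (m : Fin f → ℤ) : 0 ≤ 4 * (Q m : ℝ) - quadR ((1 / 2 : ℝ) • gram Q h)⁻¹
      fun j => (bilinZ Q m (h j) : ℝ) := by
  set F := (1 / 2 : ℝ) • gram Q h with hF
  set ν : Fin n → ℝ := fun j => (bilinZ Q m (h j) : ℝ) with hν
  set y := F⁻¹ *ᵥ ν with hy
  have hFu : IsUnit F.det := (posDef_half_gram hQ hh).det_pos.ne'.isUnit
  have hFy : F *ᵥ y = ν := by
    rw [hy, mulVec_mulVec, mul_nonsing_inv _ hFu, one_mulVec]
  let H : Matrix (Fin f) (Fin n) ℝ := Matrix.of fun i j => (h j i : ℝ)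
  set A := realMatrix Q with hA
  have hHA : Hᵀ *ᵥ (A *ᵥ vecR m) = ν := by
    ext j
    rw [hν]
    simp only
    rw [bilinZ_comm, cast_bilinZ]
    rfl
  have hg : Hᵀ *ᵥ (A *ᵥ (H *ᵥ y)) = (2 : ℝ) • ν := by
    rw [mulVec_mulVec, mulVec_mulVec, ← gram_eq, ← hFy, hF, smul_mulVec, smul_smul]
    norm_num
  have hAt : ∀ a b : Fin f → ℝ, a ⬝ᵥ A *ᵥ b = b ⬝ᵥ A *ᵥ a := by
    intro a b
    rw [dotProduct_mulVec, ← mulVec_transpose, hA, realMatrix_transpose, dotProduct_comm]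
  have hHd : ∀ (a : Fin n → ℝ) (b : Fin f → ℝ), (H *ᵥ a) ⬝ᵥ b = a ⬝ᵥ Hᵀ *ᵥ b := by
    intro a b
    rw [dotProduct_mulVec, vecMul_transpose]
  have h0 := realMatrix_nonneg hQ (vecR m - (1 / 2 : ℝ) • H *ᵥ y)
  rw [← hA, mulVec_sub, dotProduct_sub, sub_dotProduct, sub_dotProduct, mulVec_smul,
    dotProduct_smul, smul_dotProduct, smul_dotProduct, dotProduct_smul, hAt (vecR m) (H *ᵥ y),
    hHd, hHd, hHA, hg, dotProduct_smul] at h0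
  have h1 := two_mul_form_real (Q := Q) m
  change _ = vecR m ⬝ᵥ A *ᵥ vecR m at h1
  rw [← h1] at h0
  have h2 : quadR F⁻¹ ν = y ⬝ᵥ ν := by rw [quadR, dotProduct_comm]
  rw [h2]
  simp only [smul_eq_mul] at h0
  linarith

/-- The pair of exponents `(Q(m), (B(m, hⱼ))ⱼ)` belonging to the summation index `m`. -/
def exponents (Q : QuadraticForm ℤ (Fin f → ℤ)) (h : Fin n → Fin f → ℤ) (m : Fin f → ℤ) :
    ℚ × (Fin n → ℤ) := ((Q m : ℚ), fun j => bilinZ Q m (h j))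

/-- The Fourier coefficients of the theta series. -/
def fourierCoef (Q : QuadraticForm ℤ (Fin f → ℤ)) (h : Fin n → Fin f → ℤ) (v : Fin f → ℂ) (k : ℕ)
    (ℓ : ℚ) (ν : Fin n → ℤ) : ℂ :=
  ∑' m : {m // exponents Q h m = (ℓ, ν)}, bilinC Q v (vecC m.1) ^ k

theorem exists_of_fourierCoef_ne_zero {h : Fin n → Fin f → ℤ} {v : Fin f → ℂ} {k : ℕ} {ℓ : ℚ}
    {ν : Fin n → ℤ} (hne : fourierCoef Q h v k ℓ ν ≠ 0) :
    ∃ m : Fin f → ℤ, ℓ = (Q m : ℚ) ∧ ν = fun j => bilinZ Q m (h j) := by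
  by_contra hcon
  refine hne ?_
  have : IsEmpty {m // exponents Q h m = (ℓ, ν)} :=
    ⟨fun m => hcon ⟨m.1, (congrArg Prod.fst m.2).symm, (congrArg Prod.snd m.2).symm⟩⟩
  rw [fourierCoef, tsum_empty]

/-- Absolute convergence allows regrouping the theta series along the fibres of m ↦ (Q(m), (B(m,
hⱼ))ⱼ), on which the exponential is constant. -/
theorem hasSum_fourier (hQ : Q.PosDef) (h : Fin n → Fin f → ℤ) (v : Fin f → ℂ) (k : ℕ) (τ : ℍ)
    (z : Fin n → ℂ) : HasSum (fun p : ℚ × (Fin n → ℤ) =>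
      fourierCoef Q h v k p.1 p.2 * Complex.exp (2 * Real.pi * Complex.I * (p.1 : ℂ) * (τ : ℂ)) *
        Complex.exp (2 * Real.pi * Complex.I * (z ⬝ᵥ vecC p.2))) (theta Q h v k τ z) := by
  have hs := summable_thetaTerm hQ h v k τ z
  have h1 := (Equiv.sigmaFiberEquiv (exponents Q h)).hasSum_iff.mpr hs.hasSum
  refine hasSum_of_eq (h1.sigma fun p =>
    ((Equiv.sigmaFiberEquiv (exponents Q h)).summable_iff.mpr hs).sigma_factor p |>.hasSum)
    fun p => ?_
  rw [fourierCoef, mul_assoc, ← tsum_mul_right]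
  refine tsum_congr fun m => ?_
  obtain ⟨m, hm⟩ := m
  obtain ⟨ℓ, ν⟩ := p
  obtain ⟨rfl, rfl⟩ : (Q m : ℚ) = ℓ ∧ (fun j => bilinZ Q m (h j)) = ν := Prod.ext_iff.mp hm
  simp only [Function.comp_apply, Equiv.sigmaFiberEquiv_apply]
  rw [thetaTerm, ← Complex.exp_sum, mul_assoc (bilinC Q v (vecC m) ^ k)]
  congr 3
  · push_cast
    ring
  · simp only [dotProduct, vecC, Finset.mul_sum]
    exact Finset.sum_congr rfl fun j _ => by ring

theorem hasJacobiExpansion_theta (hQ : Q.PosDef) {h : Fin n → Fin f → ℤ}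
    (hh : LinearIndependent ℤ h) (v : Fin f → ℂ) (k : ℕ) :
    HasJacobiExpansion ((1 / 2 : ℝ) • gram Q h) (fourierCoef Q h v k) (theta Q h v k) := by
  refine ⟨fun ℓ ν hne => ?_, hasSum_fourier hQ h v k⟩
  obtain ⟨m, rfl, rfl⟩ := exists_of_fourierCoef_ne_zero hne
  refine ⟨by exact_mod_cast form_nonneg hQ m, ?_⟩
  have := discriminant_nonneg hQ hh m
  exact_mod_cast this

end Fourier


open Matrix

/-! ### Entire power series -/

section PowerSeries

/-- Uniqueness of power series; it converts identities between generating functions in w into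
identities for each k. -/
theorem coeff_eq_of_hasSum_pow {a b : ℕ → ℂ} {F : ℂ → ℂ}
    (ha : ∀ w, HasSum (fun k => w ^ k * a k) (F w))
    (hb : ∀ w, HasSum (fun k => w ^ k * b k) (F w)) (k : ℕ) : a k = b k := by
  have key : ∀ a : ℕ → ℂ, (∀ w, HasSum (fun k => w ^ k * a k) (F w)) →
      HasFPowerSeriesAt F (FormalMultilinearSeries.ofScalars ℂ a) 0 := by
    intro a ha
    rw [hasFPowerSeriesAt_iff]
    refine Filter.Eventually.of_forall fun w => ?_
    rw [zero_add]
    refine hasSum_of_eq (ha w) fun k => ?_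
    rw [FormalMultilinearSeries.coeff_ofScalars, smul_eq_mul]
  have h := (key a ha).eq_formalMultilinearSeries (key b hb)
  have h1 := congrArg (fun p => p.coeff k) h
  simpa only [FormalMultilinearSeries.coeff_ofScalars] using h1

theorem hasSum_pow_mul_antidiagonal {a b : ℕ → ℂ} {w A B : ℂ}
    (ha : HasSum (fun k => w ^ k * a k) A) (hb : HasSum (fun k => w ^ k * b k) B) :
    HasSum (fun k => w ^ k * ∑ q ∈ Finset.HasAntidiagonal.antidiagonal k, a q.1 * b q.2) (A * B) := by
  have ha' := ha.summable.norm
  have hb' := hb.summable.norm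
  have h := (summable_norm_sum_mul_antidiagonal_of_summable_norm ha' hb').of_norm.hasSum
  rw [← tsum_mul_tsum_eq_tsum_sum_antidiagonal_of_summable_norm ha' hb', ha.tsum_eq,
    hb.tsum_eq] at h
  refine hasSum_of_eq h fun k => ?_
  rw [Finset.mul_sum]
  refine Finset.sum_congr rfl fun q hq => ?_
  rw [← Finset.HasAntidiagonal.mem_antidiagonal.mp hq, pow_add]
  ring

/-- The coefficient of `w ^ k` in `exp (b w²)`. -/
def expSqCoef (b : ℂ) (k : ℕ) : ℂ := if Even k then b ^ (k / 2) / (k / 2).factorial else 0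

/-- The coefficient of `w ^ k` in `exp (a w + b w²)`. -/
def expQuadCoef (a b : ℂ) (k : ℕ) : ℂ :=
  ∑ p ∈ Finset.HasAntidiagonal.antidiagonal k, a ^ p.1 / p.1.factorial * expSqCoef b p.2

/-- The part of `expQuadCoef a b k` that is homogeneous of degree `j` in `(a, b)`. -/
def expQuadCoefPart (a b : ℂ) (k j : ℕ) : ℂ :=
  ∑ p ∈ Finset.HasAntidiagonal.antidiagonal k,
    if p.1 + p.2 / 2 = j then a ^ p.1 / p.1.factorial * expSqCoef b p.2 else 0

theorem hasSum_exp (x : ℂ) : HasSum (fun k : ℕ => x ^ k / k.factorial) (Complex.exp x) := by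
  rw [Complex.exp_eq_exp_ℂ]
  exact NormedSpace.expSeries_div_hasSum_exp x

theorem hasSum_exp_mul (a w : ℂ) :
    HasSum (fun k : ℕ => w ^ k * (a ^ k / k.factorial)) (Complex.exp (a * w)) :=
  hasSum_of_eq (hasSum_exp (a * w)) fun k => by rw [mul_pow]; ring

theorem hasSum_expSqCoef (b w : ℂ) :
    HasSum (fun k => w ^ k * expSqCoef b k) (Complex.exp (b * w ^ 2)) := by
  have hinj : Function.Injective fun j : ℕ => 2 * j := fun i j h => by simpa using h
  refine (hinj.hasSum_iff fun k hk => ?_).mp (hasSum_of_eq (hasSum_exp (b * w ^ 2)) fun j => ?_)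
  · rw [expSqCoef, if_neg, mul_zero]
    rintro ⟨j, rfl⟩
    exact hk ⟨j, two_mul j⟩
  · simp only [Function.comp_apply, expSqCoef, even_two_mul, if_true]
    rw [Nat.mul_div_cancel_left j two_pos, pow_mul, mul_pow]
    ring

theorem hasSum_expQuadCoef (a b w : ℂ) :
    HasSum (fun k => w ^ k * expQuadCoef a b k) (Complex.exp (a * w + b * w ^ 2)) := by
  rw [Complex.exp_add]
  exact hasSum_pow_mul_antidiagonal (a := fun k => a ^ k / k.factorial) (b := expSqCoef b)
    (hasSum_exp_mul a w) (hasSum_expSqCoef b w)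

theorem expSqCoef_mul (x b : ℂ) (k : ℕ) : expSqCoef (x * b) k = x ^ (k / 2) * expSqCoef b k := by
  unfold expSqCoef
  split_ifs
  · rw [mul_pow, mul_div_assoc]
  · rw [mul_zero]

/-- The coefficient of w^k is a polynomial in x: the pair p contributes in degree p.1 + p.2/2 ≤ k,
so any range up to t ≥ k captures it. -/
theorem expQuadCoef_mul (x a b : ℂ) {k t : ℕ} (hk : k ≤ t) :
    expQuadCoef (x * a) (x * b) k =
      ∑ j ∈ Finset.range (t + 1), expQuadCoefPart a b k j * x ^ j := by
  simp only [expQuadCoef, expQuadCoefPart, Finset.sum_mul]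
  rw [Finset.sum_comm]
  refine Finset.sum_congr rfl fun p hp => ?_
  have hp' := Finset.HasAntidiagonal.mem_antidiagonal.mp hp
  simp only [ite_mul, zero_mul]
  rw [Finset.sum_ite_eq, if_pos (Finset.mem_range.mpr (by omega)), expSqCoef_mul, mul_pow, pow_add]
  ring

end PowerSeries

/-! ### The generating function and the modular law -/

section Modular

variable {f n : ℕ} {Q : QuadraticForm ℤ (Fin f → ℤ)}

/-- Expand e(wB(v, m)) in each term of Θ and exchange the sums over m and over powers of w. -/
theorem hasSum_theta (hQ : Q.PosDef) (h : Fin n → Fin f → ℤ) (v : Fin f → ℂ) (τ : ℍ)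
    (z : Fin n → ℂ) (w : ℂ) : HasSum
      (fun k : ℕ => w ^ k * ((2 * Real.pi * Complex.I) ^ k / k.factorial * theta Q h v k τ z))
      (thetaC Q τ (hvec h z + w • v)) := by
  obtain ⟨C, hC, hB⟩ := exists_norm_bilinC_le Q
  set ω : ℂ := 2 * Real.pi * Complex.I with hω
  let F : (Fin f → ℤ) × ℕ → ℂ := fun p =>
    w ^ p.2 * (ω ^ p.2 / p.2.factorial * thetaTerm Q h v p.2 τ z p.1)
  have hFeq : ∀ m k, F (m, k) = (ω * w * bilinC Q v (vecC m)) ^ k / k.factorial *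
      expI ((τ : ℂ) * (Q m : ℂ) + bilinC Q (vecC m) (hvec h z)) := by
    intro m k
    simp only [F]
    rw [thetaTerm_eq, mul_pow, mul_pow]
    ring
  have hF : ∀ m, HasSum (fun k => F (m, k))
      (expI ((τ : ℂ) * (Q m : ℂ) + bilinC Q (vecC m) (hvec h z + w • v))) := by
    intro m
    have h1 := (hasSum_exp (ω * w * bilinC Q v (vecC m))).mul_right
      (expI ((τ : ℂ) * (Q m : ℂ) + bilinC Q (vecC m) (hvec h z)))
    have h2 : expI ((τ : ℂ) * (Q m : ℂ) + bilinC Q (vecC m) (hvec h z + w • v)) =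
        Complex.exp (ω * w * bilinC Q v (vecC m)) *
          expI ((τ : ℂ) * (Q m : ℂ) + bilinC Q (vecC m) (hvec h z)) := by
      rw [expI, expI, ← Complex.exp_add, bilinC_add_right, bilinC_smul_right,
        bilinC_comm Q (vecC m) v]
      congr 1
      ring
    rw [h2]
    exact hasSum_of_eq h1 fun k => hFeq m k
  have hnorm : ∀ m, HasSum (fun k => ‖F (m, k)‖) (Real.exp (‖ω * w * bilinC Q v (vecC m)‖) *
      ‖expI ((τ : ℂ) * (Q m : ℂ) + bilinC Q (vecC m) (hvec h z))‖) := by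
    intro m
    have h1 := (NormedSpace.expSeries_div_hasSum_exp (‖ω * w * bilinC Q v (vecC m)‖)).mul_right
      ‖expI ((τ : ℂ) * (Q m : ℂ) + bilinC Q (vecC m) (hvec h z))‖
    rw [← Real.exp_eq_exp_ℝ] at h1
    have h2 : (fun k => ‖F (m, k)‖) = fun k : ℕ => ‖ω * w * bilinC Q v (vecC m)‖ ^ k / k.factorial *
        ‖expI ((τ : ℂ) * (Q m : ℂ) + bilinC Q (vecC m) (hvec h z))‖ := by
      funext k
      rw [hFeq, norm_mul, norm_div, norm_pow, Complex.norm_natCast]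
    rw [h2]
    exact h1
  -- Summing norms over powers of w first gives exp(|2πiw B(v, m)|), exponential in ‖m‖ at most
  -- linearly; this is why the majorant carries a factor exp(K‖m‖).
  have hs : Summable F := by
    refine Summable.of_norm ((summable_prod_of_nonneg fun p => norm_nonneg _).mpr
      ⟨fun m => (hnorm m).summable, ?_⟩)
    refine Summable.of_nonneg_of_le (fun m => tsum_nonneg fun k => norm_nonneg _) (fun m => ?_)
      (summable_mul_exp_mul_expI hQ τ.im_pos (hvec h z) (‖ω * w‖ * (C * ‖v‖)) 0)
    rw [(hnorm m).tsum_eq, pow_zero, one_mul]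
    gcongr
    rw [norm_mul, mul_assoc ‖ω * w‖]
    gcongr
    have := hB v (vecC m)
    rwa [norm_vecC] at this
  have h1 := hs.hasSum.prod_fiberwise hF
  have h2 := hs.prod_symm.hasSum.prod_fiberwise fun k => (hs.prod_symm.prod_factor k).hasSum
  have h3 : ∑' p : ℕ × (Fin f → ℤ), F p.swap = thetaC Q τ (hvec h z + w • v) := by
    exact ((Equiv.prodComm ℕ (Fin f → ℤ)).tsum_eq F).trans h1.tsum_eq.symm
  rw [h3] at h2
  refine hasSum_of_eq h2 fun k => ?_
  rw [theta, ← tsum_mul_left, ← tsum_mul_left]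
  rfl

theorem hvec_actZ (h : Fin n → Fin f → ℤ) (γ : SL(2, ℤ)) (τ : ℍ) (z : Fin n → ℂ) :
    hvec h (actZ γ τ z) = (autFactor γ τ)⁻¹ • hvec h z := by
  rw [← hvec_smul]
  congr 1
  ext j
  simp [actZ, div_eq_inv_mul]

/-- Apply the law for Θ at u = ∑ zⱼhⱼ + wv and compare coefficients of w^k. On the left w appears as
w/J, which accounts for the k extra factors J in the weight. -/
theorem theta_modular (hQ : Q.PosDef) (h : Fin n → Fin f → ℤ) (v : Fin f → ℂ) (k : ℕ) {r : ℕ}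
    {γ : SL(2, ℤ)} {φ : ℂ} (hφ : IsMultiplier Q r γ φ) (τ : ℍ) (z : Fin n → ℂ) :
    theta Q h v k (γ • τ) (actZ γ τ z) = φ * autFactor γ τ ^ (k + r) *
      expI (((γ 1 0 : ℤ) : ℂ) * formC Q (hvec h z) / autFactor γ τ) *
      ∑ q ∈ Finset.HasAntidiagonal.antidiagonal k,
        expQuadCoef (((γ 1 0 : ℤ) : ℂ) / autFactor γ τ *
            (2 * Real.pi * Complex.I * bilinC Q (hvec h z) v))
          (((γ 1 0 : ℤ) : ℂ) / autFactor γ τ * (2 * Real.pi * Complex.I * formC Q v)) q.1 *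
        (k.factorial / (q.2.factorial * (2 * Real.pi * Complex.I) ^ q.1) *
          theta Q h v q.2 τ z) := by
  set J := autFactor γ τ with hJ
  have hJ0 : J ≠ 0 := autFactor_ne_zero γ τ
  set c : ℂ := ((γ 1 0 : ℤ) : ℂ)
  set ω : ℂ := 2 * Real.pi * Complex.I with hω
  have hω0 : ω ≠ 0 := Complex.two_pi_I_ne_zero
  have hk0 : (k.factorial : ℂ) ≠ 0 := Nat.cast_ne_zero.mpr k.factorial_ne_zero
  set ψ := φ * J ^ r * expI (c * formC Q (hvec h z) / J) with hψ
  have h1 : ∀ w : ℂ, HasSum (fun k : ℕ => w ^ k * (J⁻¹ ^ k * (ω ^ k / k.factorial *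
      theta Q h v k (γ • τ) (actZ γ τ z))))
      (thetaC Q ((γ • τ : ℍ) : ℂ) (J⁻¹ • (hvec h z + w • v))) := by
    intro w
    have := hasSum_theta hQ h v (γ • τ) (actZ γ τ z) (J⁻¹ * w)
    rw [hvec_actZ, ← smul_smul, ← smul_add] at this
    refine hasSum_of_eq this fun k => ?_
    rw [mul_pow]
    ring
  have h2 : ∀ w : ℂ, HasSum (fun k : ℕ => w ^ k * (ψ * ∑ q ∈ Finset.HasAntidiagonal.antidiagonal k,
      expQuadCoef (c / J * (ω * bilinC Q (hvec h z) v)) (c / J * (ω * formC Q v)) q.1 *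
        (ω ^ q.2 / q.2.factorial * theta Q h v q.2 τ z)))
      (thetaC Q ((γ • τ : ℍ) : ℂ) (J⁻¹ • (hvec h z + w • v))) := by
    intro w
    have := (hasSum_pow_mul_antidiagonal (hasSum_expQuadCoef (c / J * (ω * bilinC Q (hvec h z) v))
      (c / J * (ω * formC Q v)) w) (hasSum_theta hQ h v τ z w)).mul_left ψ
    have he : thetaC Q ((γ • τ : ℍ) : ℂ) (J⁻¹ • (hvec h z + w • v)) = ψ *
        (Complex.exp (c / J * (ω * bilinC Q (hvec h z) v) * w + c / J * (ω * formC Q v) * w ^ 2) *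
          thetaC Q τ (hvec h z + w • v)) := by
      rw [hφ, hψ, formC_add, formC_smul, bilinC_smul_right, expI, expI, ← mul_assoc (_ * _ * _),
        mul_assoc (φ * _) (Complex.exp _) (Complex.exp _), ← Complex.exp_add]
      congr 3
      ring
    rw [he]
    exact hasSum_of_eq this fun k => by ring
  have h3 := coeff_eq_of_hasSum_pow h1 h2 k
  have h4 : theta Q h v k (γ • τ) (actZ γ τ z) = J ^ k * k.factorial / ω ^ k *
      (J⁻¹ ^ k * (ω ^ k / k.factorial * theta Q h v k (γ • τ) (actZ γ τ z))) := by
    rw [inv_pow]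
    field_simp
  rw [h4, h3, hψ, Finset.mul_sum, Finset.mul_sum, Finset.mul_sum]
  refine Finset.sum_congr rfl fun q hq => ?_
  have hq' := Finset.HasAntidiagonal.mem_antidiagonal.mp hq
  have hq0 : (q.2.factorial : ℂ) ≠ 0 := Nat.cast_ne_zero.mpr q.2.factorial_ne_zero
  rw [← hq'] at hk0 ⊢
  field_simp
  ring

theorem expQuadCoef_zero (k : ℕ) : expQuadCoef 0 0 k = if k = 0 then 1 else 0 := by
  refine coeff_eq_of_hasSum_pow (b := fun k => if k = 0 then 1 else 0) (F := fun _ => 1)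
    (fun w => ?_) (fun w => ?_) k
  · simpa using hasSum_expQuadCoef 0 0 w
  · convert hasSum_ite_eq 0 (1 : ℂ) using 2 with j
    split_ifs with hj <;> simp [hj]

/-- Both coefficients in exp(αw + βw²) vanish, so only the term with q = (0, k) is left. -/
theorem theta_modular_of_isotropic (hQ : Q.PosDef) {h : Fin n → Fin f → ℤ} {v : Fin f → ℂ} (k : ℕ)
    {r : ℕ} {γ : SL(2, ℤ)} {φ : ℂ} (hφ : IsMultiplier Q r γ φ) (hv : formC Q v = 0)
    (hvh : ∀ j, bilinC Q v (vecC (h j)) = 0) (τ : ℍ) (z : Fin n → ℂ) :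
    theta Q h v k (γ • τ) (actZ γ τ z) = φ * autFactor γ τ ^ (k + r) *
      expI (((γ 1 0 : ℤ) : ℂ) * formC Q (hvec h z) / autFactor γ τ) * theta Q h v k τ z := by
  have hB : bilinC Q (hvec h z) v = 0 := by
    rw [bilinC_comm, hvec, bilinC_sum_right]
    exact Finset.sum_eq_zero fun j _ => by rw [bilinC_smul_right, hvh, mul_zero]
  have hk0 : (k.factorial : ℂ) ≠ 0 := Nat.cast_ne_zero.mpr k.factorial_ne_zero
  rw [theta_modular hQ h v k hφ, hB, hv]
  simp only [mul_zero, expQuadCoef_zero, ite_mul, zero_mul, one_mul]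
  rw [Finset.sum_eq_single (0, k)]
  · simp [hk0]
  · rintro ⟨i, j⟩ hij hne
    rw [if_neg]
    rintro rfl
    refine hne ?_
    simpa using hij
  · simp

/-- The coefficient functions of the quasi-modular transformation law. -/
def quasiCoef (Q : QuadraticForm ℤ (Fin f → ℤ)) (h : Fin n → Fin f → ℤ) (v : Fin f → ℂ) (k j : ℕ)
    (τ : ℍ) (z : Fin n → ℂ) : ℂ :=
  ∑ q ∈ Finset.HasAntidiagonal.antidiagonal k,
    expQuadCoefPart (2 * Real.pi * Complex.I * bilinC Q (hvec h z) v)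
        (2 * Real.pi * Complex.I * formC Q v) q.1 j *
      (k.factorial / (q.2.factorial * (2 * Real.pi * Complex.I) ^ q.1) * theta Q h v q.2 τ z)

theorem isHol_quasiCoef (hQ : Q.PosDef) (h : Fin n → Fin f → ℤ) (v : Fin f → ℂ) (k j : ℕ) :
    IsHol (quasiCoef Q h v k j) := by
  refine IsHol.sum fun q _ => IsHol.mul (IsHol.sum fun p _ => ?_)
    ((IsHol.const _).mul (isHol_theta hQ h v q.2))
  split_ifs
  · simp only [div_eq_mul_inv]
    exact ((((IsHol.const _).mul (IsHol.bilinC_hvec h v)).pow _).mul (IsHol.const _)).mul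
      (IsHol.const _)
  · exact IsHol.const _

theorem theta_quasi_modular (hQ : Q.PosDef) (h : Fin n → Fin f → ℤ) (v : Fin f → ℂ) (k : ℕ) {r : ℕ}
    {γ : SL(2, ℤ)} {φ : ℂ} (hφ : IsMultiplier Q r γ φ) (τ : ℍ) (z : Fin n → ℂ) :
    theta Q h v k (γ • τ) (actZ γ τ z) = φ * autFactor γ τ ^ (k + r) *
      expI (((γ 1 0 : ℤ) : ℂ) * formC Q (hvec h z) / autFactor γ τ) *
      ∑ j ∈ Finset.range (k + 1), quasiCoef Q h v k j τ z *
        (((γ 1 0 : ℤ) : ℂ) / autFactor γ τ) ^ j := by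
  rw [theta_modular hQ h v k hφ]
  congr 1
  simp only [quasiCoef, Finset.sum_mul]
  rw [Finset.sum_comm]
  refine Finset.sum_congr rfl fun q hq => ?_
  have hq' := Finset.HasAntidiagonal.mem_antidiagonal.mp hq
  rw [expQuadCoef_mul _ _ _ (show q.1 ≤ k by omega), Finset.sum_mul]
  exact Finset.sum_congr rfl fun j _ => by ring

end Modular


open Matrix

/-! ### The elliptic law -/

section Elliptic

variable {f n : ℕ} {Q : QuadraticForm ℤ (Fin f → ℤ)}

theorem hvec_vecC (h : Fin n → Fin f → ℤ) (l : Fin n → ℤ) :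
    hvec h (vecC l) = vecC (∑ j, l j • h j) := by
  ext i
  simp [hvec, vecC]

theorem hvec_shiftZ (h : Fin n → Fin f → ℤ) (τ : ℍ) (z : Fin n → ℂ) (l μ : Fin n → ℤ) :
    hvec h (shiftZ τ z l μ) =
      hvec h z + (τ : ℂ) • vecC (∑ j, l j • h j) + vecC (∑ j, μ j • h j) := by
  rw [← hvec_vecC, ← hvec_vecC, ← hvec_smul, ← hvec_add, ← hvec_add]
  congr 1
  ext j
  simp [shiftZ, vecC, mul_comm]

theorem bilinC_vecC_sum (h : Fin n → Fin f → ℤ) (v : Fin f → ℂ) (l : Fin n → ℤ) :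
    bilinC Q v (vecC (∑ j, l j • h j)) = ∑ j, (l j : ℂ) * bilinC Q v (vecC (h j)) := by
  rw [← hvec_vecC, hvec, bilinC_sum_right]
  exact Finset.sum_congr rfl fun j _ => bilinC_smul_right _ _ _ _

/-- With ℓ = ∑ λⱼhⱼ, the prefactor completes τQ(m) + τB(m, ℓ) to τQ(m + ℓ), and μ contributes an
integer to the exponent. Re-indexing by m + ℓ replaces B(v, m) by B(v, m) - B(v, ℓ), whose k-th
power is expanded binomially. -/
theorem theta_shiftZ (hQ : Q.PosDef) (h : Fin n → Fin f → ℤ) (v : Fin f → ℂ) (k : ℕ) (τ : ℍ)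
    (z : Fin n → ℂ) (l μ : Fin n → ℤ) :
    expI ((τ : ℂ) * formC Q (hvec h (vecC l)) + bilinC Q (hvec h z) (hvec h (vecC l))) *
        theta Q h v k τ (shiftZ τ z l μ) =
      ∑ i ∈ Finset.range (k + 1), (k.choose i : ℂ) * theta Q h v i τ z *
        (∑ j, (l j : ℂ) * -bilinC Q v (vecC (h j))) ^ (k - i) := by
  set ℓ := ∑ j, l j • h j with hℓ
  have hy : ∑ j, (l j : ℂ) * -bilinC Q v (vecC (h j)) = -bilinC Q v (vecC ℓ) := by
    rw [hℓ, bilinC_vecC_sum, ← Finset.sum_neg_distrib]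
    exact Finset.sum_congr rfl fun j _ => mul_neg _ _
  rw [hvec_vecC, ← hℓ, hy, ← cast_form_eq_formC]
  set y := -bilinC Q v (vecC ℓ) with hydef
  have hterm : ∀ m : Fin f → ℤ, expI ((τ : ℂ) * (Q ℓ : ℂ) + bilinC Q (hvec h z) (vecC ℓ)) *
      thetaTerm Q h v k τ (shiftZ τ z l μ) m = (bilinC Q v (vecC (m + ℓ)) + y) ^ k *
        expI ((τ : ℂ) * (Q (m + ℓ) : ℂ) + bilinC Q (vecC (m + ℓ)) (hvec h z)) := by
    intro m
    rw [thetaTerm_eq, hvec_shiftZ, ← hℓ, vecC_add, bilinC_add_right Q v, hydef,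
      add_neg_cancel_right, mul_left_comm, ← expI_add, form_add]
    congr 1
    refine Eq.trans ?_ (expI_add_int _ (bilinZ Q m (∑ j, μ j • h j)))
    rw [← bilinC_vecC]
    congr 1
    push_cast
    rw [bilinC_add_right, bilinC_add_right, bilinC_add_left, bilinC_smul_right, bilinC_vecC Q m ℓ,
      bilinC_comm Q (hvec h z)]
    ring
  have hbin : ∀ m : Fin f → ℤ, (bilinC Q v (vecC m) + y) ^ k *
      expI ((τ : ℂ) * (Q m : ℂ) + bilinC Q (vecC m) (hvec h z)) =
      ∑ i ∈ Finset.range (k + 1), (k.choose i : ℂ) * thetaTerm Q h v i τ z m * y ^ (k - i) := by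
    intro m
    rw [add_pow, Finset.sum_mul]
    refine Finset.sum_congr rfl fun i _ => ?_
    rw [thetaTerm_eq]
    ring
  have hshift := (Equiv.addRight ℓ).tsum_eq fun m => (bilinC Q v (vecC m) + y) ^ k *
    expI ((τ : ℂ) * (Q m : ℂ) + bilinC Q (vecC m) (hvec h z))
  rw [theta, ← tsum_mul_left, tsum_congr hterm]
  refine hshift.trans ?_
  rw [tsum_congr hbin]
  exact (hasSum_sum fun i _ =>
    ((summable_thetaTerm hQ h v i τ z).hasSum.mul_left _).mul_right _).tsum_eq

/-- The multinomial theorem summed over a fixed box of exponents with an indicator, because the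
quasi-elliptic law requires one box for all powers d ≤ k. -/
theorem sum_pow_eq_sum_piFinset {R : Type*} [CommSemiring R] (x : Fin n → R) {k d : ℕ}
    (hd : d ≤ k) : (∑ a, x a) ^ d =
      ∑ κ ∈ Fintype.piFinset fun _ : Fin n => Finset.range (k + 1),
        if ∑ a, κ a = d then (Nat.multinomial Finset.univ κ : R) * ∏ a, x a ^ κ a else 0 := by
  rw [Finset.sum_pow_eq_sum_piAntidiag, ← Finset.sum_filter]
  refine Finset.sum_congr ?_ fun _ _ => rfl
  ext κ
  simp only [Finset.mem_piAntidiag, Finset.mem_filter, Fintype.mem_piFinset, Finset.mem_range,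
    Finset.mem_univ, implies_true, and_true]
  refine ⟨fun hκ => ⟨fun a => ?_, hκ⟩, fun hκ => hκ.2⟩
  have : κ a ≤ ∑ i, κ i := Finset.single_le_sum (fun i _ => Nat.zero_le _) (Finset.mem_univ a)
  rw [hκ] at this
  omega

/-- The coefficient functions of the quasi-elliptic transformation law. -/
def ellipticCoef (Q : QuadraticForm ℤ (Fin f → ℤ)) (h : Fin n → Fin f → ℤ) (v : Fin f → ℂ) (k : ℕ)
    (κ : Fin n → ℕ) (τ : ℍ) (z : Fin n → ℂ) : ℂ :=
  ∑ i ∈ Finset.range (k + 1), (if ∑ a, κ a = k - i then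
    (k.choose i : ℂ) * (Nat.multinomial Finset.univ κ * ∏ a, (-bilinC Q v (vecC (h a))) ^ κ a)
    else 0) * theta Q h v i τ z

theorem isHol_ellipticCoef (hQ : Q.PosDef) (h : Fin n → Fin f → ℤ) (v : Fin f → ℂ) (k : ℕ)
    (κ : Fin n → ℕ) : IsHol (ellipticCoef Q h v k κ) :=
  IsHol.sum fun i _ => (IsHol.const _).mul (isHol_theta hQ h v i)

theorem theta_quasi_elliptic (hQ : Q.PosDef) (h : Fin n → Fin f → ℤ) (v : Fin f → ℂ) (k : ℕ)
    (τ : ℍ) (z : Fin n → ℂ) (l μ : Fin n → ℤ) :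
    expI ((τ : ℂ) * formC Q (hvec h (vecC l)) + bilinC Q (hvec h z) (hvec h (vecC l))) *
        theta Q h v k τ (shiftZ τ z l μ) =
      ∑ κ ∈ Fintype.piFinset fun _ : Fin n => Finset.range (k + 1),
        ellipticCoef Q h v k κ τ z * ∏ a, (l a : ℂ) ^ κ a := by
  rw [theta_shiftZ hQ]
  simp only [ellipticCoef, Finset.sum_mul]
  rw [Finset.sum_comm]
  refine Finset.sum_congr rfl fun i _ => ?_
  rw [sum_pow_eq_sum_piFinset _ (Nat.sub_le k i), Finset.mul_sum]
  refine Finset.sum_congr rfl fun κ _ => ?_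
  split_ifs
  · simp only [mul_pow, Finset.prod_mul_distrib]
    ring
  · ring

theorem theta_elliptic (hQ : Q.PosDef) {h : Fin n → Fin f → ℤ} {v : Fin f → ℂ} (k : ℕ)
    (hvh : ∀ j, bilinC Q v (vecC (h j)) = 0) (τ : ℍ) (z : Fin n → ℂ) (l μ : Fin n → ℤ) :
    theta Q h v k τ (shiftZ τ z l μ) =
      expI (-((τ : ℂ) * formC Q (hvec h (vecC l)) + bilinC Q (hvec h z) (hvec h (vecC l)))) *
        theta Q h v k τ z := by
  have h1 := theta_shiftZ hQ h v k τ z l μ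
  simp only [hvh, neg_zero, mul_zero, Finset.sum_const_zero] at h1
  rw [Finset.sum_eq_single k] at h1
  · rw [Nat.sub_self, pow_zero, mul_one, Nat.choose_self, Nat.cast_one, one_mul] at h1
    rw [← h1, ← mul_assoc, ← expI_add, neg_add_cancel, expI_zero, one_mul]
  · intro i hi hik
    have := Finset.mem_range.mp hi
    rw [zero_pow (by omega), mul_zero]
  · simp

end Elliptic

/-! ### Theta series as quasi-Jacobi forms -/

section Jacobi

variable {f n N : ℕ} {Q : QuadraticForm ℤ (Fin f → ℤ)}

theorem pairC_gram (h : Fin n → Fin f → ℤ) (z w : Fin n → ℂ) :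
    pairC (gram Q h) z w = bilinC Q (hvec h z) (hvec h w) := by
  simp only [pairC, hvec, bilinC_sum_left, bilinC_sum_right, bilinC_smul_left, bilinC_smul_right,
    bilinC_vecC, dotProduct, mulVec, Matrix.map_apply, gram, of_apply, Complex.ofReal_intCast,
    Finset.mul_sum]
  rw [Finset.sum_comm]
  exact Finset.sum_congr rfl fun i _ => Finset.sum_congr rfl fun j _ => by ring

theorem pairC_half_gram (h : Fin n → Fin f → ℤ) (z w : Fin n → ℂ) :
    pairC ((1 / 2 : ℝ) • gram Q h) z w = bilinC Q (hvec h z) (hvec h w) / 2 := by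
  rw [← pairC_gram]
  simp only [pairC, dotProduct, mulVec, Matrix.map_apply, Matrix.smul_apply, smul_eq_mul,
    Complex.ofReal_mul, Finset.mul_sum, Finset.sum_div]
  refine Finset.sum_congr rfl fun i _ => Finset.sum_congr rfl fun j _ => ?_
  push_cast
  ring

theorem isQuasiJacobiForm_theta (hQ : Q.PosDef) {r : ℕ} (hf : f = 2 * r) (hN : IsLevel Q N)
    {h : Fin n → Fin f → ℤ} (hh : LinearIndependent ℤ h) (v : Fin f → ℂ) (k : ℕ)
    {χ : CongruenceSubgroup.Gamma0 N →* ℂˣ}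
    (hχ : ∀ γ : CongruenceSubgroup.Gamma0 N, (χ γ : ℂ) = (eps Q r ((γ : SL(2, ℤ)) 1 1) : ℂ)) :
    IsQuasiJacobiForm (CongruenceSubgroup.Gamma0 N) χ ((k : ℤ) + (r : ℤ))
      ((1 / 2 : ℝ) • gram Q h) (theta Q h v k) := by
  -- All exponents are bounded by k. In the modular law only i = 0 is needed: the dependence on z
  -- through B(∑ zⱼhⱼ, v) is holomorphic and sits inside S, leaving pure powers of c/J.
  refine ⟨posDef_half_gram hQ hh, isHol_theta hQ h v k, fun _ => k, k,
    fun i j τ z => if i = 0 then quasiCoef Q h v k j τ z else 0, ellipticCoef Q h v k,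
    fun i j => ?_, isHol_ellipticCoef hQ h v k, fun γ τ z => ?_, fun l μ τ z => ?_⟩
  · by_cases hi : i = 0
    · simpa only [hi, if_true] using isHol_quasiCoef hQ h v k j
    · simpa only [hi, if_false] using IsHol.const 0
  · have hJ := autFactor_ne_zero (γ : SL(2, ℤ)) τ
    rw [theta_quasi_modular hQ h v k (isMultiplier_eps hQ hf hN (level_dvd_of_mem γ.2)), hχ,
      Finset.sum_eq_single (0 : Fin n → ℕ)]
    · simp only [if_true, Pi.zero_apply, pow_zero, Finset.prod_const_one, mul_one]
      rw [pairC_half_gram, ← formC, Complex.exp_neg, ← expI, _root_.zpow_neg, ← Nat.cast_add,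
        zpow_natCast]
      have h1 := expI_ne_zero (((((γ : SL(2, ℤ)) 1 0 : ℤ) : ℂ) * formC Q (hvec h z)) /
        autFactor γ τ)
      field_simp
    · intro i _ hi
      simp [hi]
    · intro h0
      exact absurd (Fintype.mem_piFinset.mpr fun a => by simp) h0
  · rw [← theta_quasi_elliptic hQ h v k τ z l μ, pairC_half_gram, pairC_half_gram, ← formC, expI]
    congr 2
    ring

theorem theta_modular_exact (hQ : Q.PosDef) {r : ℕ} (hf : f = 2 * r) (hN : IsLevel Q N)
    {h : Fin n → Fin f → ℤ} {v : Fin f → ℂ} (k : ℕ) (hv : formC Q v = 0)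
    (hvh : ∀ j, bilinC Q v (vecC (h j)) = 0) {γ : SL(2, ℤ)}
    (hγ : γ ∈ CongruenceSubgroup.Gamma0 N) (τ : ℍ) (z : Fin n → ℂ) :
    theta Q h v k (γ • τ) (actZ γ τ z) = (eps Q r (γ 1 1) : ℂ) *
      Complex.exp (Real.pi * Complex.I * ((γ 1 0 : ℤ) : ℂ) * pairC (gram Q h) z z /
        autFactor γ τ) * autFactor γ τ ^ (k + r) * theta Q h v k τ z := by
  rw [theta_modular_of_isotropic hQ k (isMultiplier_eps hQ hf hN (level_dvd_of_mem hγ)) hv hvh,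
    pairC_gram, expI, formC, mul_right_comm (eps Q r (γ 1 1) : ℂ)]
  congr 4
  ring

theorem theta_elliptic_exact (hQ : Q.PosDef) {h : Fin n → Fin f → ℤ} {v : Fin f → ℂ} (k : ℕ)
    (hvh : ∀ j, bilinC Q v (vecC (h j)) = 0) (l μ : Fin n → ℤ) (τ : ℍ) (z : Fin n → ℂ) :
    theta Q h v k τ (shiftZ τ z l μ) =
      Complex.exp (-(Real.pi * Complex.I * (pairC (gram Q h) (vecC l) (vecC l) * (τ : ℂ) +
        2 * pairC (gram Q h) z (vecC l)))) * theta Q h v k τ z := by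
  rw [theta_elliptic hQ k hvh, pairC_gram, pairC_gram, expI, formC]
  congr 2
  ring

theorem isJacobiForm_theta (hQ : Q.PosDef) {r : ℕ} (hf : f = 2 * r) (hN : IsLevel Q N)
    {h : Fin n → Fin f → ℤ} (hh : LinearIndependent ℤ h) {v : Fin f → ℂ} (k : ℕ)
    (hv : formC Q v = 0) (hvh : ∀ j, bilinC Q v (vecC (h j)) = 0)
    {χ : CongruenceSubgroup.Gamma0 N →* ℂˣ}
    (hχ : ∀ γ : CongruenceSubgroup.Gamma0 N, (χ γ : ℂ) = (eps Q r ((γ : SL(2, ℤ)) 1 1) : ℂ)) :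
    IsJacobiForm (CongruenceSubgroup.Gamma0 N) χ ((k : ℤ) + (r : ℤ))
      ((1 / 2 : ℝ) • gram Q h) (theta Q h v k) := by
  refine ⟨posDef_half_gram hQ hh, isHol_theta hQ h v k, ⟨_, hasJacobiExpansion_theta hQ hh v k⟩,
    fun γ τ z => ?_, fun l μ τ z => ?_⟩
  · rw [theta_modular_exact hQ hf hN k hv hvh γ.2, hχ, pairC_half_gram, pairC_gram,
      ← Nat.cast_add, zpow_natCast, mul_right_comm (eps Q r _ : ℂ)]
    congr 3
    ring
  · rw [theta_elliptic_exact hQ k hvh, pairC_half_gram, pairC_half_gram, pairC_gram, pairC_gram]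
    congr 2
    ring

end Jacobi

end JacobiTheta

end

/-! ### The main theorem -/

theorem theorem1 {f r n : ℕ} (hf : f = 2 * r)
    (Q : QuadraticForm ℤ (Fin f → ℤ)) (hQ : Q.PosDef)
    (N : ℕ) (hN : JacobiTheta.IsLevel Q N)
    (h : Fin n → Fin f → ℤ) (hh : LinearIndependent ℤ h)
    (v : Fin f → ℂ) (k : ℕ) :
    -- the series converges absolutely
    (∀ (τ : ℍ) (z : Fin n → ℂ), Summable (JacobiTheta.thetaTerm Q h v k τ z)) ∧
    -- the character of `Γ₀(N)` given by `ε(d)`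
    ∃ χ : CongruenceSubgroup.Gamma0 N →* ℂˣ,
      (∀ γ : CongruenceSubgroup.Gamma0 N,
        (χ γ : ℂ) = (JacobiTheta.eps Q r ((γ : SL(2, ℤ)) 1 1) : ℂ)) ∧
      -- quasi-Jacobi form of weight `k + r` and index `G / 2`
      JacobiTheta.IsQuasiJacobiForm (CongruenceSubgroup.Gamma0 N) χ ((k : ℤ) + (r : ℤ))
        ((1 / 2 : ℝ) • JacobiTheta.gram Q h) (JacobiTheta.theta Q h v k) ∧
      -- Fourier expansion
      (∃ c : ℚ → (Fin n → ℤ) → ℂ,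
        JacobiTheta.HasJacobiExpansion ((1 / 2 : ℝ) • JacobiTheta.gram Q h) c
          (JacobiTheta.theta Q h v k) ∧
        ∀ (ℓ : ℚ) (ν : Fin n → ℤ), c ℓ ν ≠ 0 →
          ∃ m : Fin f → ℤ, ℓ = (Q m : ℚ) ∧ ν = fun j => JacobiTheta.bilinZ Q m (h j)) ∧
      (∀ m : Fin f → ℤ,
        0 ≤ 4 * (Q m : ℝ) - JacobiTheta.quadR ((1 / 2 : ℝ) • JacobiTheta.gram Q h)⁻¹
          (fun j => (JacobiTheta.bilinZ Q m (h j) : ℝ))) ∧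
      -- the exact transformation laws
      (JacobiTheta.formC Q v = 0 →
        (∀ j, JacobiTheta.bilinC Q v (JacobiTheta.vecC (h j)) = 0) →
        (∀ γ : SL(2, ℤ), γ ∈ CongruenceSubgroup.Gamma0 N → ∀ (τ : ℍ) (z : Fin n → ℂ),
          JacobiTheta.theta Q h v k (γ • τ) (JacobiTheta.actZ γ τ z) =
            (JacobiTheta.eps Q r (γ 1 1) : ℂ) *
              Complex.exp (Real.pi * Complex.I * ((γ 1 0 : ℤ) : ℂ) *
                JacobiTheta.pairC (JacobiTheta.gram Q h) z z / JacobiTheta.autFactor γ τ) *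
              JacobiTheta.autFactor γ τ ^ (k + r) * JacobiTheta.theta Q h v k τ z) ∧
        (∀ (l μ : Fin n → ℤ) (τ : ℍ) (z : Fin n → ℂ),
          JacobiTheta.theta Q h v k τ (JacobiTheta.shiftZ τ z l μ) =
            Complex.exp (-(Real.pi * Complex.I *
              (JacobiTheta.pairC (JacobiTheta.gram Q h) (JacobiTheta.vecC l)
                  (JacobiTheta.vecC l) * (τ : ℂ) +
                2 * JacobiTheta.pairC (JacobiTheta.gram Q h) z (JacobiTheta.vecC l)))) *
              JacobiTheta.theta Q h v k τ z) ∧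
        JacobiTheta.IsJacobiForm (CongruenceSubgroup.Gamma0 N) χ ((k : ℤ) + (r : ℤ))
          ((1 / 2 : ℝ) • JacobiTheta.gram Q h) (JacobiTheta.theta Q h v k)) := by
  obtain ⟨χ, hχ⟩ := JacobiTheta.exists_character hQ hf hN
  exact ⟨JacobiTheta.summable_thetaTerm hQ h v k, χ, hχ,
    JacobiTheta.isQuasiJacobiForm_theta hQ hf hN hh v k hχ,
    ⟨JacobiTheta.fourierCoef Q h v k, JacobiTheta.hasJacobiExpansion_theta hQ hh v k,
      fun _ _ => JacobiTheta.exists_of_fourierCoef_ne_zero⟩,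
    JacobiTheta.discriminant_nonneg hQ hh,
    fun hv hvh => ⟨fun _ hγ => JacobiTheta.theta_modular_exact hQ hf hN k hv hvh hγ,
      JacobiTheta.theta_elliptic_exact hQ k hvh,
      JacobiTheta.isJacobiForm_theta hQ hf hN hh k hv hvh hχ⟩⟩
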